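/- Let $\sigma_1,\sigma_2,\sigma_3$ be the Pauli matrices. For $\beta\in\mathbb R^3$ put $H_\beta=\sum_j\beta_j\,\sigma_j\otimes\sigma_j$ and $U_\beta=e^{-iH_\beta}$. *Hamiltonian and canonical parameters.* Let $H_d(t)=\sum_{i,j}M_{ij}(t)\,\sigma_i\otimes\sigma_j$, where the real functions $M_{ij}$ are integrable on $[0,T]$ for every $T\ge 0$. For each $t\ge0$ let $\theta^{H_d(t)}\in\mathbb R^3$ be the canonical parameters of $H_d(t)$: $\theta_1\ge\theta_2\ge|\theta_3|$ and $H_d(t)=(A\otimes B)^\dagger H_{\theta}(A\otimes B)$ for some $A,B\in U(2)$. Let $U$ be a two-qubit gate (a unitary on $\mathbb C^2\otimes\mathbb C^2$, considered up to a global phase) with canonical parameters $\theta^U$: $\frac{\pi}{4}\ge\theta_1^U\ge\theta_2^U\ge|\theta_3^U|$ and $U=(A_1\otimes B_1)U_{\theta^U}(A_2\otimes B_2)$ for some $A_1,B_1,A_2,B_2\in U(2)$ (any such vector $\theta^U$). *Generation within time $T$.* Consider the control system $$\dot V(t)=-i\Big[H_d(t)+\sum_j\big(a_j(t)\,\sigma_j\otimes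 I+b_j(t)\,I\otimes\sigma_j\big)\Big]V(t),\qquad V(0)=I,$$ with arbitrary integrable, not necessarily bounded, real controls $a_j,b_j$. The gate $U$ can be generated within time $T\ge0$ using $H_d$ and fast local unitaries if, for some $c\in\mathbb C$ with $|c|=1$ and every $\delta>0$, $cU$ is a limit of unitaries that the system reaches at times at most $T+\delta$. *$s$-majorization.* For $x\in\mathbb R^3$ let $x_1^s\ge x_2^s\ge|x_3^s|$ be the numbers $|x_1|,|x_2|,|x_3|$ in decreasing order, the last one multiplied by $\operatorname{sgn}(x_1x_2x_3)$. Write $x\prec_s y$ if $x_1^s\le y_1^s$, $x_1^s+x_2^s+x_3^s\le y_1^s+y_2^s+y_3^s$ and $x_1^s+x_2^s-x_3^s\le y_1^s+y_2^s-y_3^s$. **Theorem.** 1. For every $T\ge0$, $U$ can be generated within time $T$ if and only if there is $n\in\mathbb Z^3$ with $$\theta^U+\tfrac{\pi}{2}n\ \prec_s\ \int_0^T\theta^{H_d(t)}\,dt .$$ 2. The minimum time for $U$, that is, the least $T\ge0$ such that $U$ can be generated within time $T$, is the least $T\ge0$ such that $$\theta^U\prec_s\int_0^T\theta^{H_d(t)}\,dt\quad\text{or}\quad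 \theta^U+\tfrac{\pi}{2}(-1,0,0)\prec_s\int_0^T\theta^{H_d(t)}\,dt$$ (if either of these two minima exists, so does the other, and they are equal). The minimum time exists whenever $U$ can be generated within some finite time. -/

import Mathlib

open scoped Kronecker

noncomputable section

namespace TwoQubit

/-- Operators on two qubits, as matrices in the computational basis `|i⟩ ⊗ |j⟩`. -/
abbrev Op : Type := Matrix (Fin 2 × Fin 2) (Fin 2 × Fin 2) ℂ

/-- The Pauli matrices `σ_x, σ_y, σ_z`. -/
def pauli : Fin 3 → Matrix (Fin 2) (Fin 2) ℂ :=
  ![!![0, 1; 1, 0], !![0, -Complex.I; Complex.I, 0], !![1, 0; 0, -1]]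

/-- The non-local Hamiltonian `∑ i j, M i j σ_i ⊗ σ_j` with coupling tensor `M`. -/
def couplingHam (M : Matrix (Fin 3) (Fin 3) ℝ) : Op :=
  ∑ i, ∑ j, (M i j : ℂ) • (pauli i ⊗ₖ pauli j)

/-- The local Hamiltonian `(a·σ) ⊗ I + I ⊗ (b·σ)`. -/
def localHam (a b : Fin 3 → ℝ) : Op :=
  ∑ i, ((a i : ℂ) • (pauli i ⊗ₖ (1 : Matrix (Fin 2) (Fin 2) ℂ)) +
    (b i : ℂ) • ((1 : Matrix (Fin 2) (Fin 2) ℂ) ⊗ₖ pauli i))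

/-- `H_β = β₁ σ_x ⊗ σ_x + β₂ σ_y ⊗ σ_y + β₃ σ_z ⊗ σ_z`. -/
def canonicalHam (β : Fin 3 → ℝ) : Op :=
  ∑ i, (β i : ℂ) • (pauli i ⊗ₖ pauli i)

/-- `U_β = exp (-i H_β)`. -/
def canonicalGate (β : Fin 3 → ℝ) : Op :=
  NormedSpace.exp ((-Complex.I) • canonicalHam β)

/-- `θ` is the vector of canonical parameters of the non-local Hamiltonian `H`:
`H = (A ⊗ B)† H_θ (A ⊗ B)` with single-qubit unitaries `A`, `B`, and `θ₁ ≥ θ₂ ≥ |θ₃|`. -/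
def IsHamParams (H : Op) (θ : Fin 3 → ℝ) : Prop :=
  |θ 2| ≤ θ 1 ∧ θ 1 ≤ θ 0 ∧
  ∃ A ∈ Matrix.unitaryGroup (Fin 2) ℂ, ∃ B ∈ Matrix.unitaryGroup (Fin 2) ℂ,
    H = (A ⊗ₖ B).conjTranspose * canonicalHam θ * (A ⊗ₖ B)

/-- `θ` is a vector of canonical parameters of the gate `U`:
`U = (A₁ ⊗ B₁) U_θ (A₂ ⊗ B₂)` with single-qubit unitaries, and `π/4 ≥ θ₁ ≥ θ₂ ≥ |θ₃|`. -/
def IsGateParams (U : Op) (θ : Fin 3 → ℝ) : Prop :=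
  |θ 2| ≤ θ 1 ∧ θ 1 ≤ θ 0 ∧ θ 0 ≤ Real.pi / 4 ∧
  ∃ A₁ ∈ Matrix.unitaryGroup (Fin 2) ℂ, ∃ B₁ ∈ Matrix.unitaryGroup (Fin 2) ℂ,
  ∃ A₂ ∈ Matrix.unitaryGroup (Fin 2) ℂ, ∃ B₂ ∈ Matrix.unitaryGroup (Fin 2) ℂ,
    U = (A₁ ⊗ₖ B₁) * canonicalGate θ * (A₂ ⊗ₖ B₂)

/-- `x^↓`: the entries of `x` in decreasing order. -/
def decreasing (x : Fin 3 → ℝ) : Fin 3 → ℝ :=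
  fun i => x (Tuple.sort x (Fin.rev i))

/-- The `s`-order version `x^s` of `x`: the absolute values in decreasing order, the last one
multiplied by the sign of `x₁ x₂ x₃`. -/
def sOrder (x : Fin 3 → ℝ) : Fin 3 → ℝ :=
  ![decreasing (fun i => |x i|) 0, decreasing (fun i => |x i|) 1,
    Real.sign (x 0 * x 1 * x 2) * decreasing (fun i => |x i|) 2]

/-- `x` is `s`-majorized by `y`. -/
def SMajorized (x y : Fin 3 → ℝ) : Prop :=
  sOrder x 0 ≤ sOrder y 0 ∧
  sOrder x 0 + sOrder x 1 + sOrder x 2 ≤ sOrder y 0 + sOrder y 1 + sOrder y 2 ∧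
  sOrder x 0 + sOrder x 1 - sOrder x 2 ≤ sOrder y 0 + sOrder y 1 - sOrder y 2

/-- `V` solves the Schrödinger equation `V' = -i H(t) V`, `V 0 = 1`, on `[0, τ]`, in integrated
form (that is, `V` is absolutely continuous and the equation holds almost everywhere). -/
def IsPropagator (H V : ℝ → Op) (τ : ℝ) : Prop :=
  ContinuousOn V (Set.Icc 0 τ) ∧
  ∀ t ∈ Set.Icc (0 : ℝ) τ, ∀ p q,
    V t p q = (1 : Op) p q + ∫ s in (0 : ℝ)..t, ((-Complex.I) • (H s * V s)) p q

/-- The unitaries that the control system `V' = -i (H_d(t) + (a(t)·σ) ⊗ I + I ⊗ (b(t)·σ)) V`,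
`V 0 = 1`, reaches at some time `τ ≤ T`, for integrable (not necessarily bounded) real
controls `a`, `b`. -/
def reachable (Hd : ℝ → Op) (T : ℝ) : Set Op :=
  {X | ∃ τ : ℝ, 0 ≤ τ ∧ τ ≤ T ∧ ∃ a b : ℝ → Fin 3 → ℝ,
    (∀ i, IntervalIntegrable (fun t => a t i) MeasureTheory.volume 0 τ) ∧
    (∀ i, IntervalIntegrable (fun t => b t i) MeasureTheory.volume 0 τ) ∧
    ∃ V : ℝ → Op, IsPropagator (fun t => Hd t + localHam (a t) (b t)) V τ ∧ X = V τ}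

/-- The gate `U` can be generated within time `T` using `H_d` and fast local unitaries: up to a
global phase, it is a limit of unitaries reached by the control system in times at most `T + δ`,
for every `δ > 0` (local unitaries can be performed in arbitrarily small, but positive, time). -/
def CanGenerate (Hd : ℝ → Op) (T : ℝ) (U : Op) : Prop :=
  ∃ c : ℂ, ‖c‖ = 1 ∧ ∀ δ : ℝ, 0 < δ → c • U ∈ closure (reachable Hd (T + δ))

/-- `β_n = θ + (π/2) n`. -/
def shifted (θ : Fin 3 → ℝ) (n : Fin 3 → ℤ) : Fin 3 → ℝ :=
  fun j => θ j + Real.pi / 2 * (n j : ℝ)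

/-- `∫₀^T θ(t) dt`, entry by entry. -/
def integralVec (θ : ℝ → Fin 3 → ℝ) (T : ℝ) : Fin 3 → ℝ :=
  fun j => ∫ t in (0 : ℝ)..T, θ t j

end TwoQubit

end

/-!
The spin flip `X ↦ (σ_y ⊗ σ_y) Xᵀ (σ_y ⊗ σ_y)` turns the question into one about eigenvalues. It
is an anti-automorphism that fixes every coupling `σ_i ⊗ σ_j` and changes the sign of every local
Hamiltonian, so along the control system `P = spinFlip V * V` satisfies `P' = i P (-2 V† H_d V)`:
the controls have disappeared, and only the spectrum of `H_d`, that is, its canonical parameters,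
is known about the generator (`IsEvolution.spinFlip_mul_self`).

Necessity. The eigenphases of `P` start at zero, and the theorem of Lidskii bounds the sums of `k`
of them by the integrals of the sums of the `k` largest eigenvalues of `-2 H_d`
(`exists_phases_of_evolution`). The infinitesimal step is an inequality for products of unitaries
(`HasPhases.exists_mul`), which follows from Weyl's monotonicity principle for Hermitian matrices
through the Cayley transform (`HasPhases.le_of_mul`). The bounds define compact sets of lists of
eigenphases, hence they survive the limits in the definition of generation
(`CanGenerate.exists_phases`). For a gate with canonical parameters `θ` the eigenphases of
`spinFlip U * U` are `-2` times the eigenvalues of `H_θ`, up to a common sign and to multiples of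
`2π`; this ambiguity is a shift of `θ` by a vector of multiples of `π/2`, and the bounds for
`k = 1, 2, 3` are the inequalities of `s`-majorization (`CanGenerate.exists_sMajorized`).

Sufficiency. By Hahn–Banach a vector `s`-majorized by an ordered vector `y` lies in the convex hull
of the images of `y` under permutations and even sign changes (`SMajorized.exists_convexHull`).
These images are canonical forms of locally equivalent Hamiltonians, so each is realized by putting
the drift between two short local pulses (`approximates_signedPerm`); canonical Hamiltonians
commute, so convex combinations are realized by dividing the time (`approximates_convexHull`). For
a drift that varies with time the convex combination is applied on the cells of a fine partition,
on which an integrable drift is nearly constant in the `L¹` sense (`approximates_integral`).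
Finally `U_β` is a local gate when `β` has entries in `(π/2) ℤ` (`isLocal_canonicalGate`), so that
any shift of the parameters of the gate may be aimed at (`canGenerate_of_sMajorized`).

Minimum time. Among all shifts, `θ` and `θ - (π/2, 0, 0)` are the least for `s`-majorization,
according to the parity of the sum of the shift (`exists_sMajorized_shifted_iff`), and the first
time exists because the integrated parameters are continuous (`exists_isLeast_sMajorized`).
-/

/-! ### Linear evolution equations with integrable generators -/

namespace TwoQubit

open MeasureTheory Set Filter Topology

section Evolution

set_option linter.unusedSectionVars false

theorem absolutelyContinuousOnInterval_of_dist_le {E F : Type*} [PseudoMetricSpace E]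
    [PseudoMetricSpace F] {f : ℝ → E} {g : ℝ → F} {a b C : ℝ}
    (hg : AbsolutelyContinuousOnInterval g a b)
    (h : ∀ x ∈ uIcc a b, ∀ y ∈ uIcc a b, dist (f x) (f y) ≤ C * dist (g x) (g y)) :
    AbsolutelyContinuousOnInterval f a b := by
  unfold AbsolutelyContinuousOnInterval at hg ⊢
  apply squeeze_zero' ?_ ?_ (by simpa using hg.const_mul C)
  · exact Filter.Eventually.of_forall fun _ => Finset.sum_nonneg fun i _ => dist_nonneg
  rw [eventually_inf_principal]
  filter_upwards with E hE
  rw [Finset.mul_sum]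
  exact Finset.sum_le_sum fun i hi => h _ (hE.1 i hi).1 _ (hE.1 i hi).2

theorem dist_intervalIntegral_le {E : Type*} [NormedAddCommGroup E] [NormedSpace ℝ E]
    {f : ℝ → E} {g : ℝ → ℝ} {a b x y : ℝ} (hf : IntervalIntegrable f volume a b)
    (hg : IntervalIntegrable g volume a b)
    (hfg : ∀ t, ‖f t‖ ≤ g t) (hx : x ∈ uIcc a b) (hy : y ∈ uIcc a b) :
    dist (∫ r in a..x, f r) (∫ r in a..y, f r) ≤ dist (∫ r in a..x, g r) (∫ r in a..y, g r) := by
  have hsub : ∀ {z}, z ∈ uIcc a b → uIcc a z ⊆ uIcc a b := fun hz =>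
    uIcc_subset_uIcc left_mem_uIcc hz
  rw [dist_eq_norm, dist_eq_norm,
    intervalIntegral.integral_interval_sub_left (hf.mono_set (hsub hx)) (hf.mono_set (hsub hy)),
    intervalIntegral.integral_interval_sub_left (hg.mono_set (hsub hx)) (hg.mono_set (hsub hy))]
  rw [Real.norm_eq_abs]
  refine intervalIntegral.norm_integral_le_abs_of_norm_le (ae_of_all _ fun t => hfg t)
    (hg.mono_set (uIcc_subset_uIcc hy hx))

variable {A : Type*} [NormedRing A] [NormedAlgebra ℝ A] [CompleteSpace A]

/-- The product rule for absolutely continuous functions with values in a Banach algebra, in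
integrated form. -/
theorem mul_eq_add_integral {f g f' g' : ℝ → A} {a b : ℝ} (hab : a ≤ b)
    (hf' : IntervalIntegrable f' volume a b) (hg' : IntervalIntegrable g' volume a b)
    (hf : ∀ t ∈ Icc a b, f t = f a + ∫ r in a..t, f' r)
    (hg : ∀ t ∈ Icc a b, g t = g a + ∫ r in a..t, g' r) :
    ∀ t ∈ Icc a b, f t * g t = f a * g a + ∫ r in a..t, (f' r * g r + f r * g' r) := by
  set F : ℝ → A := fun t => f a + ∫ r in a..t, f' r with hF
  set G : ℝ → A := fun t => g a + ∫ r in a..t, g' r with hG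
  have hFc : ContinuousOn F (uIcc a b) :=
    continuousOn_const.add (intervalIntegral.continuousOn_primitive_interval' hf' left_mem_uIcc)
  have hGc : ContinuousOn G (uIcc a b) :=
    continuousOn_const.add (intervalIntegral.continuousOn_primitive_interval' hg' left_mem_uIcc)
  set H : ℝ → A := fun r => f' r * G r + F r * g' r with hH
  have hHi : IntervalIntegrable H volume a b :=
    (hf'.mul_continuousOn hGc).add (hg'.continuousOn_mul hFc)
  obtain ⟨CF, hCF⟩ := isCompact_uIcc.exists_bound_of_continuousOn hFc
  obtain ⟨CG, hCG⟩ := isCompact_uIcc.exists_bound_of_continuousOn hGc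
  set w : ℝ → ℝ := fun r => ‖f' r‖ + ‖g' r‖ + ‖H r‖ with hw
  have hwi : IntervalIntegrable w volume a b := (hf'.norm.add hg'.norm).add hHi.norm
  -- `D` is absolutely continuous with derivative zero almost everywhere, hence constant.
  set D : ℝ → A := fun t => F t * G t - ∫ r in a..t, H r with hD
  have hDac : AbsolutelyContinuousOnInterval D a b := by
    refine absolutelyContinuousOnInterval_of_dist_le (C := CF + CG + 1)
      (hwi.absolutelyContinuousOnInterval_intervalIntegral (c := a) left_mem_uIcc) ?_
    intro x hx y hy
    have h1 : dist (F x) (F y) ≤ dist (∫ r in a..x, w r) (∫ r in a..y, w r) := by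
      simp only [hF, dist_add_left]
      exact dist_intervalIntegral_le hf' hwi
        (fun t => by simp only [hw]; linarith [norm_nonneg (g' t), norm_nonneg (H t)]) hx hy
    have h2 : dist (G x) (G y) ≤ dist (∫ r in a..x, w r) (∫ r in a..y, w r) := by
      simp only [hG, dist_add_left]
      exact dist_intervalIntegral_le hg' hwi
        (fun t => by simp only [hw]; linarith [norm_nonneg (f' t), norm_nonneg (H t)]) hx hy
    have h3 := dist_intervalIntegral_le hHi hwi
        (fun t => by simp only [hw]; linarith [norm_nonneg (f' t), norm_nonneg (g' t)]) hx hy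
    set d := dist (∫ r in a..x, w r) (∫ r in a..y, w r)
    have h4 : dist (F x * G x) (F y * G y) ≤ CF * d + CG * d := by
      rw [dist_eq_norm] at h1 h2 ⊢
      have : F x * G x - F y * G y = F x * (G x - G y) + (F x - F y) * G y := by noncomm_ring
      rw [this]
      refine (norm_add_le _ _).trans (add_le_add ((norm_mul_le _ _).trans ?_)
        ((norm_mul_le _ _).trans ?_))
      · exact mul_le_mul (hCF x hx) h2 (norm_nonneg _) ((norm_nonneg _).trans (hCF x hx))
      · rw [mul_comm]
        exact mul_le_mul (hCG y hy) h1 (norm_nonneg _) ((norm_nonneg _).trans (hCG y hy))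
    calc dist (D x) (D y) ≤ dist (F x * G x) (F y * G y)
          + dist (∫ r in a..x, H r) (∫ r in a..y, H r) := dist_sub_sub_le _ _ _ _
      _ ≤ _ := by linarith
  obtain ⟨c, hc⟩ := hDac.const_of_ae_hasDerivAt_zero (by
    filter_upwards [hf'.ae_hasDerivAt_integral, hg'.ae_hasDerivAt_integral,
      hHi.ae_hasDerivAt_integral] with x h1 h2 h3 hx
    have d1 : HasDerivAt F (f' x) x := (h1 hx a left_mem_uIcc).const_add _
    have d2 : HasDerivAt G (g' x) x := (h2 hx a left_mem_uIcc).const_add _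
    have := (d1.mul d2).sub (h3 hx a left_mem_uIcc)
    rwa [show f' x * G x + F x * g' x - H x = 0 from sub_self _] at this)
  intro t ht
  have h0 : D a = f a * g a := by simp [hD, hF, hG]
  have h1 : D t = D a := by
    rw [hc t (by rwa [uIcc_of_le hab]), hc a left_mem_uIcc]
  have h2 : ∫ r in a..t, (f' r * g r + f r * g' r) = ∫ r in a..t, H r := by
    refine intervalIntegral.integral_congr fun r hr => ?_
    rw [uIcc_of_le ht.1] at hr
    have hr' : r ∈ Icc a b := ⟨hr.1, hr.2.trans ht.2⟩
    simp only [hH]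
    rw [hf r hr', hg r hr']
  rw [h2, ← h0, ← h1, hf t ht, hg t ht]
  simp [hD, hF, hG]

/-- `V` solves `V' = G V` on `[a, b]`, in integrated form. -/
def IsEvolution (G V : ℝ → A) (a b : ℝ) : Prop :=
  ContinuousOn V (Icc a b) ∧ ∀ t ∈ Icc a b, V t = V a + ∫ r in a..t, G r * V r

theorem IsEvolution.integrable {G V : ℝ → A} {a b : ℝ} (hab : a ≤ b) (h : IsEvolution G V a b)
    (hG : IntervalIntegrable G volume a b) :
    IntervalIntegrable (fun r => G r * V r) volume a b :=
  hG.mul_continuousOn (by rw [uIcc_of_le hab]; exact h.1)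

theorem IsEvolution.mul_const {G V : ℝ → A} {a b : ℝ} (hab : a ≤ b) (h : IsEvolution G V a b)
    (hG : IntervalIntegrable G volume a b) (X : A) :
    IsEvolution G (fun t => V t * X) a b := by
  refine ⟨h.1.mul continuousOn_const, fun t ht => ?_⟩
  have hi : IntervalIntegrable (fun r => G r * V r) volume a t :=
    (h.integrable hab hG).mono_set (uIcc_subset_uIcc left_mem_uIcc (by
      rw [uIcc_of_le hab]; exact ht))
  have := ((ContinuousLinearMap.mul ℝ A).flip X).intervalIntegral_comp_comm hi
  simp only [ContinuousLinearMap.flip_apply, ContinuousLinearMap.mul_apply'] at this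
  simp only [h.2 t ht, add_mul, ← this, mul_assoc]

theorem IsEvolution.glue {G V W : ℝ → A} {a b c : ℝ} (hab : a ≤ b) (hbc : b ≤ c)
    (hG : IntervalIntegrable G volume a c)
    (hV : IsEvolution G V a b) (hW : IsEvolution G W b c) (hVW : W b = V b) :
    IsEvolution G (fun t => if t ≤ b then V t else W t) a c := by
  set U : ℝ → A := fun t => if t ≤ b then V t else W t with hU
  have hUV : ∀ t, t ≤ b → U t = V t := fun t ht => by simp [hU, ht]
  have hUW : ∀ t, b ≤ t → U t = W t := fun t ht => by
    rcases ht.eq_or_lt with rfl | h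
    · simp [hU, hVW]
    · simp [hU, not_le.2 h]
  have hc : ContinuousOn U (Icc a c) := by
    rw [← Icc_union_Icc_eq_Icc hab hbc]
    exact (hV.1.congr fun t ht => hUV t ht.2).union_of_isClosed
      (hW.1.congr fun t ht => hUW t ht.1) isClosed_Icc isClosed_Icc
  refine ⟨hc, fun t ht => ?_⟩
  have hi : IntervalIntegrable (fun r => G r * U r) volume a c :=
    hG.mul_continuousOn (by rw [uIcc_of_le (hab.trans hbc)]; exact hc)
  have key : ∀ t, t ∈ Icc a b → U t = U a + ∫ r in a..t, G r * U r := by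
    intro t ht
    rw [hUV t ht.2, hUV a hab, hV.2 t ht]
    congr 1
    refine intervalIntegral.integral_congr fun r hr => ?_
    rw [uIcc_of_le ht.1] at hr
    simp only [hUV r (hr.2.trans ht.2)]
  rcases le_total t b with h | h
  · exact key t ⟨ht.1, h⟩
  · have hac : uIcc a c = Icc a c := uIcc_of_le (hab.trans hbc)
    rw [← intervalIntegral.integral_add_adjacent_intervals (b := b)
      (hi.mono_set (uIcc_subset_uIcc left_mem_uIcc (by rw [hac]; exact ⟨hab, hbc⟩)))
      (hi.mono_set (uIcc_subset_uIcc (by rw [hac]; exact ⟨hab, hbc⟩) (by rw [hac]; exact ht))),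
      ← add_assoc, ← key b ⟨hab, le_rfl⟩, hUW t h, hUW b le_rfl, hW.2 t ⟨h, ht.2⟩]
    congr 1
    refine intervalIntegral.integral_congr fun r hr => ?_
    rw [uIcc_of_le h] at hr
    simp only [hUW r hr.1]

/-- On an interval where the generator has integral norm below `1`, the evolution exists by the
contraction principle. -/
theorem exists_isEvolution_of_integral_lt_one {G : ℝ → A} {a b : ℝ} (hab : a ≤ b)
    (hG : IntervalIntegrable G volume a b) (h1 : ∫ r in a..b, ‖G r‖ < 1) (X : A) :
    ∃ V : ℝ → A, IsEvolution G V a b ∧ V a = X := by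
  have hab' : uIcc a b = Icc a b := uIcc_of_le hab
  let ext : C(Icc a b, A) → ℝ → A := fun v t => v (projIcc a b hab t)
  have hext : ∀ v, Continuous (ext v) := fun v => v.continuous.comp continuous_projIcc
  have hint : ∀ v, IntervalIntegrable (fun r => G r * ext v r) volume a b := fun v =>
    hG.mul_continuousOn (hext v).continuousOn
  let Φ : C(Icc a b, A) → C(Icc a b, A) := fun v =>
    ⟨fun t => X + ∫ r in a..t.1, G r * ext v r, by
      refine continuous_const.add ?_
      have := intervalIntegral.continuousOn_primitive_interval' (hint v) left_mem_uIcc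
      rw [hab'] at this
      exact continuousOn_iff_continuous_domRestrict.1 this⟩
  have hk0 : 0 ≤ ∫ r in a..b, ‖G r‖ :=
    intervalIntegral.integral_nonneg hab fun r _ => norm_nonneg _
  have hΦ : ContractingWith ⟨∫ r in a..b, ‖G r‖, hk0⟩ Φ := by
    refine ⟨h1, LipschitzWith.of_dist_le_mul fun v w => ?_⟩
    change dist (Φ v) (Φ w) ≤ (∫ r in a..b, ‖G r‖) * dist v w
    refine (ContinuousMap.dist_le (mul_nonneg hk0 dist_nonneg)).2 fun t => ?_
    have ht : uIcc a t.1 ⊆ uIcc a b := uIcc_subset_uIcc left_mem_uIcc (by rw [hab']; exact t.2)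
    have hi1 : IntervalIntegrable (fun r => ‖G r‖) volume a t.1 := hG.norm.mono_set ht
    simp only [Φ, ContinuousMap.coe_mk, dist_add_left]
    rw [dist_eq_norm, ← intervalIntegral.integral_sub ((hint v).mono_set ht)
      ((hint w).mono_set ht)]
    calc ‖∫ r in a..t.1, (G r * ext v r - G r * ext w r)‖
        ≤ ∫ r in a..t.1, ‖G r‖ * dist v w := by
          refine intervalIntegral.norm_integral_le_of_norm_le t.2.1 (ae_of_all _ fun r _ => ?_)
            (hi1.mul_const _)
          rw [← mul_sub]
          refine (norm_mul_le _ _).trans (mul_le_mul_of_nonneg_left ?_ (norm_nonneg _))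
          rw [← dist_eq_norm]
          exact ContinuousMap.dist_apply_le_dist _
      _ = (∫ r in a..t.1, ‖G r‖) * dist v w := by
          rw [intervalIntegral.integral_mul_const]
      _ ≤ (∫ r in a..b, ‖G r‖) * dist v w := by
          refine mul_le_mul_of_nonneg_right ?_ dist_nonneg
          exact intervalIntegral.integral_mono_interval le_rfl t.2.1 t.2.2
            (ae_of_all _ fun r => norm_nonneg _) hG.norm
  have hfix := hΦ.fixedPoint_isFixedPt
  set v := ContractingWith.fixedPoint Φ hΦ
  have hv : ∀ t : Icc a b, v t = X + ∫ r in a..t.1, G r * ext v r := fun t => by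
    conv_lhs => rw [← hfix]
    rfl
  have hev : ∀ t (ht : t ∈ Icc a b), ext v t = v ⟨t, ht⟩ := fun t ht => by
    simp only [ext, projIcc_of_mem hab ht]
  have h0 : ext v a = X := by
    rw [hev a ⟨le_rfl, hab⟩, hv]; simp
  refine ⟨ext v, ⟨(hext v).continuousOn, fun t ht => ?_⟩, h0⟩
  rw [h0, hev t ht, hv]

/-- Existence of evolutions, by gluing solutions on intervals where the generator has small
integral. -/
theorem exists_isEvolution {G : ℝ → A} {a b : ℝ} (hab : a ≤ b)
    (hG : IntervalIntegrable G volume a b) (X : A) :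
    ∃ V : ℝ → A, IsEvolution G V a b ∧ V a = X := by
  have hab' : uIcc a b = Icc a b := uIcc_of_le hab
  have huc : UniformContinuousOn (fun t => ∫ r in a..t, ‖G r‖) (Icc a b) := by
    refine isCompact_Icc.uniformContinuousOn_of_continuous ?_
    rw [← hab']
    exact intervalIntegral.continuousOn_primitive_interval' hG.norm left_mem_uIcc
  obtain ⟨δ, hδ, h⟩ := Metric.uniformContinuousOn_iff.1 huc 1 one_pos
  obtain ⟨N, hN⟩ := exists_nat_gt ((b - a) / δ)
  have hsub : ∀ x ∈ Icc a b, ∀ y ∈ Icc a b, uIcc x y ⊆ uIcc a b := fun x hx y hy =>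
    uIcc_subset_uIcc (by rwa [hab']) (by rwa [hab'])
  have key : ∀ k : ℕ, ∃ V : ℝ → A, IsEvolution G V a (min b (a + k * (δ / 2))) ∧ V a = X := by
    intro k
    induction k with
    | zero =>
      refine ⟨fun _ => X, ⟨continuousOn_const, fun t ht => ?_⟩, rfl⟩
      have : t = a := le_antisymm (ht.2.trans (by simp [hab])) ht.1
      simp [this]
    | succ k ih =>
      obtain ⟨V, hV, hVa⟩ := ih
      set c := min b (a + k * (δ / 2)) with hc
      set d := min b (a + (k + 1 : ℕ) * (δ / 2)) with hd
      have hk : 0 ≤ (k : ℝ) * (δ / 2) := by positivity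
      have hac : a ≤ c := le_min hab (by linarith)
      have hcd : c ≤ d := min_le_min le_rfl (by push_cast; linarith)
      have hdb : d ≤ b := min_le_left _ _
      have hcm : c ∈ Icc a b := ⟨hac, hcd.trans hdb⟩
      have hdm : d ∈ Icc a b := ⟨hac.trans hcd, hdb⟩
      have hdist : dist d c < δ := by
        rw [Real.dist_eq, abs_of_nonneg (sub_nonneg.2 hcd)]
        have : d ≤ c + δ / 2 := by
          rw [hc, hd, ← min_add_add_right]
          exact min_le_min (by linarith) (by push_cast; linarith)
        linarith
      have hlt := h d hdm c hcm hdist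
      rw [Real.dist_eq, intervalIntegral.integral_interval_sub_left
        (hG.norm.mono_set (hsub a ⟨le_rfl, hab⟩ d hdm))
        (hG.norm.mono_set (hsub a ⟨le_rfl, hab⟩ c hcm))] at hlt
      obtain ⟨W, hW, hWc⟩ := exists_isEvolution_of_integral_lt_one hcd
        (hG.mono_set (hsub c hcm d hdm)) (lt_of_abs_lt hlt) (V c)
      refine ⟨_, hV.glue hac hcd (hG.mono_set (hsub a ⟨le_rfl, hab⟩ d hdm)) hW hWc, ?_⟩
      simp [hac, hVa]
  obtain ⟨V, hV, hVa⟩ := key (2 * N)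
  rw [min_eq_left] at hV
  · exact ⟨V, hV, hVa⟩
  · rw [div_lt_iff₀ hδ] at hN
    push_cast
    linarith

end Evolution

end TwoQubit

/-! ### Unitary evolutions -/

namespace TwoQubit

open MeasureTheory Set Filter Topology

section UnitaryEvolution

variable {A : Type*} [CStarAlgebra A]

/-- The variation of `W* V` for two evolutions with skew-adjoint generators is governed by the
difference of the generators; with `V = W` this is unitarity, and in general it is the basic
perturbation estimate. -/
theorem IsEvolution.star_mul_eq {G G' V W : ℝ → A} {a b : ℝ} (hab : a ≤ b)
    (hG : IntervalIntegrable G volume a b) (hG' : IntervalIntegrable G' volume a b)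
    (hskew : ∀ r ∈ Icc a b, star (G' r) = -G' r)
    (hV : IsEvolution G V a b) (hW : IsEvolution G' W a b) :
    ∀ t ∈ Icc a b, star (W t) * V t = star (W a) * V a +
      ∫ r in a..t, star (W r) * (G r - G' r) * V r := by
  have hWi := hW.integrable hab hG'
  have hstar : ∀ t ∈ Icc a b, star (W t) = star (W a) + ∫ r in a..t, star (G' r * W r) := by
    intro t ht
    have := (starL' ℝ : A ≃L[ℝ] A).toContinuousLinearMap.intervalIntegral_comp_comm
      (hWi.mono_set (uIcc_subset_uIcc left_mem_uIcc (by rw [uIcc_of_le hab]; exact ht)))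
    simp only [ContinuousLinearEquiv.coe_coe, starL'_apply] at this
    rw [this, ← star_add, ← hW.2 t ht]
  have hsi : IntervalIntegrable (fun r => star (G' r * W r)) volume a b := by
    constructor
    · exact (starL' ℝ : A ≃L[ℝ] A).toContinuousLinearMap.integrable_comp hWi.1
    · exact (starL' ℝ : A ≃L[ℝ] A).toContinuousLinearMap.integrable_comp hWi.2
  intro t ht
  rw [mul_eq_add_integral hab hsi (hV.integrable hab hG) hstar hV.2 t ht]
  congr 1
  refine intervalIntegral.integral_congr fun r hr => ?_
  rw [uIcc_of_le ht.1] at hr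
  simp only [star_mul, hskew r ⟨hr.1, hr.2.trans ht.2⟩]
  noncomm_ring

theorem IsEvolution.star_mul_self {G V : ℝ → A} {a b : ℝ} (hab : a ≤ b)
    (hG : IntervalIntegrable G volume a b) (hskew : ∀ r ∈ Icc a b, star (G r) = -G r)
    (hV : IsEvolution G V a b) (h0 : star (V a) * V a = 1) :
    ∀ t ∈ Icc a b, star (V t) * V t = 1 := by
  intro t ht
  rw [hV.star_mul_eq hab hG hG hskew hV t ht, h0]
  simp

theorem norm_le_one_of_star_mul_self {x : A} (h : star x * x = 1) : ‖x‖ ≤ 1 := by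
  have h1 : ‖x‖ * ‖x‖ = ‖(1 : A)‖ := by rw [← CStarRing.norm_star_mul_self, h]
  have h2 : ‖(1 : A)‖ * ‖(1 : A)‖ = ‖(1 : A)‖ := by
    rw [← CStarRing.norm_star_mul_self]; simp
  have h3 : ‖(1 : A)‖ ≤ 1 := by
    by_contra h3
    have : ‖(1 : A)‖ = 1 := mul_left_cancel₀ (by linarith) (h2.trans (mul_one _).symm)
    linarith
  nlinarith [norm_nonneg x]

theorem isEvolution_exp (X : A) {a b : ℝ} :
    IsEvolution (fun _ => X) (fun t => NormedSpace.exp ((t - a) • X)) a b := by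
  have hd : ∀ t, HasDerivAt (fun t : ℝ => NormedSpace.exp ((t - a) • X))
      (X * NormedSpace.exp ((t - a) • X)) t := fun t => by
    have h1 := hasDerivAt_exp_smul_const' (𝕂 := ℝ) X (t - a)
    have h2 : HasDerivAt (fun t : ℝ => t - a) 1 t := (hasDerivAt_id t).sub_const a
    simpa [Function.comp_def] using h1.scomp t h2
  have hc : Continuous (fun t : ℝ => NormedSpace.exp ((t - a) • X)) :=
    continuous_iff_continuousAt.2 fun t => (hd t).continuousAt
  refine ⟨hc.continuousOn, fun t _ => ?_⟩
  rw [intervalIntegral.integral_eq_sub_of_hasDerivAt (fun r _ => hd r)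
    ((continuous_const.mul hc).intervalIntegrable _ _)]
  abel

/-- An evolution with skew-adjoint generator differs from the one with constant generator `X` by
at most the `L¹` distance of the generators. -/
theorem IsEvolution.norm_sub_exp_le {G V : ℝ → A} {a b : ℝ} (hab : a ≤ b) {X : A}
    (hG : IntervalIntegrable G volume a b) (hskew : ∀ r ∈ Icc a b, star (G r) = -G r)
    (hX : star X = -X) (hV : IsEvolution G V a b) (h0 : V a = 1) :
    ‖V b - NormedSpace.exp ((b - a) • X)‖ ≤ ∫ r in a..b, ‖G r - X‖ := by
  set W : ℝ → A := fun t => NormedSpace.exp ((t - a) • X) with hWdef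
  have hW : IsEvolution (fun _ => X) W a b := isEvolution_exp X
  have hWa : W a = 1 := by simp [hWdef]
  have hXi : IntervalIntegrable (fun _ : ℝ => X) volume a b := intervalIntegrable_const
  have hVu := hV.star_mul_self hab hG hskew (by simp [h0])
  have hWu : ∀ t, W t ∈ unitary A := fun t => by
    let +nondep : NormedAlgebra ℚ A := .restrictScalars ℚ ℂ A
    refine NormedSpace.exp_mem_unitary_of_mem_skewAdjoint ?_
    rw [skewAdjoint.mem_iff, star_smul, hX]
    simp
  have hb : b ∈ Icc a b := ⟨hab, le_rfl⟩
  have key := hV.star_mul_eq hab hG hXi (fun _ _ => hX) hW b hb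
  rw [hWa, h0, star_one, one_mul] at key
  have h1 : V b - W b = W b * (star (W b) * V b - 1) := by
    rw [mul_sub, ← mul_assoc, (Unitary.mem_iff.1 (hWu b)).2]; simp
  change ‖V b - W b‖ ≤ _
  have h2 : ‖∫ r in a..b, star (W r) * (G r - X) * V r‖ ≤ ∫ r in a..b, ‖G r - X‖ := by
    refine intervalIntegral.norm_integral_le_of_norm_le hab (ae_of_all _ fun r hr => ?_)
      (hG.sub hXi).norm
    have hr' : r ∈ Icc a b := ⟨hr.1.le, hr.2⟩
    have e1 : ‖star (W r)‖ ≤ 1 := by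
      rw [norm_star]; exact norm_le_one_of_star_mul_self (Unitary.mem_iff.1 (hWu r)).1
    have e2 : ‖V r‖ ≤ 1 := norm_le_one_of_star_mul_self (hVu r hr')
    calc ‖star (W r) * (G r - X) * V r‖ ≤ ‖star (W r)‖ * ‖G r - X‖ * ‖V r‖ :=
          (norm_mul_le _ _).trans (mul_le_mul_of_nonneg_right (norm_mul_le _ _) (norm_nonneg _))
      _ ≤ 1 * ‖G r - X‖ * 1 := by gcongr
      _ = _ := by ring
  rw [h1, key, add_sub_cancel_left]
  refine (norm_mul_le _ _).trans ?_
  calc _ ≤ 1 * ‖∫ r in a..b, star (W r) * (G r - X) * V r‖ := by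
        gcongr
        exact norm_le_one_of_star_mul_self (Unitary.mem_iff.1 (hWu b)).1
    _ ≤ _ := by rw [one_mul]; exact h2

end UnitaryEvolution

end TwoQubit

/-! ### Eigenvalue lists and Weyl monotonicity -/

namespace TwoQubit

open Matrix
open scoped Matrix.Norms.L2Operator

section Spectral

set_option linter.unusedSectionVars false

variable {n : Type*} [Fintype n] [DecidableEq n]

/-- `A` is unitarily diagonalizable with eigenvalue list `a`. -/
def HasEigenlist (A : Matrix n n ℂ) (a : n → ℂ) : Prop :=
  ∃ V ∈ unitaryGroup n ℂ, A = V * diagonal a * Vᴴ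

theorem mem_unitaryGroup_mul {V : Matrix n n ℂ} (hV : V ∈ unitaryGroup n ℂ) :
    V * Vᴴ = 1 := mem_unitaryGroup_iff.1 hV

theorem mem_unitaryGroup_mul' {V : Matrix n n ℂ} (hV : V ∈ unitaryGroup n ℂ) :
    Vᴴ * V = 1 := mem_unitaryGroup_iff'.1 hV

theorem conj_mul_conj {V : Matrix n n ℂ} (hV : V ∈ unitaryGroup n ℂ) (A B : Matrix n n ℂ) :
    (V * A * Vᴴ) * (V * B * Vᴴ) = V * (A * B) * Vᴴ := by
  calc _ = V * A * (Vᴴ * V) * B * Vᴴ := by noncomm_ring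
    _ = _ := by rw [mem_unitaryGroup_mul' hV]; noncomm_ring

theorem conj_one {V : Matrix n n ℂ} (hV : V ∈ unitaryGroup n ℂ) :
    V * (1 : Matrix n n ℂ) * Vᴴ = 1 := by
  rw [mul_one, mem_unitaryGroup_mul hV]

theorem norm_conj {V : Matrix n n ℂ} (hV : V ∈ unitaryGroup n ℂ) (A : Matrix n n ℂ) :
    ‖V * A * Vᴴ‖ = ‖A‖ := by
  have h1 : Vᴴ ∈ unitary (Matrix n n ℂ) := Unitary.star_mem hV
  rw [CStarRing.norm_mul_mem_unitary _ h1, CStarRing.norm_mem_unitary_mul _ hV]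

theorem HasEigenlist.comp_perm {A : Matrix n n ℂ} {a : n → ℂ} (h : HasEigenlist A a)
    (σ : Equiv.Perm n) : HasEigenlist A (a ∘ σ) := by
  obtain ⟨V, hV, rfl⟩ := h
  have h1 : V.submatrix id σ * (V.submatrix id σ)ᴴ = V * Vᴴ := by
    rw [conjTranspose_submatrix, submatrix_mul_equiv]; rfl
  refine ⟨V.submatrix id σ, mem_unitaryGroup_iff.2 ?_, ?_⟩
  · rw [star_eq_conjTranspose, h1, mem_unitaryGroup_mul hV]
  · rw [conjTranspose_submatrix, ← submatrix_diagonal_equiv, submatrix_mul_equiv,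
      submatrix_mul_equiv]
    rfl

theorem HasEigenlist.smul {A : Matrix n n ℂ} {a : n → ℂ} (h : HasEigenlist A a) (c : ℂ) :
    HasEigenlist (c • A) (fun j => c * a j) := by
  obtain ⟨V, hV, rfl⟩ := h
  refine ⟨V, hV, ?_⟩
  rw [show (fun j => c * a j) = c • a from rfl, diagonal_smul]
  simp

theorem HasEigenlist.norm_sub_one {A : Matrix n n ℂ} {a : n → ℂ} (h : HasEigenlist A a) :
    ‖A - 1‖ = ‖fun j => a j - 1‖ := by
  obtain ⟨V, hV, rfl⟩ := h
  rw [← l2_opNorm_diagonal, ← norm_conj hV (diagonal fun j => a j - 1), ← diagonal_sub,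
    diagonal_one, mul_sub, sub_mul, conj_one hV]

theorem HasEigenlist.det {A : Matrix n n ℂ} {a : n → ℂ} (h : HasEigenlist A a) :
    A.det = ∏ j, a j := by
  obtain ⟨V, hV, rfl⟩ := h
  rw [det_mul, det_mul, det_diagonal, mul_right_comm, ← det_mul, mem_unitaryGroup_mul hV]
  simp

/-- The real quadratic form of a matrix. -/
def quadForm (A : Matrix n n ℂ) (w : n → ℂ) : ℝ := (star w ⬝ᵥ (A *ᵥ w)).re

theorem dotProduct_conj (V D : Matrix n n ℂ) (w z : n → ℂ) :
    star w ⬝ᵥ ((V * D * Vᴴ) *ᵥ z) = star (Vᴴ *ᵥ w) ⬝ᵥ (D *ᵥ (Vᴴ *ᵥ z)) := by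
  rw [star_mulVec, conjTranspose_conjTranspose, ← dotProduct_mulVec, mulVec_mulVec, mulVec_mulVec]

theorem quadForm_conj_diagonal (V : Matrix n n ℂ) (a : n → ℝ) (w : n → ℂ) :
    quadForm (V * diagonal (fun j => (a j : ℂ)) * Vᴴ) w
      = ∑ j, a j * Complex.normSq ((Vᴴ *ᵥ w) j) := by
  rw [quadForm, dotProduct_conj, dotProduct, Complex.re_sum]
  refine Finset.sum_congr rfl fun j _ => ?_
  rw [mulVec_diagonal, Complex.normSq_apply]
  simp
  ring

theorem sum_normSq_conj {V : Matrix n n ℂ} (hV : V ∈ unitaryGroup n ℂ) (w : n → ℂ) :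
    ∑ j, Complex.normSq ((Vᴴ *ᵥ w) j) = ∑ j, Complex.normSq (w j) := by
  have h1 := quadForm_conj_diagonal V (fun _ => 1) w
  have h2 := quadForm_conj_diagonal (1 : Matrix n n ℂ) (fun _ => 1) w
  simp only [Complex.ofReal_one, diagonal_one, one_mul, mul_one,
    conjTranspose_one, one_mulVec] at h1 h2
  rw [← h1, ← h2, mem_unitaryGroup_mul hV]

/-- Weyl's monotonicity principle: enlarging a Hermitian matrix in the quadratic form order
enlarges its eigenvalues, when both lists are arranged compatibly. -/
theorem le_of_quadForm_le {A B : Matrix n n ℂ} {a b : n → ℝ}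
    (hA : HasEigenlist A (fun j => (a j : ℂ))) (hB : HasEigenlist B (fun j => (b j : ℂ)))
    (hab : ∀ i j, a i < a j → b i ≤ b j) (hle : ∀ w, quadForm A w ≤ quadForm B w) : a ≤ b := by
  obtain ⟨V, hV, rfl⟩ := hA
  obtain ⟨W, hW, rfl⟩ := hB
  intro i
  -- A nonzero `w` with no component along the eigenvectors of `A` below `a i`, nor along those
  -- of `B` above `b i`: these are fewer than `card n` linear conditions.
  let f : (n → ℂ) →ₗ[ℂ] ({j // a j < a i} ⊕ {j // b i < b j} → ℂ) :=
    LinearMap.pi (Sum.elim (fun j => (LinearMap.proj j.1).comp (Vᴴ).mulVecLin)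
      (fun j => (LinearMap.proj j.1).comp (Wᴴ).mulVecLin))
  have hcard : Module.finrank ℂ ({j // a j < a i} ⊕ {j // b i < b j} → ℂ)
      < Module.finrank ℂ (n → ℂ) := by
    rw [Module.finrank_fintype_fun_eq_card, Module.finrank_fintype_fun_eq_card, Fintype.card_sum,
      Fintype.card_subtype, Fintype.card_subtype, ← Finset.card_union_of_disjoint]
    · refine Finset.card_lt_univ_of_notMem (x := i) ?_
      simp
    · rw [Finset.disjoint_left]
      intro j hj hj'
      simp only [Finset.mem_filter, Finset.mem_univ, true_and] at hj hj'
      exact absurd (hab j i hj) (not_le.2 hj')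
  obtain ⟨w, hw, hw0⟩ := (Submodule.ne_bot_iff _).1
    (LinearMap.ker_ne_bot_of_finrank_lt hcard (f := f))
  have hfw : ∀ s, f w s = 0 := fun s => by rw [LinearMap.mem_ker.1 hw]; rfl
  have h1 : ∀ j, a j < a i → (Vᴴ *ᵥ w) j = 0 := fun j hj => hfw (Sum.inl ⟨j, hj⟩)
  have h2 : ∀ j, b i < b j → (Wᴴ *ᵥ w) j = 0 := fun j hj => hfw (Sum.inr ⟨j, hj⟩)
  have hpos : 0 < ∑ j, Complex.normSq (w j) := by
    obtain ⟨j, hj⟩ := Function.ne_iff.1 hw0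
    exact Finset.sum_pos' (fun j _ => Complex.normSq_nonneg _)
      ⟨j, Finset.mem_univ _, Complex.normSq_pos.2 hj⟩
  have h3 := hle w
  rw [quadForm_conj_diagonal, quadForm_conj_diagonal] at h3
  have h4 : a i * ∑ j, Complex.normSq (w j) ≤ ∑ j, a j * Complex.normSq ((Vᴴ *ᵥ w) j) := by
    rw [← sum_normSq_conj hV, Finset.mul_sum]
    refine Finset.sum_le_sum fun j _ => ?_
    rcases lt_or_ge (a j) (a i) with h | h
    · simp [h1 j h]
    · exact mul_le_mul_of_nonneg_right h (Complex.normSq_nonneg _)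
  have h5 : ∑ j, b j * Complex.normSq ((Wᴴ *ᵥ w) j) ≤ b i * ∑ j, Complex.normSq (w j) := by
    rw [← sum_normSq_conj hW, Finset.mul_sum]
    refine Finset.sum_le_sum fun j _ => ?_
    rcases lt_or_ge (b i) (b j) with h | h
    · simp [h2 j h]
    · exact mul_le_mul_of_nonneg_right h (Complex.normSq_nonneg _)
  exact le_of_mul_le_mul_right (h4.trans (h3.trans h5)) hpos

/-! ### The Cayley transform -/

/-- The addition law of the Cayley transform: if `P = (1 + H) / (1 - H)` and
`E = (1 + K) / (1 - K)`, then `P E` has Cayley transform `H + (1 + H) K (1 + H K)⁻¹ (1 - H)`. -/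
theorem cayley_mul {R : Type*} [Ring R] {P E H H' K N : R} (hP : P * (1 - H) = 1 + H)
    (hP' : P * E * (1 - H') = 1 + H') (hE : E * (1 - K) = 1 + K) (hN : (1 + H * K) * N = 1)
    (hcancel : ∀ x, (P * E + 1) * x = 0 → x = 0) :
    H' = H + (1 + H) * K * (N * (1 - H)) := by
  set u := N * (1 - H) with hu
  have h1 : (1 + H * K) * u = 1 - H := by rw [hu, ← mul_assoc, hN, one_mul]
  set F := H + (1 + H) * K * u with hF
  have h2 : 1 - F = (1 - K) * u := by
    have : 1 - F = (1 - H) - K * u - H * K * u := by rw [hF]; noncomm_ring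
    rw [this, ← h1]; noncomm_ring
  have h3 : (1 + K) * u = (1 - H) * (1 + K * u) := by
    have : (1 - H) * (1 + K * u) = (1 - H) + K * u - H * K * u := by noncomm_ring
    rw [this, ← h1]; noncomm_ring
  have h4 : P * E * (1 - F) = 1 + F := by
    calc P * E * (1 - F) = P * ((E * (1 - K)) * u) := by rw [h2]; noncomm_ring
      _ = P * ((1 + K) * u) := by rw [hE]
      _ = (P * (1 - H)) * (1 + K * u) := by rw [h3]; noncomm_ring
      _ = 1 + F := by rw [hP, hF]; noncomm_ring
  have h5 := hcancel (H' - F) (by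
    have : (P * E + 1) * (H' - F) = (P * E * (1 - F) - (1 + F)) - (P * E * (1 - H') - (1 + H')) := by
      noncomm_ring
    rw [this, h4, hP']; simp)
  exact sub_eq_zero.1 h5

open Complex in
theorem exp_I_mul_one_sub_tan {x : ℝ} (hx : |x| < Real.pi) :
    Complex.exp (x * I) * (1 - I * (Real.tan (x / 2) : ℝ)) = 1 + I * (Real.tan (x / 2) : ℝ) := by
  have hc : Real.cos (x / 2) ≠ 0 := by
    have := abs_lt.1 hx
    exact (Real.cos_pos_of_mem_Ioo ⟨by linarith, by linarith⟩).ne'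
  have hc' : (Real.cos (x / 2) : ℂ) ≠ 0 := by exact_mod_cast hc
  have h1 : Complex.exp (x * I) = (Real.cos (x / 2) + Real.sin (x / 2) * I) ^ 2 := by
    rw [Complex.ofReal_cos, Complex.ofReal_sin, ← Complex.exp_mul_I, ← Complex.exp_nat_mul]
    congr 1; push_cast; ring
  have h2 : (Real.cos (x / 2) : ℂ) ^ 2 + (Real.sin (x / 2) : ℂ) ^ 2 = 1 := by
    exact_mod_cast Real.cos_sq_add_sin_sq (x / 2)
  rw [h1, Real.tan_eq_sin_div_cos]
  push_cast at *
  field_simp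
  have hI : I ^ 2 = -1 := I_sq
  linear_combination (Complex.cos (x/2) + Complex.sin (x/2) * I) * (h2 - Complex.sin (x/2) ^ 2 * hI)

end Spectral

end TwoQubit

/-! ### Monotonicity of eigenphases -/

namespace TwoQubit

open Matrix
open scoped Matrix.Norms.L2Operator

section Eigenphases

set_option linter.unusedSectionVars false

variable {n : Type*} [Fintype n] [DecidableEq n]

/-- `x` is a list of eigenphases of the unitary matrix `P`: real numbers, not reduced modulo `2π`,
such that the `exp (i x_j)` are the eigenvalues of `P` with multiplicity. -/
def HasPhases (P : Matrix n n ℂ) (x : n → ℝ) : Prop :=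
  HasEigenlist P (fun j => Complex.exp (x j * Complex.I))

theorem conjTranspose_conj_real (V : Matrix n n ℂ) (a : n → ℝ) :
    (V * diagonal (fun j => (a j : ℂ)) * Vᴴ)ᴴ = V * diagonal (fun j => (a j : ℂ)) * Vᴴ := by
  rw [conjTranspose_mul, conjTranspose_mul, conjTranspose_conjTranspose, diagonal_conjTranspose,
    mul_assoc]
  congr 3
  ext j; simp

theorem norm_conj_real_le {V : Matrix n n ℂ} (hV : V ∈ unitaryGroup n ℂ) {a : n → ℝ} {C : ℝ}
    (hC : 0 ≤ C) (ha : ∀ j, |a j| ≤ C) : ‖V * diagonal (fun j => (a j : ℂ)) * Vᴴ‖ ≤ C := by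
  rw [norm_conj hV, l2_opNorm_diagonal]
  refine (pi_norm_le_iff_of_nonneg hC).2 fun j => ?_
  simpa using ha j

theorem mulVec_diagonal_conj {V : Matrix n n ℂ} (hV : V ∈ unitaryGroup n ℂ) (d : n → ℂ)
    (w : n → ℂ) (j : n) : (Vᴴ *ᵥ ((V * diagonal d * Vᴴ) *ᵥ w)) j = d j * (Vᴴ *ᵥ w) j := by
  rw [mulVec_mulVec, show Vᴴ * (V * diagonal d * Vᴴ) = (Vᴴ * V) * diagonal d * Vᴴ by noncomm_ring,
    mem_unitaryGroup_mul' hV, one_mul, ← mulVec_mulVec, mulVec_diagonal]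

theorem conj_smul_I (V : Matrix n n ℂ) (d : n → ℂ) :
    V * diagonal (fun j => Complex.I * d j) * Vᴴ = Complex.I • (V * diagonal d * Vᴴ) := by
  rw [show (fun j => Complex.I * d j) = Complex.I • d from rfl, diagonal_smul]
  simp

/-- The Hermitian matrix with eigenvalues `tan (x_j / 2)` is the Cayley transform of the unitary
matrix with eigenphases `x_j`. -/
theorem cayley_conj {V : Matrix n n ℂ} (hV : V ∈ unitaryGroup n ℂ) {x : n → ℝ}
    (hx : ∀ j, |x j| < Real.pi) :
    (V * diagonal (fun j => Complex.exp (x j * Complex.I)) * Vᴴ)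
      * (1 - Complex.I • (V * diagonal (fun j => ((Real.tan (x j / 2) : ℝ) : ℂ)) * Vᴴ))
      = 1 + Complex.I • (V * diagonal (fun j => ((Real.tan (x j / 2) : ℝ) : ℂ)) * Vᴴ) := by
  have e1 : ∀ D : Matrix n n ℂ, 1 - V * D * Vᴴ = V * (1 - D) * Vᴴ := fun D => by
    rw [mul_sub, sub_mul, conj_one hV]
  have e2 : ∀ D : Matrix n n ℂ, 1 + V * D * Vᴴ = V * (1 + D) * Vᴴ := fun D => by
    rw [mul_add, add_mul, conj_one hV]
  rw [← conj_smul_I, e1, e2, conj_mul_conj hV, ← diagonal_one, diagonal_sub,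
    diagonal_add, diagonal_mul_diagonal]
  congr 3
  ext j
  exact exp_I_mul_one_sub_tan (hx j)

/-- Eigenphases that stay away from `±π` increase under multiplication with a unitary matrix of
small nonnegative eigenphases: the Cayley transform increases in the quadratic form order. -/
theorem HasPhases.le_of_mul {P E : Matrix n n ℂ} {x x' g : n → ℝ} (hP : HasPhases P x)
    (hE : HasPhases E g) (hP' : HasPhases (P * E) x') (hx : ∀ j, |x j| < Real.pi)
    (hx' : ∀ j, |x' j| < Real.pi) (hg0 : ∀ j, 0 ≤ g j) (hg1 : ∀ j, g j < Real.pi) {τ γ : ℝ}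
    (hτ : 0 ≤ τ) (hγ : 0 ≤ γ) (hxt : ∀ j, |Real.tan (x j / 2)| ≤ τ)
    (hgt : ∀ j, Real.tan (g j / 2) ≤ γ) (hτγ : τ * γ < 1)
    (hmono : ∀ i j, x i < x j → x' i ≤ x' j) : x ≤ x' := by
  obtain ⟨V, hV, hPV⟩ := hP
  obtain ⟨Y, hY, hEY⟩ := hE
  obtain ⟨W, hW, hPW⟩ := hP'
  have htm : ∀ {s t : ℝ}, |s| < Real.pi → |t| < Real.pi →
      (Real.tan (s / 2) ≤ Real.tan (t / 2) ↔ s ≤ t) := fun {s t} hs ht => by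
    have hs := abs_lt.1 hs
    have ht := abs_lt.1 ht
    rw [Real.strictMonoOn_tan.le_iff_le (by constructor <;> linarith)
      (by constructor <;> linarith)]
    constructor <;> intro h <;> linarith
  have hgabs : ∀ j, |g j| < Real.pi := fun j => by rw [abs_of_nonneg (hg0 j)]; exact hg1 j
  have hκ0 : ∀ j, 0 ≤ Real.tan (g j / 2) := fun j =>
    Real.tan_nonneg_of_nonneg_of_le_pi_div_two (by linarith [hg0 j]) (by linarith [hg1 j])
  have cP := cayley_conj hV hx
  have cE := cayley_conj hY hgabs
  have cP' := cayley_conj hW hx'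
  rw [← hPV] at cP
  rw [← hEY] at cE
  rw [← hPW] at cP'
  set A := V * diagonal (fun j => ((Real.tan (x j / 2) : ℝ) : ℂ)) * Vᴴ with hA
  set B := W * diagonal (fun j => ((Real.tan (x' j / 2) : ℝ) : ℂ)) * Wᴴ with hB
  set K := Y * diagonal (fun j => ((Real.tan (g j / 2) : ℝ) : ℂ)) * Yᴴ with hK
  have hAh : Aᴴ = A := conjTranspose_conj_real V _
  have hAn : ‖A‖ ≤ τ := norm_conj_real_le hV hτ hxt
  have hKn : ‖K‖ ≤ γ := norm_conj_real_le hY hγ fun j => by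
    rw [abs_of_nonneg (hκ0 j)]; exact hgt j
  have hAK : ‖A * K‖ < 1 := lt_of_le_of_lt
    ((norm_mul_le _ _).trans (mul_le_mul hAn hKn (norm_nonneg _) hτ)) hτγ
  obtain ⟨N, hN⟩ : ∃ N, (1 - A * K) * N = 1 := by
    obtain ⟨u, hu⟩ := isUnit_one_sub_of_norm_lt_one hAK
    exact ⟨↑u⁻¹, by rw [← hu]; exact u.mul_inv⟩
  have hII : Complex.I * Complex.I = -1 := Complex.I_mul_I
  have hcay := cayley_mul cP cP' cE (N := N) (by
      rw [smul_mul_smul_comm, hII, neg_one_smul, ← sub_eq_add_neg, hN]) (by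
      intro z hz
      have e1 : (P * E + 1) * (1 - Complex.I • B) = (2 : ℂ) • 1 := by
        rw [add_mul, cP', one_mul, add_add_sub_cancel, two_smul]
      have e2 : (((2 : ℂ)⁻¹) • (1 - Complex.I • B)) * (P * E + 1) = 1 := by
        refine mul_eq_one_comm.1 ?_
        rw [mul_smul_comm, e1, smul_smul]; norm_num
      rw [← one_mul z, ← e2, mul_assoc, hz, mul_zero])
  set u := N * (1 - Complex.I • A) with hu
  have hBA : B = A + (1 + Complex.I • A) * K * u := by
    have h1 : Complex.I • B = Complex.I • (A + (1 + Complex.I • A) * K * u) := by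
      rw [hcay, smul_add, mul_smul_comm, smul_mul_assoc]
    have := congrArg (fun Z => (-Complex.I) • Z) h1
    simpa [smul_smul] using this
  -- With `y = u w`, the form `B - A` at `w` is `⟨y, K y⟩ - ⟨K y, A K y⟩`, which is nonnegative
  -- since `‖A‖ ≤ τ` and `τ K ≤ 1`.
  have hle : ∀ w, quadForm A w ≤ quadForm B w := by
    intro w
    set y := u *ᵥ w with hy
    have hyw : (1 - Complex.I • A) *ᵥ w = (1 - A * K) *ᵥ y := by
      rw [hy, mulVec_mulVec, hu, ← mul_assoc, hN, one_mul]
    have hz : star w ⬝ᵥ (((1 + Complex.I • A) * K * u) *ᵥ w)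
        = star y ⬝ᵥ (K *ᵥ y) - star (K *ᵥ y) ⬝ᵥ (A *ᵥ (K *ᵥ y)) := by
      have h1 : (1 + Complex.I • A) = (1 - Complex.I • A)ᴴ := by
        rw [conjTranspose_sub, conjTranspose_smul, hAh]; simp
      have h2 : ∀ (Z : Matrix n n ℂ) (p q : n → ℂ),
          star p ⬝ᵥ (Zᴴ *ᵥ q) = star (Z *ᵥ p) ⬝ᵥ q := fun Z p q => by
        rw [dotProduct_mulVec, ← star_mulVec]
      have h3 : star ((A * K) *ᵥ y) ⬝ᵥ (K *ᵥ y) = star (K *ᵥ y) ⬝ᵥ (A *ᵥ (K *ᵥ y)) := by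
        rw [← mulVec_mulVec y A K, ← h2, hAh]
      rw [← mulVec_mulVec w _ u, ← hy, ← mulVec_mulVec y _ K, h1, h2, hyw,
        sub_mulVec, one_mulVec, star_sub, sub_dotProduct, h3]
    have hq : quadForm B w = quadForm A w + (quadForm K y - quadForm A (K *ᵥ y)) := by
      rw [quadForm, hBA, add_mulVec, dotProduct_add, hz]
      simp [quadForm]
    have h2 : quadForm A (K *ᵥ y) ≤ quadForm K y := by
      rw [hA, quadForm_conj_diagonal]
      calc ∑ j, Real.tan (x j / 2) * Complex.normSq ((Vᴴ *ᵥ (K *ᵥ y)) j)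
          ≤ ∑ j, τ * Complex.normSq ((Vᴴ *ᵥ (K *ᵥ y)) j) :=
            Finset.sum_le_sum fun j _ => mul_le_mul_of_nonneg_right
              ((le_abs_self _).trans (hxt j)) (Complex.normSq_nonneg _)
        _ = ∑ j, τ * Complex.normSq ((Yᴴ *ᵥ (K *ᵥ y)) j) := by
            rw [← Finset.mul_sum, ← Finset.mul_sum, sum_normSq_conj hV, sum_normSq_conj hY]
        _ ≤ quadForm K y := by
            rw [hK, quadForm_conj_diagonal]
            refine Finset.sum_le_sum fun j _ => ?_
            rw [mulVec_diagonal_conj hY, Complex.normSq_mul, Complex.normSq_ofReal, ← mul_assoc]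
            refine mul_le_mul_of_nonneg_right ?_ (Complex.normSq_nonneg _)
            have h3 : τ * Real.tan (g j / 2) ≤ 1 :=
              (mul_le_mul_of_nonneg_left (hgt j) hτ).trans hτγ.le
            nlinarith [hκ0 j]
    linarith
  have hfin := le_of_quadForm_le (a := fun j => Real.tan (x j / 2))
    (b := fun j => Real.tan (x' j / 2)) ⟨V, hV, hA⟩ ⟨W, hW, hB⟩ (fun i j hij => by
      refine (htm (hx' i) (hx' j)).2 (hmono i j ?_)
      by_contra hcon
      exact absurd ((htm (hx j) (hx i)).2 (not_lt.1 hcon)) (not_le.2 hij)) hle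
  exact fun j => (htm (hx j) (hx' j)).1 (hfin j)

theorem exists_hasEigenlist_of_isHermitian {X : Matrix n n ℂ} (hX : X.IsHermitian) :
    ∃ a : n → ℝ, HasEigenlist X (fun j => (a j : ℂ)) := by
  refine ⟨hX.eigenvalues, hX.eigenvectorUnitary, hX.eigenvectorUnitary.2, ?_⟩
  have := hX.spectral_theorem
  rw [Unitary.conjStarAlgAut_apply] at this
  exact this

theorem exp_I_smul_conj {V : Matrix n n ℂ} (hV : V ∈ unitaryGroup n ℂ) (a : n → ℝ) :
    NormedSpace.exp (Complex.I • (V * diagonal (fun j => (a j : ℂ)) * Vᴴ)) =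
      V * diagonal (fun j => Complex.exp (a j * Complex.I)) * Vᴴ := by
  have hinv : Vᴴ = V⁻¹ := (inv_eq_right_inv (mem_unitaryGroup_mul hV)).symm
  have hVu : IsUnit V := (isUnit_iff_isUnit_det _).2
    (isUnit_det_of_right_inverse (mem_unitaryGroup_mul hV))
  rw [← conj_smul_I, hinv, exp_conj _ _ hVu, exp_diagonal]
  congr 3
  ext j
  rw [Pi.coe_exp, ← Complex.exp_eq_exp_ℂ, mul_comm]

theorem HasEigenlist.exp_I_smul {X : Matrix n n ℂ} {a : n → ℝ}
    (h : HasEigenlist X (fun j => (a j : ℂ))) : HasPhases (NormedSpace.exp (Complex.I • X)) a := by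
  obtain ⟨V, hV, rfl⟩ := h
  exact ⟨V, hV, exp_I_smul_conj hV a⟩

/-- A unitary matrix without the eigenvalue `-1` has eigenphases strictly between `-π` and `π`. -/
theorem exists_hasPhases {U : Matrix n n ℂ} (hU : U ∈ unitaryGroup n ℂ) (h : ‖U - 1‖ < 2) :
    ∃ x : n → ℝ, HasPhases U x ∧ ∀ j, |x j| < Real.pi := by
  set X := Unitary.argSelfAdjoint (A := Matrix n n ℂ) ⟨U, hU⟩ with hX
  have hexp := expUnitary_argSelfAdjoint (A := Matrix n n ℂ) (u := ⟨U, hU⟩) h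
  have hUX : U = NormedSpace.exp (Complex.I • (X : Matrix n n ℂ)) := by
    have := congrArg Subtype.val hexp
    rw [selfAdjoint.expUnitary_coe] at this
    exact this.symm
  obtain ⟨θ, hθ⟩ := exists_hasEigenlist_of_isHermitian (X := (X : Matrix n n ℂ)) X.2
  have hlist : HasEigenlist U (fun j => Complex.exp (θ j * Complex.I)) := by
    rw [hUX]; exact hθ.exp_I_smul
  have hn := hlist.norm_sub_one
  set a : n → ℂ := fun j => Complex.exp (θ j * Complex.I) with ha
  have ha1 : ∀ j, ‖a j‖ = 1 := fun j => Complex.norm_exp_ofReal_mul_I _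
  have harg : ∀ j, Complex.exp (Complex.arg (a j) * Complex.I) = a j := fun j => by
    have := Complex.norm_mul_exp_arg_mul_I (a j)
    rwa [ha1, Complex.ofReal_one, one_mul] at this
  refine ⟨fun j => Complex.arg (a j), ?_, fun j => ?_⟩
  · rw [HasPhases]
    simp only [harg]
    exact hlist
  · refine lt_of_le_of_ne (Complex.abs_arg_le_pi _) fun hpi => ?_
    have h1 : ‖a j - 1‖ < 2 := lt_of_le_of_lt
      (by have := norm_le_pi_norm (fun j => a j - 1) j; rwa [← hn] at this) h
    have h2 : a j = -1 := by
      rw [← harg j]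
      rcases abs_eq Real.pi_pos.le |>.1 hpi with h | h <;> change Complex.arg (a j) = _ at h <;> rw [h]
      · exact Complex.exp_pi_mul_I
      · rw [Complex.ofReal_neg, neg_mul, Complex.exp_neg, Complex.exp_pi_mul_I]; norm_num
    rw [h2] at h1
    norm_num at h1

end Eigenphases

end TwoQubit

/-! ### Lidskii inequalities in a window of the circle -/

namespace TwoQubit

open Matrix
open scoped Matrix.Norms.L2Operator

section Step

set_option linter.unusedSectionVars false

variable {n : Type*} [Fintype n] [DecidableEq n]

theorem norm_exp_sub_one_le (x : ℝ) : ‖Complex.exp (x * Complex.I) - 1‖ ≤ |x| := by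
  rw [mul_comm, Complex.norm_exp_I_mul_ofReal_sub_one, norm_mul, Real.norm_eq_abs, Real.norm_eq_abs,
    abs_two]
  have := Real.abs_sin_le_abs (x := x / 2)
  rw [abs_div, abs_two] at this
  linarith

theorem phase_bound {x : ℝ} (hx : |x| < Real.pi)
    (h : ‖Complex.exp (x * Complex.I) - 1‖ ≤ 199 / 100) :
    |x| ≤ Real.pi - 1 / 10 ∧ |Real.tan (x / 2)| ≤ 11 := by
  rw [mul_comm, Complex.norm_exp_I_mul_ofReal_sub_one] at h
  have hs : Real.sin (x / 2) ^ 2 ≤ (199 / 200) ^ 2 := by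
    have : |Real.sin (x / 2)| ≤ 199 / 200 := by
      rw [norm_mul, Real.norm_eq_abs, Real.norm_eq_abs] at h
      norm_num at h ⊢
      linarith
    rw [← sq_abs]
    exact pow_le_pow_left₀ (abs_nonneg _) this 2
  have hx' := abs_lt.1 hx
  have hc0 : 0 < Real.cos (x / 2) := Real.cos_pos_of_mem_Ioo ⟨by linarith, by linarith⟩
  have hc : 1 / 11 ≤ Real.cos (x / 2) := by
    nlinarith [Real.sin_sq_add_cos_sq (x / 2)]
  constructor
  · have h1 : Real.cos (x / 2) = Real.sin (Real.pi / 2 - |x| / 2) := by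
      rw [Real.sin_pi_div_two_sub, ← Real.cos_abs (x / 2), abs_div, abs_two]
    have h2 := Real.sin_le (x := Real.pi / 2 - |x| / 2) (by linarith)
    linarith
  · rw [Real.tan_eq_sin_div_cos, abs_div, abs_of_pos hc0, div_le_iff₀ hc0]
    linarith [Real.abs_sin_le_one (x / 2)]

theorem tan_le_of_small {y : ℝ} (h0 : 0 ≤ y) (h1 : y ≤ 1 / 100) : Real.tan y ≤ 1 / 50 := by
  have hc := Real.one_sub_sq_div_two_le_cos (x := y)
  have hc' : 1 / 2 ≤ Real.cos y := by nlinarith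
  rw [Real.tan_eq_sin_div_cos, div_le_iff₀ (by linarith)]
  linarith [Real.sin_le h0]

theorem HasPhases.comp_perm {P : Matrix n n ℂ} {x : n → ℝ} (h : HasPhases P x)
    (σ : Equiv.Perm n) : HasPhases P (x ∘ σ) := HasEigenlist.comp_perm h σ

theorem HasPhases.bound {P : Matrix n n ℂ} {x : n → ℝ} (h : HasPhases P x)
    (hP : ‖P - 1‖ ≤ 199 / 100) (hx : ∀ j, |x j| < Real.pi) (j : n) :
    |x j| ≤ Real.pi - 1 / 10 ∧ |Real.tan (x j / 2)| ≤ 11 := by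
  refine phase_bound (hx j) (le_trans ?_ hP)
  rw [HasEigenlist.norm_sub_one h]
  exact norm_le_pi_norm (fun j => Complex.exp (x j * Complex.I) - 1) j

/-- The unitary matrix with eigenvectors the columns of `Y` and eigenphases `g`. -/
noncomputable def phaseMatrix (Y : Matrix n n ℂ) (g : n → ℝ) : Matrix n n ℂ :=
  Y * diagonal (fun j => Complex.exp (g j * Complex.I)) * Yᴴ

theorem phaseMatrix_hasPhases {Y : Matrix n n ℂ} (hY : Y ∈ unitaryGroup n ℂ) (g : n → ℝ) :
    HasPhases (phaseMatrix Y g) g := ⟨Y, hY, rfl⟩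

theorem phaseMatrix_mul {Y : Matrix n n ℂ} (hY : Y ∈ unitaryGroup n ℂ) (g g' : n → ℝ) :
    phaseMatrix Y g * phaseMatrix Y g' = phaseMatrix Y (g + g') := by
  rw [phaseMatrix, phaseMatrix, conj_mul_conj hY, diagonal_mul_diagonal, phaseMatrix]
  congr 3
  ext j
  rw [← Complex.exp_add, Pi.add_apply]
  congr 1
  push_cast
  ring

theorem phaseMatrix_const {Y : Matrix n n ℂ} (hY : Y ∈ unitaryGroup n ℂ) (c : ℝ) :
    phaseMatrix Y (fun _ => c) = Complex.exp (c * Complex.I) • (1 : Matrix n n ℂ) := by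
  rw [phaseMatrix, ← smul_one_eq_diagonal, mul_smul_comm, mul_one, smul_mul_assoc,
    mem_unitaryGroup_mul hY]

theorem HasPhases.mem_unitaryGroup {P : Matrix n n ℂ} {x : n → ℝ} (h : HasPhases P x) :
    P ∈ unitaryGroup n ℂ := by
  obtain ⟨V, hV, rfl⟩ := h
  have hd : diagonal (fun j => Complex.exp (x j * Complex.I)) ∈ unitaryGroup n ℂ := by
    rw [mem_unitaryGroup_iff, star_eq_conjTranspose, diagonal_conjTranspose, diagonal_mul_diagonal,
      ← diagonal_one]
    congr 1
    ext j
    rw [Pi.star_apply, RCLike.star_def, Complex.mul_conj, Complex.normSq_eq_norm_sq,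
      Complex.norm_exp_ofReal_mul_I]
    simp
  exact mul_mem (mul_mem hV hd) (Unitary.star_mem hV)

theorem HasPhases.mul_phaseMatrix_const {P Y : Matrix n n ℂ} {x : n → ℝ} (h : HasPhases P x)
    (hY : Y ∈ unitaryGroup n ℂ) (c : ℝ) :
    HasPhases (P * phaseMatrix Y fun _ => c) (fun j => x j + c) := by
  rw [phaseMatrix_const hY, mul_smul_comm, mul_one]
  have := HasEigenlist.smul h (Complex.exp (c * Complex.I))
  rw [HasPhases]
  convert this using 2 with j
  rw [← Complex.exp_add]
  congr 1
  push_cast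
  ring

theorem exists_sorted_hasPhases {N : ℕ} (e : n ≃ Fin N) {U : Matrix n n ℂ}
    (hU : U ∈ unitaryGroup n ℂ) (h : ‖U - 1‖ < 2) :
    ∃ x : n → ℝ, HasPhases U x ∧ (∀ j, |x j| < Real.pi) ∧ Monotone (x ∘ e.symm) := by
  obtain ⟨x, hx, hxp⟩ := exists_hasPhases hU h
  let σ : Equiv.Perm n := (e.trans (Tuple.sort (x ∘ e.symm))).trans e.symm
  refine ⟨x ∘ σ, hx.comp_perm σ, fun j => hxp _, ?_⟩
  have : (x ∘ σ) ∘ e.symm = (x ∘ e.symm) ∘ Tuple.sort (x ∘ e.symm) := by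
    ext j; simp [σ]
  rw [this]
  exact Tuple.monotone_sort _

theorem le_of_monotone_of_lt {N : ℕ} (e : n ≃ Fin N) {x y : n → ℝ} (hx : Monotone (x ∘ e.symm))
    (hy : Monotone (y ∘ e.symm)) (i j : n) (h : x i < x j) : y i ≤ y j := by
  have h1 : e i ≤ e j := by
    by_contra hcon
    have := hx (not_le.1 hcon).le
    simp only [Function.comp_apply, Equiv.symm_apply_apply] at this
    linarith
  simpa using hy h1

theorem phaseMatrix_norm_sub_one_le {Y : Matrix n n ℂ} (hY : Y ∈ unitaryGroup n ℂ) {g : n → ℝ}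
    {γ : ℝ} (hγ : 0 ≤ γ) (hg : ∀ j, |g j| ≤ γ) : ‖phaseMatrix Y g - 1‖ ≤ γ := by
  rw [HasEigenlist.norm_sub_one (phaseMatrix_hasPhases hY g)]
  exact (pi_norm_le_iff_of_nonneg hγ).2 fun j => (norm_exp_sub_one_le _).trans (hg j)

/-- In a window of the circle free of the eigenvalue `-1`, the sorted eigenphases of a product of
unitaries obey Lidskii's inequalities. The increments are compared with those produced by the
truncated phases `max g c`, which dominate both `g` and the scalar `c`. -/
theorem exists_phases_mul_of_window {N : ℕ} (e : n ≃ Fin N) (hN : N ≤ 4)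
    {P Y : Matrix n n ℂ} {x g : n → ℝ}
    (hP : HasPhases P x) (hx : ∀ j, |x j| < Real.pi) (hxm : Monotone (x ∘ e.symm))
    (hPn : ‖P - 1‖ ≤ 198 / 100) (hY : Y ∈ unitaryGroup n ℂ) (hg : ∀ j, |g j| ≤ 1 / 100) :
    ∃ x' : n → ℝ, HasPhases (P * phaseMatrix Y g) x' ∧ ∑ j, (x' j - x j) = ∑ j, g j ∧
      ∀ (S : Finset n) (c : ℝ), |c| ≤ 1 / 100 →
        ∑ j ∈ S, (x' j - x j - c) ≤ ∑ j, (max (g j) c - c) := by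
  have hPu := hP.mem_unitaryGroup
  have hPE : ∀ g' : n → ℝ, (∀ j, |g' j| ≤ 1 / 100) → ‖P * phaseMatrix Y g' - 1‖ ≤ 199 / 100 := by
    intro g' hg'
    have h1 := phaseMatrix_norm_sub_one_le hY (by norm_num) hg'
    have h2 : P * phaseMatrix Y g' - 1 = P * (phaseMatrix Y g' - 1) + (P - 1) := by
      rw [mul_sub, mul_one]; abel
    rw [h2]
    refine (norm_add_le _ _).trans ?_
    rw [CStarRing.norm_mem_unitary_mul _ hPu]
    linarith
  -- `F g` is the sorted list of eigenphases of `P * phaseMatrix Y g`.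
  have hex : ∀ g' : n → ℝ, ∃ y : n → ℝ, (∀ j, |g' j| ≤ 1 / 100) →
      HasPhases (P * phaseMatrix Y g') y ∧ (∀ j, |y j| < Real.pi) ∧ Monotone (y ∘ e.symm) := by
    intro g'
    by_cases hg' : ∀ j, |g' j| ≤ 1 / 100
    · obtain ⟨y, hy⟩ := exists_sorted_hasPhases e
        (mul_mem hPu (phaseMatrix_hasPhases hY g').mem_unitaryGroup)
        (lt_of_le_of_lt (hPE g' hg') (by norm_num))
      exact ⟨y, fun _ => hy⟩
    · exact ⟨0, fun h => absurd h hg'⟩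
  choose F hF using hex
  have hcmp : ∀ (Q : Matrix n n ℂ) (d y z : n → ℝ), HasPhases Q y → (∀ j, |y j| < Real.pi) →
      Monotone (y ∘ e.symm) → ‖Q - 1‖ ≤ 199 / 100 → HasPhases (Q * phaseMatrix Y d) z →
      (∀ j, |z j| < Real.pi) → Monotone (z ∘ e.symm) → (∀ j, 0 ≤ d j) → (∀ j, d j ≤ 1 / 50) →
      y ≤ z := by
    intro Q d y z hy hyp hym hQ hz hzp hzm hd0 hd1
    refine hy.le_of_mul (phaseMatrix_hasPhases hY d) hz hyp hzp hd0
      (fun j => by linarith [hd1 j, Real.pi_gt_three]) (τ := 11) (γ := 1 / 50) (by norm_num)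
      (by norm_num) (fun j => (hy.bound hQ hyp j).2)
      (fun j => tan_le_of_small (by linarith [hd0 j]) (by linarith [hd1 j])) (by norm_num)
      (le_of_monotone_of_lt e hym hzm)
  have hFm : ∀ g₁ g₂ : n → ℝ, (∀ j, |g₁ j| ≤ 1 / 100) → (∀ j, |g₂ j| ≤ 1 / 100) → g₁ ≤ g₂ →
      F g₁ ≤ F g₂ := by
    intro g₁ g₂ h₁ h₂ h
    obtain ⟨a1, a2, a3⟩ := hF g₁ h₁
    obtain ⟨b1, b2, b3⟩ := hF g₂ h₂
    refine hcmp _ (g₂ - g₁) _ _ a1 a2 a3 (hPE g₁ h₁) ?_ b2 b3 (fun j => sub_nonneg.2 (h j))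
      (fun j => ?_)
    · rwa [mul_assoc, phaseMatrix_mul hY, add_sub_cancel]
    · have := (abs_le.1 (h₁ j)).1
      have := (abs_le.1 (h₂ j)).2
      rw [Pi.sub_apply]; linarith
  have hFc : ∀ c : ℝ, |c| ≤ 1 / 100 → F (fun _ => c) = fun j => x j + c := by
    intro c hc
    obtain ⟨a1, a2, a3⟩ := hF (fun _ => c) (fun _ => hc)
    have b1 := hP.mul_phaseMatrix_const hY c
    have b2 : ∀ j, |x j + c| < Real.pi := fun j => by
      have := (hP.bound (hPn.trans (by norm_num)) hx j).1
      refine (abs_add_le _ _).trans_lt ?_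
      linarith
    have b3 : Monotone ((fun j => x j + c) ∘ e.symm) := fun i j hij =>
      add_le_add_left (hxm hij) c
    have hQ := hPE (fun _ => c) (fun _ => hc)
    have h0 : ∀ Q : Matrix n n ℂ, Q * phaseMatrix Y 0 = Q := fun Q => by
      have := phaseMatrix_const hY 0
      rw [show (0 : n → ℝ) = fun _ => 0 from rfl, this]
      simp
    apply le_antisymm
    · exact hcmp _ 0 _ _ a1 a2 a3 hQ (by rwa [h0]) b2 b3 (fun _ => le_rfl) (fun _ => by norm_num)
    · exact hcmp _ 0 _ _ b1 b2 b3 hQ (by rwa [h0]) a2 a3 (fun _ => le_rfl) (fun _ => by norm_num)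
  have hFb : ∀ g' : n → ℝ, (∀ j, |g' j| ≤ 1 / 100) → ∀ j, |F g' j - x j| ≤ 1 / 100 := by
    intro g' hg' j
    have h1 := hFm g' (fun _ => 1 / 100) hg' (fun _ => by norm_num)
      (fun j => (abs_le.1 (hg' j)).2) j
    have h2 := hFm (fun _ => -(1 / 100)) g' (fun _ => by norm_num) hg'
      (fun j => (abs_le.1 (hg' j)).1) j
    rw [hFc _ (by norm_num)] at h1 h2
    rw [abs_le]
    constructor <;> linarith
  have hcard : Fintype.card n ≤ 4 := by rw [Fintype.card_congr e, Fintype.card_fin]; exact hN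
  -- The determinant fixes the sum of the eigenphases modulo `2π`; the bounds are too small for a
  -- nonzero multiple.
  have hFs : ∀ g' : n → ℝ, (∀ j, |g' j| ≤ 1 / 100) → ∑ j, (F g' j - x j) = ∑ j, g' j := by
    intro g' hg'
    have h1 := HasEigenlist.det (hF g' hg').1
    rw [det_mul, HasEigenlist.det hP, HasEigenlist.det (phaseMatrix_hasPhases hY g'),
      ← Complex.exp_sum, ← Complex.exp_sum, ← Complex.exp_sum, ← Complex.exp_add,
      Complex.exp_eq_exp_iff_exists_int] at h1
    obtain ⟨m, hm⟩ := h1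
    rw [← Finset.sum_mul, ← Finset.sum_mul, ← Finset.sum_mul] at hm
    have h2 : ∑ j, x j + ∑ j, g' j = ∑ j, F g' j + m * (2 * Real.pi) := by
      have : ((∑ j, x j + ∑ j, g' j : ℝ) : ℂ) * Complex.I
          = ((∑ j, F g' j + m * (2 * Real.pi) : ℝ) : ℂ) * Complex.I := by
        push_cast
        linear_combination hm
      exact_mod_cast mul_right_cancel₀ Complex.I_ne_zero this
    have h3 : |∑ j, (F g' j - x j - g' j)| ≤ 8 / 100 := by
      refine (Finset.abs_sum_le_sum_abs _ _).trans ?_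
      calc ∑ j, |F g' j - x j - g' j| ≤ ∑ _j : n, (2 / 100 : ℝ) :=
            Finset.sum_le_sum fun j _ => by
              refine (abs_sub _ _).trans ?_
              linarith [hFb g' hg' j, hg' j]
        _ = Fintype.card n * (2 / 100 : ℝ) := by simp
        _ ≤ 4 * (2 / 100) := by
            refine mul_le_mul_of_nonneg_right ?_ (by norm_num)
            exact_mod_cast hcard
        _ = _ := by norm_num
    have h4 : ∑ j, (F g' j - x j - g' j) = -(m * (2 * Real.pi)) := by
      rw [Finset.sum_sub_distrib, Finset.sum_sub_distrib]
      linarith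
    rw [h4, abs_neg, abs_mul, abs_of_pos Real.two_pi_pos] at h3
    have hm0 : m = 0 := by
      by_contra hne
      have : (1 : ℝ) ≤ |(m : ℝ)| := by exact_mod_cast Int.one_le_abs hne
      nlinarith [Real.pi_gt_three]
    rw [hm0] at h2
    rw [Finset.sum_sub_distrib]
    simp at h2
    linarith
  refine ⟨F g, (hF g hg).1, hFs g hg, fun S c hc => ?_⟩
  set G : n → ℝ := fun j => max (g j) c with hG
  have hGb : ∀ j, |G j| ≤ 1 / 100 := fun j => by
    rcases max_choice (g j) c with h | h <;> simp only [hG, h]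
    · exact hg j
    · exact hc
  have h1 : F g ≤ F G := hFm g G hg hGb fun j => le_max_left _ _
  have h2 : ∀ j, x j + c ≤ F G j := fun j => by
    have := hFm (fun _ => c) G (fun _ => hc) hGb (fun j => le_max_right _ _) j
    rwa [hFc c hc] at this
  calc ∑ j ∈ S, (F g j - x j - c) ≤ ∑ j ∈ S, (F G j - x j - c) :=
        Finset.sum_le_sum fun j _ => by linarith [h1 j]
    _ ≤ ∑ j, (F G j - x j - c) :=
        Finset.sum_le_univ_sum_of_nonneg fun j => by linarith [h2 j]
    _ = ∑ j, (max (g j) c - c) := by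
        rw [Finset.sum_sub_distrib (fun j => F G j - x j), hFs G hGb, Finset.sum_sub_distrib]

end Step

end TwoQubit

/-! ### Lidskii inequalities for small unitary factors -/

namespace TwoQubit

open Matrix
open scoped Matrix.Norms.L2Operator

section Lidskii

set_option linter.unusedSectionVars false

variable {n : Type*} [Fintype n] [DecidableEq n]

/-- At most four points on the unit circle leave a point of the circle at distance at least
`3 / 10` from all of them. -/
theorem exists_unit_away (hn : Fintype.card n ≤ 4) (a : n → ℂ) :
    ∃ z : ℂ, ‖z‖ = 1 ∧ ∀ j, 3 / 10 ≤ ‖a j - z‖ := by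
  let z : Fin 5 → ℂ := ![1, -1, Complex.I, -Complex.I, ⟨3 / 5, 4 / 5⟩]
  have hz1 : ∀ k, Complex.normSq (z k) = 1 := by
    intro k
    fin_cases k <;> simp [z, Complex.normSq_apply]
    norm_num
  have hz2 : ∀ k l, k ≠ l → 9 / 25 ≤ Complex.normSq (z k - z l) := by
    intro k l hkl
    fin_cases k <;> fin_cases l <;> simp [z, Complex.normSq_apply] at hkl ⊢ <;> norm_num
  by_contra hcon
  push Not at hcon
  have h1 : ∀ k, ∃ j, ‖a j - z k‖ < 3 / 10 := fun k => hcon (z k) (by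
    rw [← sq_eq_sq₀ (norm_nonneg _) zero_le_one, ← Complex.normSq_eq_norm_sq, hz1, one_pow])
  choose f hf using h1
  obtain ⟨k, l, hkl, hfe⟩ := Fintype.exists_ne_map_eq_of_card_lt f
    (lt_of_le_of_lt hn (by simp))
  have h2 : ‖z k - z l‖ < 6 / 10 := by
    have : z k - z l = (a (f l) - z l) - (a (f k) - z k) := by rw [hfe]; ring
    rw [this]
    refine (norm_sub_le _ _).trans_lt ?_
    linarith [hf k, hf l]
  have h3 := hz2 k l hkl
  rw [Complex.normSq_eq_norm_sq] at h3
  nlinarith [norm_nonneg (z k - z l)]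

/-- The Lidskii inequalities for unitary matrices of size at most four: multiplication with a
unitary of small eigenphases `g` changes suitable continuous eigenphases by a vector majorized by
`g`. The majorization is expressed by truncations at a level `c`. -/
theorem HasPhases.exists_mul (hn : Fintype.card n ≤ 4) {P E : Matrix n n ℂ} {φ g : n → ℝ}
    (hP : HasPhases P φ) (hE : HasPhases E g) (hg : ∀ j, |g j| ≤ 1 / 100) :
    ∃ ψ : n → ℝ, HasPhases (P * E) ψ ∧ ∑ j, (ψ j - φ j) = ∑ j, g j ∧
      ∀ (S : Finset n) (c : ℝ), |c| ≤ 1 / 100 →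
        ∑ j ∈ S, (ψ j - φ j - c) ≤ ∑ j, (max (g j) c - c) := by
  obtain ⟨Y, hY, rfl⟩ := hE
  obtain ⟨z, hz, hza⟩ := exists_unit_away hn (fun j => Complex.exp (φ j * Complex.I))
  have hzz : z * (starRingEnd ℂ) z = 1 := by
    rw [Complex.mul_conj, Complex.normSq_eq_norm_sq, hz]; norm_num
  -- Multiplication by `w` moves `z` to `-1`, away from the eigenvalues of `w • P`.
  set w : ℂ := -(starRingEnd ℂ) z with hw
  have hw1 : ‖w‖ = 1 := by rw [hw, norm_neg, RCLike.norm_conj, hz]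
  have hw0 : w ≠ 0 := fun h => by rw [h] at hw1; simp at hw1
  set a : n → ℂ := fun j => w * Complex.exp (φ j * Complex.I) with ha
  have ha1 : ∀ j, ‖a j‖ = 1 := fun j => by
    rw [ha, norm_mul, hw1, Complex.norm_exp_ofReal_mul_I, one_mul]
  have hQ : HasEigenlist (w • P) a := HasEigenlist.smul hP w
  have hd : ∀ j, ‖a j - 1‖ ≤ 198 / 100 := by
    intro j
    have h1 : ‖a j - 1‖ = ‖Complex.exp (φ j * Complex.I) + z‖ := by
      have : Complex.exp (φ j * Complex.I) + z = -z * (a j - 1) := by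
        simp only [ha, hw]; linear_combination -(Complex.exp (φ j * Complex.I)) * hzz
      rw [this, norm_mul, norm_neg, hz, one_mul]
    have h2 := parallelogram_law_with_norm ℝ (Complex.exp (φ j * Complex.I)) z
    rw [Complex.norm_exp_ofReal_mul_I, hz] at h2
    rw [h1]
    nlinarith [hza j, norm_nonneg (Complex.exp (φ j * Complex.I) + z)]
  set y : n → ℝ := fun j => Complex.arg (a j) with hy
  have harg : ∀ j, Complex.exp (y j * Complex.I) = a j := fun j => by
    have := Complex.norm_mul_exp_arg_mul_I (a j)
    rwa [ha1, Complex.ofReal_one, one_mul] at this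
  have hyp : ∀ j, |y j| < Real.pi := by
    intro j
    refine lt_of_le_of_ne (Complex.abs_arg_le_pi _) fun hpi => ?_
    have h2 : a j = -1 := by
      rw [← harg j]
      rcases abs_eq Real.pi_pos.le |>.1 hpi with h | h <;> change y j = _ at h <;> rw [h]
      · exact Complex.exp_pi_mul_I
      · rw [Complex.ofReal_neg, neg_mul, Complex.exp_neg, Complex.exp_pi_mul_I]; norm_num
    have h1 := hd j
    rw [h2] at h1
    norm_num at h1
  have hQy : HasPhases (w • P) y := by
    rw [HasPhases]; simp only [harg]; exact hQ
  have hQn : ‖w • P - 1‖ ≤ 198 / 100 := by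
    rw [hQ.norm_sub_one]
    exact (pi_norm_le_iff_of_nonneg (by norm_num)).2 hd
  let e₀ : n ≃ Fin (Fintype.card n) := Fintype.equivFin n
  let e : n ≃ Fin (Fintype.card n) := e₀.trans (Tuple.sort (y ∘ e₀.symm)).symm
  have hmono : Monotone (y ∘ e.symm) := by
    have : y ∘ e.symm = (y ∘ e₀.symm) ∘ Tuple.sort (y ∘ e₀.symm) := by
      ext j; simp [e]
    rw [this]
    exact Tuple.monotone_sort _
  obtain ⟨x', hx', hsum, hS⟩ := exists_phases_mul_of_window e hn hQy hyp hmono hQn hY hg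
  -- Only the increments of the window carry over to `φ`, which may lie on other branches than `y`.
  refine ⟨fun j => x' j + φ j - y j, ?_, ?_, fun S c hc => ?_⟩
  · have h1 := HasEigenlist.smul hx' w⁻¹
    rw [smul_mul_assoc, smul_smul, inv_mul_cancel₀ hw0, one_smul] at h1
    have hfun : (fun j => Complex.exp ((x' j + φ j - y j : ℝ) * Complex.I))
        = fun j => w⁻¹ * Complex.exp (x' j * Complex.I) := by
      ext j
      have h2 : Complex.exp (φ j * Complex.I) = w⁻¹ * Complex.exp (y j * Complex.I) := by
        rw [harg, ha, ← mul_assoc, inv_mul_cancel₀ hw0, one_mul]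
      have h3 : ((x' j + φ j - y j : ℝ) : ℂ) * Complex.I
          = x' j * Complex.I + φ j * Complex.I - y j * Complex.I := by push_cast; ring
      rw [h3, Complex.exp_sub, Complex.exp_add, h2]
      field_simp [Complex.exp_ne_zero]
    rw [HasPhases, hfun]
    exact h1
  · rw [← hsum]
    exact Finset.sum_congr rfl fun j _ => by ring
  · refine le_trans (le_of_eq (Finset.sum_congr rfl fun j _ => ?_)) (hS S c hc)
    ring

/-- The majorization in `HasPhases.exists_mul` in terms of partial sums. -/
theorem exists_card_sum_le {φ ψ g : n → ℝ} {C : ℝ} (hg : ∀ j, |g j| ≤ C)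
    (h : ∀ (S : Finset n) (c : ℝ), |c| ≤ C → ∑ j ∈ S, (ψ j - φ j - c) ≤ ∑ j, (max (g j) c - c))
    (S : Finset n) : ∃ S' : Finset n, S'.card = S.card ∧
      ∑ j ∈ S, (ψ j - φ j) ≤ ∑ j ∈ S', g j := by
  rcases S.eq_empty_or_nonempty with rfl | hne
  · exact ⟨∅, rfl, by simp⟩
  -- A set of the given size on which the sum of `g` is largest; `c` is the smallest value there.
  obtain ⟨T, hT, hmax⟩ := Finset.exists_max_image (Finset.powersetCard S.card Finset.univ)
    (fun T => ∑ j ∈ T, g j) ⟨S, by simp [Finset.mem_powersetCard]⟩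
  rw [Finset.mem_powersetCard] at hT
  have hTne : T.Nonempty := by
    rw [← Finset.card_pos, hT.2]; exact hne.card_pos
  obtain ⟨i, hi, hmin⟩ := Finset.exists_min_image T g hTne
  refine ⟨T, hT.2, ?_⟩
  have hout : ∀ j, j ∉ T → g j ≤ g i := by
    intro j hj
    have h1 := hmax (insert j (T.erase i)) (by
      rw [Finset.mem_powersetCard]
      refine ⟨Finset.subset_univ _, ?_⟩
      rw [Finset.card_insert_of_notMem (fun hcon => hj (Finset.mem_of_mem_erase hcon)),
        Finset.card_erase_of_mem hi, ← hT.2]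
      have := Finset.card_pos.2 hTne
      omega)
    rw [Finset.sum_insert (fun hcon => hj (Finset.mem_of_mem_erase hcon)),
      ← Finset.add_sum_erase T g hi] at h1
    linarith
  have h2 := h S (g i) (hg i)
  have h3 : ∑ j, (max (g j) (g i) - g i) = ∑ j ∈ T, (g j - g i) := by
    rw [← Finset.sum_subset (Finset.subset_univ T)]
    · exact Finset.sum_congr rfl fun j hj => by rw [max_eq_left (hmin j hj)]
    · intro j _ hj
      rw [max_eq_right (hout j hj), sub_self]
  rw [h3, Finset.sum_sub_distrib, Finset.sum_sub_distrib (fun j => g j), Finset.sum_const,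
    Finset.sum_const, hT.2] at h2
  linarith

end Lidskii

end TwoQubit

/-! ### Compactness of lists of eigenphases -/

namespace TwoQubit

open Matrix MeasureTheory Set Filter Topology
open scoped Matrix.Norms.L2Operator

section Transport

set_option linter.unusedSectionVars false

variable {n : Type*} [Fintype n] [DecidableEq n]

theorem norm_entry_le (A : Matrix n n ℂ) (i j : n) : ‖A i j‖ ≤ ‖A‖ := by
  have h1 := l2_opNorm_mulVec A (EuclideanSpace.single j (1 : ℂ))
  rw [PiLp.norm_single, norm_one, mul_one] at h1
  refine le_trans ?_ h1
  have h2 := EuclideanSpace.norm_eq (WithLp.toLp 2 (A *ᵥ (EuclideanSpace.single j (1 : ℂ)).ofLp))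
  have h3 := PiLp.norm_apply_le (p := 2)
    (WithLp.toLp 2 (A *ᵥ (EuclideanSpace.single j (1 : ℂ)).ofLp)) i
  simpa using h3

theorem norm_le_one_of_mem_unitaryGroup {V : Matrix n n ℂ} (hV : V ∈ unitaryGroup n ℂ) :
    ‖V‖ ≤ 1 := norm_le_one_of_star_mul_self (mem_unitaryGroup_iff'.1 hV)

theorem isCompact_unitaryGroup : IsCompact (unitaryGroup n ℂ : Set (Matrix n n ℂ)) := by
  have : ProperSpace (Matrix n n ℂ) := FiniteDimensional.proper ℂ _
  refine Metric.isCompact_of_isClosed_isBounded ?_ ?_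
  · have : (unitaryGroup n ℂ : Set (Matrix n n ℂ)) = {V | V * star V = 1} := by
      ext V; exact mem_unitaryGroup_iff
    rw [this]
    exact isClosed_eq (continuous_id.mul continuous_star) continuous_const
  · refine Metric.isBounded_closedBall (x := 0) (r := 1) |>.subset fun V hV => ?_
    rw [mem_closedBall_zero_iff]
    exact norm_le_one_of_mem_unitaryGroup hV

theorem isClosed_hasPhases :
    IsClosed {q : Matrix n n ℂ × (n → ℝ) | HasPhases q.1 q.2} := by
  have : CompactSpace (unitaryGroup n ℂ : Set (Matrix n n ℂ)) :=
    isCompact_iff_compactSpace.1 isCompact_unitaryGroup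
  have h1 : IsClosed {r : (unitaryGroup n ℂ : Set (Matrix n n ℂ)) × (Matrix n n ℂ × (n → ℝ)) |
      r.2.1 = r.1.1 * diagonal (fun j => Complex.exp (r.2.2 j * Complex.I)) * (r.1.1)ᴴ} := by
    refine isClosed_eq (by fun_prop) ?_
    refine Continuous.mul (Continuous.mul (by fun_prop) (Continuous.matrix_diagonal ?_)) ?_
    · fun_prop
    · exact Continuous.matrix_conjTranspose (by fun_prop)
  have h2 := isClosedMap_snd_of_compactSpace _ h1
  convert h2 using 1
  ext q
  simp only [mem_ofPred_eq, mem_image, Prod.exists, exists_eq_right, Subtype.exists]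
  exact ⟨fun ⟨V, hV, h⟩ => ⟨V, hV, h⟩, fun ⟨V, hV, h⟩ => ⟨V, hV, h⟩⟩

/-- If `P` has eigenphases in every member of a decreasing sequence of compact sets, it has
eigenphases in their intersection. -/
theorem exists_hasPhases_iInter {P : Matrix n n ℂ} (C : ℕ → Set (n → ℝ))
    (hmono : ∀ m, C (m + 1) ⊆ C m) (hc : ∀ m, IsCompact (C m))
    (h : ∀ m, ∃ ψ ∈ C m, HasPhases P ψ) : ∃ ψ, (∀ m, ψ ∈ C m) ∧ HasPhases P ψ := by
  have hcl : IsClosed {ψ : n → ℝ | HasPhases P ψ} :=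
    isClosed_hasPhases.preimage (f := fun ψ => (P, ψ)) (by fun_prop)
  obtain ⟨ψ, hψ⟩ := IsCompact.nonempty_iInter_of_sequence_nonempty_isCompact_isClosed
    (fun m => C m ∩ {ψ | HasPhases P ψ}) (fun m => inter_subset_inter_left _ (hmono m))
    (fun m => let ⟨ψ, h1, h2⟩ := h m; ⟨ψ, h1, h2⟩) ((hc 0).inter_right hcl)
    (fun m => (hc m).isClosed.inter hcl)
  rw [mem_iInter] at hψ
  exact ⟨ψ, fun m => (hψ m).1, (hψ 0).2⟩

theorem isClosed_exists_hasPhases {C : Set (n → ℝ)} (hC : IsCompact C) :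
    IsClosed {P : Matrix n n ℂ | ∃ ψ ∈ C, HasPhases P ψ} := by
  have : CompactSpace C := isCompact_iff_compactSpace.1 hC
  have h1 : IsClosed {r : C × Matrix n n ℂ | HasPhases r.2 r.1.1} :=
    isClosed_hasPhases.preimage (f := fun r : C × Matrix n n ℂ => (r.2, r.1.1)) (by fun_prop)
  have h2 := isClosedMap_snd_of_compactSpace _ h1
  convert h2 using 1
  ext P
  simp

/-- Vectors with sum zero all of whose partial sums of `k` entries are at most `L k`, both up to an
error `η`. -/
def partialSumSet (L : ℕ → ℝ) (η : ℝ) : Set (n → ℝ) :=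
  {ψ | (∀ S : Finset n, ∑ j ∈ S, ψ j ≤ L S.card + η) ∧ |∑ j, ψ j| ≤ η}

theorem isCompact_partialSumSet (L : ℕ → ℝ) (η : ℝ) :
    IsCompact (partialSumSet L η : Set (n → ℝ)) := by
  refine Metric.isCompact_of_isClosed_isBounded ?_ ?_
  · refine IsClosed.inter ?_ (isClosed_le (f := fun ψ : n → ℝ => |∑ j, ψ j|) (by fun_prop)
      continuous_const)
    change IsClosed {ψ : n → ℝ | ∀ S : Finset n, ∑ j ∈ S, ψ j ≤ L S.card + η}
    simp only [ofPred_forall]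
    exact isClosed_iInter fun S =>
      isClosed_le (f := fun ψ : n → ℝ => ∑ j ∈ S, ψ j) (by fun_prop) continuous_const
  · refine (Metric.isBounded_Icc (fun _ : n => -(L (Fintype.card n - 1) + η) - η)
      (fun _ => L 1 + η)).subset fun ψ hψ => ⟨fun j => ?_, fun j => ?_⟩
    · have h1 := hψ.1 (Finset.univ.erase j)
      rw [Finset.card_erase_of_mem (Finset.mem_univ j), Finset.card_univ] at h1
      have h2 := (abs_le.1 hψ.2).1
      rw [← Finset.add_sum_erase _ _ (Finset.mem_univ j)] at h2
      linarith
    · have h1 := hψ.1 {j}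
      simpa using h1

theorem partialSumSet_mono (L : ℕ → ℝ) {η η' : ℝ} (h : η ≤ η') :
    (partialSumSet L η : Set (n → ℝ)) ⊆ partialSumSet L η' :=
  fun ψ hψ => ⟨fun S => (hψ.1 S).trans (by linarith), hψ.2.trans h⟩

theorem abs_phase_le {x : ℝ} (hx : |x| < Real.pi) :
    |x| ≤ 2 * ‖Complex.exp (x * Complex.I) - 1‖ := by
  rw [mul_comm (x : ℂ), Complex.norm_exp_I_mul_ofReal_sub_one, norm_mul, Real.norm_eq_abs,
    Real.norm_eq_abs, abs_two]
  have h1 := Real.mul_le_sin (x := |x| / 2) (by positivity) (by linarith)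
  have h2 : Real.sin (|x| / 2) ≤ |Real.sin (x / 2)| := by
    rcases abs_cases x with ⟨h, _⟩ | ⟨h, _⟩ <;> rw [h]
    · exact le_abs_self _
    · rw [neg_div, Real.sin_neg]; exact neg_le_abs _
  have h3 : |x| / 4 ≤ 2 / Real.pi * (|x| / 2) := by
    rw [div_mul_eq_mul_div, le_div_iff₀ Real.pi_pos]
    nlinarith [Real.pi_lt_four, abs_nonneg x]
  linarith

theorem abs_sub_sin_le {x : ℝ} (hx : |x| ≤ 1 / 100) : |x - Real.sin x| ≤ x ^ 2 / 4 := by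
  have key : ∀ y : ℝ, 0 ≤ y → y ≤ 1 / 100 → |y - Real.sin y| ≤ y ^ 2 / 4 := by
    intro y h0 h1
    rw [abs_of_nonneg (sub_nonneg.2 (Real.sin_le h0))]
    rcases h0.eq_or_lt with rfl | h0
    · simp
    · have := Real.sin_gt_sub_cube h0
      nlinarith [sq_nonneg y]
  rcases abs_cases x with ⟨h, h'⟩ | ⟨h, h'⟩
  · exact key x h' (by linarith)
  · have := key (-x) (by linarith) (by linarith)
    rw [Real.sin_neg] at this
    rw [show x - Real.sin x = -(-x - -Real.sin x) by ring, abs_neg]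
    linarith [neg_sq x]

end Transport

end TwoQubit

/-! ### Transport of eigenphases along a unitary evolution -/

namespace TwoQubit

open Matrix MeasureTheory Set Filter Topology
open scoped Matrix.Norms.L2Operator

section Transport

set_option linter.unusedSectionVars false

variable {n : Type*} [Fintype n] [DecidableEq n]

/-- The bound `∑ j ∈ S, ⟨yⱼ, G yⱼ⟩ ≤ L S.card` for orthonormal systems `y`: by Ky Fan's principle,
the sums of the largest eigenvalues of `G` are bounded by `L`. -/
def KyFanBound (G : Matrix n n ℂ) (L : ℕ → ℝ) : Prop :=
  ∀ Y ∈ unitaryGroup n ℂ, ∀ S : Finset n, ∑ j ∈ S, ((Yᴴ * G * Y) j j).re ≤ L S.card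

/-- One short step of the transport of eigenphases. The error is of second order in the length
of the step. -/
theorem HasPhases.exists_step (hn : Fintype.card n ≤ 4) {P P' K : Matrix n n ℂ} {φ : n → ℝ}
    {L : ℕ → ℝ} {ε : ℝ} (hP : HasPhases P φ) (hP' : P' ∈ unitaryGroup n ℂ) (hε : ε ≤ 1 / 200)
    (h1 : ‖P' - P‖ ≤ ε) (h2 : ‖P' - P - Complex.I • (P * K)‖ ≤ ε ^ 2) (hK : K.trace.re = 0)
    (hL : KyFanBound K L) :
    ∃ ψ : n → ℝ, HasPhases P' ψ ∧ |∑ j, (ψ j - φ j)| ≤ 8 * ε ^ 2 ∧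
      ∀ S : Finset n, ∑ j ∈ S, (ψ j - φ j) ≤ L S.card + 8 * ε ^ 2 := by
  have hPu := hP.mem_unitaryGroup
  have hPs : Pᴴ ∈ unitaryGroup n ℂ := Unitary.star_mem hPu
  have hε0 : 0 ≤ ε := (norm_nonneg _).trans h1
  set E := Pᴴ * P' with hE
  have hPE : P * E = P' := by rw [hE, ← mul_assoc, mem_unitaryGroup_mul hPu, one_mul]
  have hE1 : ‖E - 1‖ ≤ ε := by
    rw [← CStarRing.norm_mem_unitary_mul (E - 1) hPu, mul_sub, hPE, mul_one]
    exact h1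
  have hE2 : ‖E - 1 - Complex.I • K‖ ≤ ε ^ 2 := by
    rw [← CStarRing.norm_mem_unitary_mul _ hPu, mul_sub, mul_sub, hPE, mul_one, mul_smul_comm]
    exact h2
  obtain ⟨g, hg, hgp⟩ := exists_hasPhases (U := E) (mul_mem hPs hP')
    (hE1.trans_lt (by linarith))
  have hgε : ∀ j, |g j| ≤ 2 * ε := fun j => by
    refine (abs_phase_le (hgp j)).trans ?_
    have := norm_le_pi_norm (fun j => Complex.exp (g j * Complex.I) - 1) j
    rw [← HasEigenlist.norm_sub_one hg] at this
    linarith [this.trans hE1]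
  have hgs : ∀ j, |g j| ≤ 1 / 100 := fun j => (hgε j).trans (by linarith)
  obtain ⟨ψ, hψ, hsum, hS⟩ := hP.exists_mul hn hg hgs
  rw [hPE] at hψ
  obtain ⟨Y, hY, hEY⟩ := hg
  have hYs : Yᴴ ∈ unitaryGroup n ℂ := Unitary.star_mem hY
  -- The eigenphases of `E = 1 + i K + O(ε²)` are the diagonal entries of `K` in an eigenbasis of
  -- `E`, up to second order.
  have hgK : ∀ j, |g j - ((Yᴴ * K * Y) j j).re| ≤ 2 * ε ^ 2 := by
    intro j
    have e1 : Yᴴ * (E - 1 - Complex.I • K) * Y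
        = diagonal (fun j => Complex.exp (g j * Complex.I)) - 1 - Complex.I • (Yᴴ * K * Y) := by
      rw [mul_sub, mul_sub, sub_mul, sub_mul, hEY, mul_one, mem_unitaryGroup_mul' hY,
        mul_smul_comm, smul_mul_assoc]
      congr 2
      calc _ = (Yᴴ * Y) * diagonal (fun j => Complex.exp (g j * Complex.I)) * (Yᴴ * Y) := by
            noncomm_ring
        _ = _ := by rw [mem_unitaryGroup_mul' hY]; simp
    have e2 : ‖(Yᴴ * (E - 1 - Complex.I • K) * Y) j j‖ ≤ ε ^ 2 := by
      refine (norm_entry_le _ j j).trans ?_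
      rw [CStarRing.norm_mul_mem_unitary _ hY, CStarRing.norm_mem_unitary_mul _ hYs]
      exact hE2
    rw [e1] at e2
    have e3 := (Complex.abs_im_le_norm _).trans e2
    simp only [Matrix.sub_apply, diagonal_apply_eq, one_apply_eq, Matrix.smul_apply, smul_eq_mul,
      Complex.sub_im, Complex.one_im, Complex.exp_ofReal_mul_I_im, Complex.mul_im, Complex.I_re,
      Complex.I_im, zero_mul, one_mul, zero_add, sub_zero] at e3
    have e4 := abs_sub_sin_le (hgs j)
    have e5 : g j ^ 2 ≤ (2 * ε) ^ 2 := by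
      rw [← sq_abs]; exact pow_le_pow_left₀ (abs_nonneg _) (hgε j) 2
    have := abs_sub_le (g j) (Real.sin (g j)) ((Yᴴ * K * Y) j j).re
    nlinarith
  have hcard : ∀ S : Finset n, (S.card : ℝ) ≤ 4 := fun S => by
    exact_mod_cast (Finset.card_le_univ S).trans hn
  have herr : ∀ S : Finset n, |∑ j ∈ S, g j - ∑ j ∈ S, ((Yᴴ * K * Y) j j).re| ≤ 8 * ε ^ 2 := by
    intro S
    rw [← Finset.sum_sub_distrib]
    refine (Finset.abs_sum_le_sum_abs _ _).trans ?_
    calc _ ≤ ∑ _j ∈ S, 2 * ε ^ 2 := Finset.sum_le_sum fun j _ => hgK j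
      _ = S.card * (2 * ε ^ 2) := by rw [Finset.sum_const, nsmul_eq_mul]
      _ ≤ 4 * (2 * ε ^ 2) := mul_le_mul_of_nonneg_right (hcard S) (by positivity)
      _ = _ := by ring
  refine ⟨ψ, hψ, ?_, fun S => ?_⟩
  · have h3 : ∑ j, ((Yᴴ * K * Y) j j).re = 0 := by
      rw [← Complex.re_sum]
      change (trace (Yᴴ * K * Y)).re = 0
      rw [trace_mul_comm, ← mul_assoc, mem_unitaryGroup_mul hY, one_mul, hK]
    have := herr Finset.univ
    rw [h3, sub_zero] at this
    rwa [hsum]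
  · obtain ⟨S', hc, hle⟩ := exists_card_sum_le hgs hS S
    have h4 := (abs_le.1 (herr S')).2
    have h5 := hL Y hY S'
    rw [hc] at h5
    linarith

/-- Transport of eigenphases: if `P' = i P G` with `G` traceless and with sums of largest
eigenvalues bounded by `L`, then the eigenphases of `P` change by a vector whose partial sums are
bounded by the integrals of `L`. -/
theorem exists_phases_of_evolution (hn : Fintype.card n ≤ 4) {P G : ℝ → Matrix n n ℂ} {T : ℝ}
    (hT : 0 ≤ T) {L : ℕ → ℝ → ℝ} (hG : IntervalIntegrable G volume 0 T)
    (hL : ∀ k, IntervalIntegrable (L k) volume 0 T)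
    (hPu : ∀ t ∈ Icc 0 T, P t ∈ unitaryGroup n ℂ) (hPc : ContinuousOn P (Icc 0 T))
    (hP : ∀ t ∈ Icc 0 T, P t = P 0 + ∫ r in (0 : ℝ)..t, Complex.I • (P r * G r))
    (hP0 : P 0 = 1) (htr : ∀ r ∈ Icc 0 T, (G r).trace.re = 0)
    (hKF : ∀ r ∈ Icc 0 T, KyFanBound (G r) fun k => L k r) :
    ∃ ψ ∈ partialSumSet (fun k => ∫ r in (0 : ℝ)..T, L k r) 0, HasPhases (P T) ψ := by
  have hIcc : uIcc 0 T = Icc 0 T := uIcc_of_le hT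
  have hsub : ∀ {x y : ℝ}, x ∈ Icc 0 T → y ∈ Icc 0 T → uIcc x y ⊆ uIcc 0 T := fun hx hy =>
    uIcc_subset_uIcc (by rwa [hIcc]) (by rwa [hIcc])
  have h0m : (0 : ℝ) ∈ Icc 0 T := ⟨le_rfl, hT⟩
  set F : ℝ → ℝ := fun t => ∫ r in (0 : ℝ)..t, ‖G r‖ with hF
  have hFc : UniformContinuousOn F (Icc 0 T) := by
    refine isCompact_Icc.uniformContinuousOn_of_continuous ?_
    rw [← hIcc]
    exact intervalIntegral.continuousOn_primitive_interval' hG.norm left_mem_uIcc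
  have hPG : IntervalIntegrable (fun r => Complex.I • (P r * G r)) volume 0 T :=
    (hG.continuousOn_mul (by rwa [hIcc])).smul Complex.I
  have hdiff : ∀ s ∈ Icc 0 T, ∀ t ∈ Icc 0 T,
      P t - P s = ∫ r in s..t, Complex.I • (P r * G r) := by
    intro s hs t ht
    rw [hP t ht, hP s hs, add_sub_add_left_eq_sub, intervalIntegral.integral_interval_sub_left
      (hPG.mono_set (hsub h0m ht)) (hPG.mono_set (hsub h0m hs))]
  have hFdiff : ∀ s ∈ Icc 0 T, ∀ t ∈ Icc 0 T, F t - F s = ∫ r in s..t, ‖G r‖ := by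
    intro s hs t ht
    exact intervalIntegral.integral_interval_sub_left
      (hG.norm.mono_set (hsub h0m ht)) (hG.norm.mono_set (hsub h0m hs))
  have hnormPG : ∀ r ∈ Icc 0 T, ∀ A : Matrix n n ℂ, ‖Complex.I • (P r * A)‖ = ‖A‖ := by
    intro r hr A
    rw [norm_smul, Complex.norm_I, one_mul, CStarRing.norm_mem_unitary_mul _ (hPu r hr)]
  have hlip : ∀ s ∈ Icc 0 T, ∀ t ∈ Icc 0 T, s ≤ t → ‖P t - P s‖ ≤ F t - F s := by
    intro s hs t ht hst
    rw [hdiff s hs t ht, hFdiff s hs t ht]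
    refine intervalIntegral.norm_integral_le_of_norm_le hst (ae_of_all _ fun r hr => ?_)
      (hG.norm.mono_set (hsub hs ht))
    rw [hnormPG r ⟨hs.1.trans hr.1.le, hr.2.trans ht.2⟩]
  have hFmono : ∀ s ∈ Icc 0 T, ∀ t ∈ Icc 0 T, s ≤ t → F s ≤ F t := fun s hs t ht hst => by
    linarith [hlip s hs t ht hst, norm_nonneg (P t - P s)]
  -- Freezing `P` at the left end of an interval costs an error of second order.
  have hsecond : ∀ s ∈ Icc 0 T, ∀ t ∈ Icc 0 T, s ≤ t →
      ‖P t - P s - Complex.I • (P s * ∫ r in s..t, G r)‖ ≤ (F t - F s) ^ 2 := by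
    intro s hs t ht hst
    have hGi := hG.mono_set (hsub hs ht)
    have e1 : Complex.I • (P s * ∫ r in s..t, G r) = ∫ r in s..t, Complex.I • (P s * G r) := by
      have := ((Complex.I • ContinuousLinearMap.mul ℂ (Matrix n n ℂ) (P s)).restrictScalars
        ℝ).intervalIntegral_comp_comm hGi
      simpa using this.symm
    have e3 : IntervalIntegrable (fun r => Complex.I • (P s * G r)) volume s t :=
      (hGi.continuousOn_mul continuousOn_const).smul Complex.I
    rw [e1, hdiff s hs t ht, ← intervalIntegral.integral_sub (hPG.mono_set (hsub hs ht)) e3]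
    have e2 : (F t - F s) ^ 2 = ∫ r in s..t, (F t - F s) * ‖G r‖ := by
      rw [intervalIntegral.integral_const_mul, ← hFdiff s hs t ht, sq]
    rw [e2]
    refine intervalIntegral.norm_integral_le_of_norm_le hst (ae_of_all _ fun r hr => ?_)
      (hGi.norm.const_mul _)
    have hr' : r ∈ Icc 0 T := ⟨hs.1.trans hr.1.le, hr.2.trans ht.2⟩
    rw [← smul_sub, ← sub_mul, norm_smul, Complex.norm_I, one_mul]
    refine (norm_mul_le _ _).trans (mul_le_mul_of_nonneg_right ?_ (norm_nonneg _))
    linarith [hlip s hs r hr' hr.1.le, hFmono r hr' t ht hr.2]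
  have hKFint : ∀ s ∈ Icc 0 T, ∀ t ∈ Icc 0 T, s ≤ t →
      KyFanBound (∫ r in s..t, G r) fun k => ∫ r in s..t, L k r := by
    intro s hs t ht hst Y hY S
    have hGi := hG.mono_set (hsub hs ht)
    let Λ : Matrix n n ℂ →L[ℝ] ℝ := LinearMap.toContinuousLinearMap
      { toFun := fun A => ∑ j ∈ S, ((Yᴴ * A * Y) j j).re
        map_add' := fun A B => by
          simp [mul_add, add_mul, Finset.sum_add_distrib]
        map_smul' := fun c A => by
          simp [Finset.mul_sum] }
    have h1 := Λ.intervalIntegral_comp_comm hGi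
    change Λ (∫ r in s..t, G r) ≤ _
    rw [← h1]
    refine intervalIntegral.integral_mono_on hst (Λ.integrable_comp hGi.1 |> fun h => ?_)
      ((hL _).mono_set (hsub hs ht)) fun r hr => hKF r ⟨hs.1.trans hr.1, hr.2.trans ht.2⟩ Y hY S
    exact (intervalIntegrable_iff_integrableOn_Ioc_of_le hst).2 h
  have htrint : ∀ s ∈ Icc 0 T, ∀ t ∈ Icc 0 T, s ≤ t → (∫ r in s..t, G r).trace.re = 0 := by
    intro s hs t ht hst
    have hGi := hG.mono_set (hsub hs ht)
    let Λ : Matrix n n ℂ →L[ℝ] ℝ := LinearMap.toContinuousLinearMap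
      { toFun := fun A => A.trace.re
        map_add' := fun A B => by simp
        map_smul' := fun c A => by simp }
    have h1 := Λ.intervalIntegral_comp_comm hGi
    change Λ (∫ r in s..t, G r) = _
    rw [← h1, intervalIntegral.integral_congr (g := fun _ => (0 : ℝ)) fun r hr => ?_]
    · simp
    · rw [uIcc_of_le hst] at hr
      exact htr r ⟨hs.1.trans hr.1, hr.2.trans ht.2⟩
  set Λ : ℕ → ℝ → ℝ := fun k t => ∫ r in (0 : ℝ)..t, L k r with hΛ
  -- Eigenphases with an arbitrarily small error, from a sufficiently fine partition.
  have key : ∀ η : ℝ, 0 < η → η ≤ 1 / 200 →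
      ∃ ψ ∈ partialSumSet (fun k => Λ k T) (8 * η * F T), HasPhases (P T) ψ := by
    intro η hη hη'
    obtain ⟨δ, hδ, hδF⟩ := Metric.uniformContinuousOn_iff.1 hFc η hη
    obtain ⟨N, hN⟩ := exists_nat_gt (T / δ)
    have hN0 : 0 < (N : ℝ) + 1 := by positivity
    set τ : ℕ → ℝ := fun k => k * (T / (N + 1)) with hτ
    have hτm : ∀ k : ℕ, k ≤ N + 1 → τ k ∈ Icc 0 T := fun k hk => by
      have hk' : (k : ℝ) ≤ N + 1 := by exact_mod_cast hk
      refine ⟨by positivity, ?_⟩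
      rw [hτ]
      calc (k : ℝ) * (T / (N + 1)) ≤ (N + 1) * (T / (N + 1)) := by gcongr
        _ = T := by field_simp
    have hind : ∀ k : ℕ, k ≤ N + 1 →
        ∃ φ ∈ partialSumSet (fun i => Λ i (τ k)) (8 * η * F (τ k)), HasPhases (P (τ k)) φ := by
      intro k
      induction k with
      | zero =>
        intro _
        refine ⟨0, ⟨fun S => ?_, ?_⟩, ?_⟩
        · simp [hτ, hΛ, hF]
        · simp [hτ, hF]
        · rw [show τ 0 = 0 by simp [hτ], hP0]
          exact ⟨1, one_mem _, by simp⟩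
      | succ k ih =>
        intro hk
        obtain ⟨φ, hφ, hφP⟩ := ih (by omega)
        have hs := hτm k (by omega)
        have ht := hτm (k + 1) hk
        have hτd : τ (k + 1) - τ k = T / (N + 1) := by simp only [hτ]; push_cast; ring
        have hst : τ k ≤ τ (k + 1) := by
          have : 0 ≤ T / (N + 1) := by positivity
          linarith
        have hsmall : F (τ (k + 1)) - F (τ k) ≤ η := by
          have h1 : dist (τ (k + 1)) (τ k) < δ := by
            rw [Real.dist_eq, hτd, abs_of_nonneg (by positivity), div_lt_iff₀ hN0]
            rw [div_lt_iff₀ hδ] at hN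
            nlinarith
          exact (le_abs_self _).trans (hδF _ ht _ hs h1).le
        have hε0 : 0 ≤ F (τ (k + 1)) - F (τ k) := sub_nonneg.2 (hFmono _ hs _ ht hst)
        obtain ⟨ψ, hψ, hψ1, hψ2⟩ := hφP.exists_step hn (hPu _ ht) (hsmall.trans hη')
          (hlip _ hs _ ht hst) (hsecond _ hs _ ht hst) (htrint _ hs _ ht hst)
          (hKFint _ hs _ ht hst)
        have hsq : 8 * (F (τ (k + 1)) - F (τ k)) ^ 2
            ≤ 8 * η * (F (τ (k + 1)) - F (τ k)) := by nlinarith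
        refine ⟨ψ, ⟨fun S => ?_, ?_⟩, hψ⟩
        · have h1 := hφ.1 S
          have h2 := hψ2 S
          have h3 : Λ S.card (τ (k + 1)) - Λ S.card (τ k)
              = ∫ r in (τ k)..(τ (k + 1)), L S.card r :=
            intervalIntegral.integral_interval_sub_left
              ((hL _).mono_set (hsub h0m ht)) ((hL _).mono_set (hsub h0m hs))
          rw [Finset.sum_sub_distrib] at h2
          linarith
        · have h1 := hφ.2
          rw [Finset.sum_sub_distrib] at hψ1
          have h2 := abs_add_le (∑ j, ψ j - ∑ j, φ j) (∑ j, φ j)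
          rw [sub_add_cancel] at h2
          linarith
    have hfin := hind (N + 1) le_rfl
    rwa [show τ (N + 1) = T by simp only [hτ]; push_cast; field_simp] at hfin
  have hFT : 0 ≤ F T := by simpa [hF] using hFmono 0 h0m T ⟨hT, le_rfl⟩ hT
  -- Compactness turns the bounds with arbitrarily small error into exact ones.
  obtain ⟨ψ, hψ, hψP⟩ := exists_hasPhases_iInter (P := P T)
    (fun m : ℕ => partialSumSet (fun k => Λ k T) (8 * (1 / (200 * ((m : ℝ) + 1))) * F T))
    (fun m => partialSumSet_mono _ (by gcongr; simp)) (fun m => isCompact_partialSumSet _ _)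
    (fun m => key _ (by positivity) (by
      rw [div_le_div_iff_of_pos_left one_pos (by positivity) (by norm_num)]
      have : (0 : ℝ) ≤ m := by positivity
      linarith))
  refine ⟨ψ, ⟨fun S => ?_, ?_⟩, hψP⟩
  all_goals
    have hlim : Tendsto (fun m : ℕ => 8 * (1 / (200 * ((m : ℝ) + 1))) * F T) atTop (𝓝 0) := by
      have h1 := tendsto_one_div_add_atTop_nhds_zero_nat (𝕜 := ℝ)
      have h2 := h1.const_mul (8 / 200 * F T)
      rw [mul_zero] at h2
      refine h2.congr fun m => ?_
      field_simp
  · rw [add_zero]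
    refine ge_of_tendsto' (by simpa using hlim.const_add (Λ S.card T)) fun m => (hψ m).1 S
  · exact ge_of_tendsto' hlim fun m => (hψ m).2

end Transport

end TwoQubit

/-! ### The spin flip and the Bell basis -/

namespace TwoQubit

open Matrix
open scoped Matrix.Norms.L2Operator

section Pauli

theorem pauli_conjTranspose (i : Fin 3) : (pauli i)ᴴ = pauli i := by
  ext a b
  fin_cases i <;> fin_cases a <;> fin_cases b <;> simp [pauli, conjTranspose_apply]

theorem pauli_mul_self (i : Fin 3) : pauli i * pauli i = 1 := by
  ext a b
  fin_cases i <;> fin_cases a <;> fin_cases b <;> simp [pauli, mul_apply, Fin.sum_univ_two]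

theorem pauli_mem_unitaryGroup (i : Fin 3) : pauli i ∈ unitaryGroup (Fin 2) ℂ := by
  rw [mem_unitaryGroup_iff, star_eq_conjTranspose, pauli_conjTranspose, pauli_mul_self]

theorem pauli_trace (i : Fin 3) : (pauli i).trace = 0 := by
  fin_cases i <;> simp [pauli, trace, Fin.sum_univ_two]

theorem pauli_one_mul_transpose_mul (i : Fin 3) :
    pauli 1 * (pauli i)ᵀ * pauli 1 = -pauli i := by
  ext a b
  simp only [mul_apply, transpose_apply, Fin.sum_univ_two]
  fin_cases i <;> fin_cases a <;> fin_cases b <;> simp [pauli]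

theorem pauli_one_mul_transpose_mul_mul (A : Matrix (Fin 2) (Fin 2) ℂ) :
    pauli 1 * Aᵀ * pauli 1 * A = A.det • 1 := by
  have h : pauli 1 = Complex.I • !![0, -1; 1, 0] := by
    ext a b
    fin_cases a <;> fin_cases b <;> simp [pauli]
  rw [h, smul_mul_assoc, smul_mul_smul_comm, Complex.I_mul_I, smul_mul_assoc]
  ext a b
  simp only [mul_apply, transpose_apply, Fin.sum_univ_two, Matrix.smul_apply, det_fin_two]
  fin_cases a <;> fin_cases b <;> simp <;> ring

theorem kronecker_mem_unitaryGroup {A B : Matrix (Fin 2) (Fin 2) ℂ}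
    (hA : A ∈ unitaryGroup (Fin 2) ℂ) (hB : B ∈ unitaryGroup (Fin 2) ℂ) :
    A ⊗ₖ B ∈ unitaryGroup (Fin 2 × Fin 2) ℂ := by
  rw [mem_unitaryGroup_iff, star_eq_conjTranspose, conjTranspose_kronecker, ← mul_kronecker_mul,
    mem_unitaryGroup_mul hA, mem_unitaryGroup_mul hB, one_kronecker_one]

/-- The tensor product `σ_y ⊗ σ_y`, which implements the spin flip. -/
def flipOp : Op := pauli 1 ⊗ₖ pauli 1

theorem flipOp_mul_self : flipOp * flipOp = 1 := by
  rw [flipOp, ← mul_kronecker_mul, pauli_mul_self, one_kronecker_one]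

/-- The spin flip `X ↦ (σ_y ⊗ σ_y) Xᵀ (σ_y ⊗ σ_y)`. In the magic basis it is the transposition. -/
def spinFlip (X : Op) : Op := flipOp * Xᵀ * flipOp

theorem spinFlip_mul (X Y : Op) : spinFlip (X * Y) = spinFlip Y * spinFlip X := by
  simp only [spinFlip, transpose_mul]
  calc _ = flipOp * Yᵀ * (1 : Op) * Xᵀ * flipOp := by noncomm_ring
    _ = _ := by rw [← flipOp_mul_self]; noncomm_ring

theorem spinFlip_add (X Y : Op) : spinFlip (X + Y) = spinFlip X + spinFlip Y := by
  simp only [spinFlip, transpose_add]; noncomm_ring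

theorem spinFlip_smul (c : ℂ) (X : Op) : spinFlip (c • X) = c • spinFlip X := by
  simp [spinFlip]

theorem spinFlip_one : spinFlip 1 = 1 := by
  simp [spinFlip, flipOp_mul_self]

theorem spinFlip_sum {ι : Type*} (s : Finset ι) (f : ι → Op) :
    spinFlip (∑ i ∈ s, f i) = ∑ i ∈ s, spinFlip (f i) := by
  simp [spinFlip, transpose_sum, Finset.mul_sum, Finset.sum_mul]

theorem spinFlip_kronecker (A B : Matrix (Fin 2) (Fin 2) ℂ) :
    spinFlip (A ⊗ₖ B) = (pauli 1 * Aᵀ * pauli 1) ⊗ₖ (pauli 1 * Bᵀ * pauli 1) := by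
  rw [spinFlip, flipOp, ← kroneckerMap_transpose, ← mul_kronecker_mul, ← mul_kronecker_mul]

/-- In dimension two, `σ_y Aᵀ σ_y` is the adjugate of `A`. -/
theorem spinFlip_kronecker_mul (A B : Matrix (Fin 2) (Fin 2) ℂ) :
    spinFlip (A ⊗ₖ B) * (A ⊗ₖ B) = (A.det * B.det) • 1 := by
  rw [spinFlip_kronecker, ← mul_kronecker_mul, pauli_one_mul_transpose_mul_mul,
    pauli_one_mul_transpose_mul_mul, smul_kronecker, kronecker_smul, one_kronecker_one, smul_smul]

theorem spinFlip_couplingHam (M : Matrix (Fin 3) (Fin 3) ℝ) :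
    spinFlip (couplingHam M) = couplingHam M := by
  rw [couplingHam, spinFlip_sum]
  refine Finset.sum_congr rfl fun i _ => ?_
  rw [spinFlip_sum]
  refine Finset.sum_congr rfl fun j _ => ?_
  rw [spinFlip_smul, spinFlip_kronecker, pauli_one_mul_transpose_mul, pauli_one_mul_transpose_mul]
  congr 1
  ext ⟨a, b⟩ ⟨c, d⟩
  simp [kroneckerMap_apply]

theorem spinFlip_canonicalHam (β : Fin 3 → ℝ) : spinFlip (canonicalHam β) = canonicalHam β := by
  rw [canonicalHam, spinFlip_sum]
  refine Finset.sum_congr rfl fun i _ => ?_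
  rw [spinFlip_smul, spinFlip_kronecker, pauli_one_mul_transpose_mul]
  congr 1
  ext ⟨a, b⟩ ⟨c, d⟩
  simp [kroneckerMap_apply]

theorem spinFlip_localHam (a b : Fin 3 → ℝ) : spinFlip (localHam a b) = -localHam a b := by
  have h1 : pauli 1 * (1 : Matrix (Fin 2) (Fin 2) ℂ)ᵀ * pauli 1 = 1 := by
    rw [transpose_one, mul_one, pauli_mul_self]
  rw [localHam, spinFlip_sum, ← Finset.sum_neg_distrib]
  refine Finset.sum_congr rfl fun i _ => ?_
  rw [spinFlip_add, spinFlip_smul, spinFlip_smul, spinFlip_kronecker, spinFlip_kronecker, h1,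
    pauli_one_mul_transpose_mul, neg_add, ← smul_neg, ← smul_neg]
  congr 2
  · ext ⟨a, b⟩ ⟨c, d⟩
    simp [kroneckerMap_apply]
  · ext ⟨a, b⟩ ⟨c, d⟩
    simp [kroneckerMap_apply]

theorem couplingHam_conjTranspose (M : Matrix (Fin 3) (Fin 3) ℝ) :
    (couplingHam M)ᴴ = couplingHam M := by
  simp [couplingHam, conjTranspose_sum, conjTranspose_smul, conjTranspose_kronecker,
    pauli_conjTranspose]

theorem localHam_conjTranspose (a b : Fin 3 → ℝ) : (localHam a b)ᴴ = localHam a b := by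
  simp [localHam, conjTranspose_sum, conjTranspose_smul, conjTranspose_kronecker,
    pauli_conjTranspose]

theorem couplingHam_trace (M : Matrix (Fin 3) (Fin 3) ℝ) : (couplingHam M).trace = 0 := by
  simp [couplingHam, trace_sum, trace_smul, trace_kronecker, pauli_trace]

/-- The eigenvalues of `H_β`, indexed by the Bell states `Φ⁺, Ψ⁺, Ψ⁻, Φ⁻` at the indices
`(0,0), (0,1), (1,0), (1,1)`. -/
def bellEig (β : Fin 3 → ℝ) : Fin 2 × Fin 2 → ℝ :=
  fun p => !![β 0 - β 1 + β 2, β 0 + β 1 - β 2; -β 0 - β 1 - β 2, -β 0 + β 1 + β 2] p.1 p.2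

/-- The unitary matrix whose columns are the Bell states. -/
noncomputable def bellBasis : Op := (Real.sqrt 2 : ℂ)⁻¹ • Matrix.of fun p q =>
  (!![!![1, 0; 0, 1], !![0, 1; 1, 0]; !![0, 1; -1, 0], !![1, 0; 0, -1]] :
    Matrix (Fin 2) (Fin 2) (Matrix (Fin 2) (Fin 2) ℂ)) q.1 q.2 p.1 p.2

theorem sqrt_two_inv_sq : (Real.sqrt 2 : ℂ)⁻¹ * (Real.sqrt 2 : ℂ)⁻¹ = 1 / 2 := by
  rw [← mul_inv, ← Complex.ofReal_mul, Real.mul_self_sqrt (by norm_num)]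
  norm_num

theorem bellBasis_mem : bellBasis ∈ unitaryGroup (Fin 2 × Fin 2) ℂ := by
  rw [mem_unitaryGroup_iff, star_eq_conjTranspose, bellBasis, conjTranspose_smul,
    smul_mul_smul_comm, star_inv₀, RCLike.star_def, Complex.conj_ofReal, sqrt_two_inv_sq]
  ext ⟨a, b⟩ ⟨c, d⟩
  rw [Matrix.smul_apply, mul_apply, Fintype.sum_prod_type]
  fin_cases a <;> fin_cases b <;> fin_cases c <;> fin_cases d <;>
    simp [conjTranspose_apply, Fin.sum_univ_two, one_apply] <;> norm_num

theorem canonicalHam_eq_conj (β : Fin 3 → ℝ) :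
    canonicalHam β = bellBasis * diagonal (fun j => (bellEig β j : ℂ)) * bellBasisᴴ := by
  rw [bellBasis, conjTranspose_smul, smul_mul_assoc, smul_mul_smul_comm, star_inv₀,
    RCLike.star_def, Complex.conj_ofReal, sqrt_two_inv_sq]
  ext ⟨a, b⟩ ⟨c, d⟩
  rw [Matrix.smul_apply, mul_apply, Fintype.sum_prod_type]
  simp only [canonicalHam, Fin.sum_univ_three, mul_diagonal, conjTranspose_apply,
    Fin.sum_univ_two]
  fin_cases a <;> fin_cases b <;> fin_cases c <;> fin_cases d <;>
    simp [kroneckerMap_apply, pauli, bellEig] <;> ring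

theorem canonicalHam_hasEigenlist (β : Fin 3 → ℝ) :
    HasEigenlist (canonicalHam β) (fun j => (bellEig β j : ℂ)) :=
  ⟨bellBasis, bellBasis_mem, canonicalHam_eq_conj β⟩

theorem canonicalGate_eq (β : Fin 3 → ℝ) :
    canonicalGate β = phaseMatrix bellBasis (fun j => -bellEig β j) := by
  have h : (-Complex.I) • canonicalHam β = Complex.I • (bellBasis *
      diagonal (fun j => ((-bellEig β j : ℝ) : ℂ)) * bellBasisᴴ) := by
    rw [canonicalHam_eq_conj, show diagonal (fun j => ((-bellEig β j : ℝ) : ℂ)) =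
      -diagonal (fun j => (bellEig β j : ℂ)) by rw [diagonal_neg]; congr 1; ext j; simp,
      mul_neg, neg_mul, smul_neg, neg_smul]
  rw [canonicalGate, h, exp_I_smul_conj bellBasis_mem, phaseMatrix]

end Pauli

end TwoQubit

/-! ### Canonical parameters of a Hamiltonian -/

namespace TwoQubit

open Matrix MeasureTheory Set
open scoped Matrix.Norms.L2Operator

section EigenlistNorm

set_option linter.unusedSectionVars false

variable {n : Type*} [Fintype n] [DecidableEq n]

theorem HasEigenlist.conj {A W : Matrix n n ℂ} {a : n → ℂ} (h : HasEigenlist A a)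
    (hW : W ∈ unitaryGroup n ℂ) : HasEigenlist (W * A * Wᴴ) a := by
  obtain ⟨V, hV, rfl⟩ := h
  refine ⟨W * V, mul_mem hW hV, ?_⟩
  rw [conjTranspose_mul]
  noncomm_ring

theorem HasEigenlist.add_const {A : Matrix n n ℂ} {a : n → ℂ} (h : HasEigenlist A a) (c : ℂ) :
    HasEigenlist (A + c • 1) (fun j => a j + c) := by
  obtain ⟨V, hV, rfl⟩ := h
  refine ⟨V, hV, ?_⟩
  rw [← diagonal_add, ← smul_one_eq_diagonal c, mul_add, add_mul, mul_smul_comm, smul_mul_assoc,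
    mul_one, mem_unitaryGroup_mul hV]

theorem HasEigenlist.isHermitian {A : Matrix n n ℂ} {a : n → ℝ}
    (h : HasEigenlist A (fun j => (a j : ℂ))) : Aᴴ = A := by
  obtain ⟨V, hV, rfl⟩ := h
  exact conjTranspose_conj_real V a

theorem HasEigenlist.abs_le_norm {A : Matrix n n ℂ} {a : n → ℝ}
    (h : HasEigenlist A (fun j => (a j : ℂ))) (j : n) : |a j| ≤ ‖A‖ := by
  obtain ⟨V, hV, rfl⟩ := h
  rw [norm_conj hV, l2_opNorm_diagonal]
  have := norm_le_pi_norm (fun j => (a j : ℂ)) j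
  simpa using this

/-- Weyl's perturbation bound for compatibly arranged eigenvalues. -/
theorem HasEigenlist.le_add_norm_sub {A B : Matrix n n ℂ} {a b : n → ℝ}
    (hA : HasEigenlist A (fun j => (a j : ℂ))) (hB : HasEigenlist B (fun j => (b j : ℂ)))
    (hab : ∀ i j, a i < a j → b i ≤ b j) (j : n) : a j ≤ b j + ‖A - B‖ := by
  have hB' : HasEigenlist (B + (‖A - B‖ : ℂ) • 1) (fun j => ((b j + ‖A - B‖ : ℝ) : ℂ)) := by
    convert hB.add_const (‖A - B‖ : ℂ) using 2
    push_cast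
    rfl
  refine le_of_quadForm_le hA hB' (fun i j h => by linarith [hab i j h]) (fun w => ?_) j
  obtain ⟨d, hd⟩ := exists_hasEigenlist_of_isHermitian (X := A - B) (by
    rw [IsHermitian, conjTranspose_sub, hA.isHermitian, hB.isHermitian])
  have hdle := hd.abs_le_norm
  have h1 : quadForm A w = quadForm B w + quadForm (A - B) w := by
    simp [quadForm, sub_mulVec, dotProduct_sub]
  have h2 : quadForm (B + (‖A - B‖ : ℂ) • 1) w
      = quadForm B w + ‖A - B‖ * ∑ j, Complex.normSq (w j) := by
    have h3 : star w ⬝ᵥ w = ((∑ j, Complex.normSq (w j) : ℝ) : ℂ) := by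
      rw [dotProduct, Complex.ofReal_sum]
      exact Finset.sum_congr rfl fun j _ => by
        rw [Pi.star_apply, RCLike.star_def, mul_comm, Complex.mul_conj]
    simp only [quadForm, add_mulVec, dotProduct_add, smul_mulVec, one_mulVec, dotProduct_smul, h3,
      Complex.add_re, smul_eq_mul, ← Complex.ofReal_mul, Complex.ofReal_re]
  rw [h1, h2]
  gcongr
  obtain ⟨V, hV, he⟩ := hd
  rw [← sum_normSq_conj hV w, Finset.mul_sum, he, quadForm_conj_diagonal, ← he]
  exact Finset.sum_le_sum fun j _ =>
    mul_le_mul_of_nonneg_right ((le_abs_self _).trans (hdle j)) (Complex.normSq_nonneg _)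

theorem sum_normSq_col {Q : Matrix n n ℂ} (hQ : Q ∈ unitaryGroup n ℂ) (j : n) :
    ∑ i, Complex.normSq (Q i j) = 1 := by
  have h := congrFun (congrFun (mem_unitaryGroup_mul' hQ) j) j
  rw [mul_apply, one_apply_eq] at h
  have h2 : ((∑ i, Complex.normSq (Q i j) : ℝ) : ℂ) = 1 := by
    rw [← h, Complex.ofReal_sum]
    exact Finset.sum_congr rfl fun i _ => by
      rw [conjTranspose_apply, RCLike.star_def, mul_comm, Complex.mul_conj]
  exact_mod_cast h2

theorem sum_normSq_row {Q : Matrix n n ℂ} (hQ : Q ∈ unitaryGroup n ℂ) (i : n) :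
    ∑ j, Complex.normSq (Q i j) = 1 := by
  have h := sum_normSq_col (Unitary.star_mem hQ) i
  simpa [star_eq_conjTranspose, conjTranspose_apply, Complex.normSq_conj] using h

theorem re_conj_diagonal (Q : Matrix n n ℂ) (a : n → ℝ) (j : n) :
    ((Qᴴ * diagonal (fun i => (a i : ℂ)) * Q) j j).re = ∑ i, a i * Complex.normSq (Q i j) := by
  rw [mul_apply, Complex.re_sum]
  refine Finset.sum_congr rfl fun i _ => ?_
  rw [mul_diagonal, conjTranspose_apply, Complex.normSq_apply]
  simp
  ring

/-- Doubly substochastic weights turn a bound on weighted sums of eigenvalues into a bound of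
Ky Fan type. -/
theorem HasEigenlist.kyFanBound {A : Matrix n n ℂ} {a : n → ℝ}
    (h : HasEigenlist A (fun j => (a j : ℂ))) {L : ℕ → ℝ}
    (hL : ∀ (w : n → ℝ) (k : ℕ), k ≤ Fintype.card n → (∀ i, 0 ≤ w i) → (∀ i, w i ≤ 1) →
      ∑ i, w i = k → ∑ i, a i * w i ≤ L k) : KyFanBound A L := by
  obtain ⟨V, hV, rfl⟩ := h
  intro Y hY S
  have hQ : Vᴴ * Y ∈ unitaryGroup n ℂ := mul_mem (Unitary.star_mem hV) hY
  have h1 : Yᴴ * (V * diagonal (fun j => (a j : ℂ)) * Vᴴ) * Y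
      = (Vᴴ * Y)ᴴ * diagonal (fun j => (a j : ℂ)) * (Vᴴ * Y) := by
    rw [conjTranspose_mul, conjTranspose_conjTranspose]; noncomm_ring
  rw [h1]
  simp only [re_conj_diagonal]
  rw [Finset.sum_comm]
  simp only [← Finset.mul_sum]
  refine hL _ _ (Finset.card_le_univ _) (fun i => Finset.sum_nonneg fun j _ =>
    Complex.normSq_nonneg _) (fun i => ?_) ?_
  · rw [← sum_normSq_row hQ i]
    exact Finset.sum_le_univ_sum_of_nonneg fun j => Complex.normSq_nonneg _
  · rw [Finset.sum_comm, Finset.sum_congr rfl fun j _ => sum_normSq_col hQ j]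
    simp

end EigenlistNorm

section Canonical

/-- The chamber `θ₁ ≥ θ₂ ≥ |θ₃|` of canonical parameters. -/
def IsOrdered (θ : Fin 3 → ℝ) : Prop := |θ 2| ≤ θ 1 ∧ θ 1 ≤ θ 0

theorem IsHamParams.isOrdered {H : Op} {θ : Fin 3 → ℝ} (h : IsHamParams H θ) : IsOrdered θ :=
  ⟨h.1, h.2.1⟩

theorem IsHamParams.hasEigenlist {H : Op} {θ : Fin 3 → ℝ} (h : IsHamParams H θ) :
    HasEigenlist H (fun j => (bellEig θ j : ℂ)) := by
  obtain ⟨-, -, A, hA, B, hB, rfl⟩ := h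
  have := (canonicalHam_hasEigenlist θ).conj (Unitary.star_mem (kronecker_mem_unitaryGroup hA hB))
  rwa [star_eq_conjTranspose, conjTranspose_conjTranspose] at this

theorem bellEig_compatible {θ θ' : Fin 3 → ℝ} (h : IsOrdered θ) (h' : IsOrdered θ')
    (p q : Fin 2 × Fin 2) (hpq : bellEig θ p < bellEig θ q) : bellEig θ' p ≤ bellEig θ' q := by
  obtain ⟨h1, h2⟩ := h
  obtain ⟨h3, h4⟩ := h'
  rw [abs_le] at h1 h3
  obtain ⟨a, b⟩ := p
  obtain ⟨c, d⟩ := q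
  fin_cases a <;> fin_cases b <;> fin_cases c <;> fin_cases d <;>
    simp [bellEig] at hpq ⊢ <;> linarith

/-- Canonical parameters depend on the Hamiltonian in a Lipschitz way. -/
theorem IsHamParams.abs_sub_le {H H' : Op} {θ θ' : Fin 3 → ℝ} (h : IsHamParams H θ)
    (h' : IsHamParams H' θ') (i : Fin 3) : |θ i - θ' i| ≤ ‖H - H'‖ := by
  have h1 := h.hasEigenlist.le_add_norm_sub h'.hasEigenlist
    (bellEig_compatible h.isOrdered h'.isOrdered)
  have h2 := h'.hasEigenlist.le_add_norm_sub h.hasEigenlist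
    (bellEig_compatible h'.isOrdered h.isOrdered)
  rw [norm_sub_rev H' H] at h2
  have a1 := h1 (0, 0)
  have a2 := h1 (0, 1)
  have a3 := h1 (1, 1)
  have b1 := h2 (0, 0)
  have b2 := h2 (0, 1)
  have b3 := h2 (1, 1)
  simp [bellEig] at a1 a2 a3 b1 b2 b3
  rw [abs_le]
  fin_cases i <;> simp <;> constructor <;> linarith

theorem intervalIntegrable_couplingHam {M : ℝ → Matrix (Fin 3) (Fin 3) ℝ} {a b : ℝ}
    (hM : ∀ i j, IntervalIntegrable (fun t => M t i j) volume a b) :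
    IntervalIntegrable (fun t => couplingHam (M t)) volume a b := by
  have h : (fun t => couplingHam (M t)) = ∑ i, ∑ j, fun t => M t i j • (pauli i ⊗ₖ pauli j) := by
    funext t
    simp only [couplingHam, Finset.sum_apply, Complex.coe_smul]
  rw [h]
  refine IntervalIntegrable.sum _ fun i _ => IntervalIntegrable.sum _ fun j _ => ?_
  exact ⟨(hM i j).1.smul_const _, (hM i j).2.smul_const _⟩

theorem intervalIntegrable_localHam {a b : ℝ → Fin 3 → ℝ} {u v : ℝ}
    (ha : ∀ i, IntervalIntegrable (fun t => a t i) volume u v)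
    (hb : ∀ i, IntervalIntegrable (fun t => b t i) volume u v) :
    IntervalIntegrable (fun t => localHam (a t) (b t)) volume u v := by
  have h : (fun t => localHam (a t) (b t)) =
      ∑ i, ((fun t => a t i • (pauli i ⊗ₖ (1 : Matrix (Fin 2) (Fin 2) ℂ))) +
        fun t => b t i • ((1 : Matrix (Fin 2) (Fin 2) ℂ) ⊗ₖ pauli i)) := by
    funext t
    simp only [localHam, Finset.sum_apply, Pi.add_apply, Complex.coe_smul]
  rw [h]
  exact IntervalIntegrable.sum _ fun i _ =>
    .add ⟨(ha i).1.smul_const _, (ha i).2.smul_const _⟩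
      ⟨(hb i).1.smul_const _, (hb i).2.smul_const _⟩

/-- Being a Lipschitz function of an integrable Hamiltonian, the canonical parameters are
integrable. -/
theorem intervalIntegrable_params {H : ℝ → Op} {θ : ℝ → Fin 3 → ℝ} {T : ℝ} (hT : 0 ≤ T)
    (hH : IntervalIntegrable H volume 0 T) (hθ : ∀ t, 0 ≤ t → IsHamParams (H t) (θ t))
    (i : Fin 3) : IntervalIntegrable (fun t => θ t i) volume 0 T := by
  classical
  -- The parameters are a Lipschitz function on the set `D` of the Hamiltonians that have them; an
  -- extension to all operators shows their measurability.
  let D : Set Op := {X | ∃ η, IsHamParams X η}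
  let g : Op → ℝ := fun X => if h : ∃ η, IsHamParams X η then h.choose i else 0
  have hg : ∀ X η, IsHamParams X η → g X = η i := fun X η h => by
    have h' : ∃ η, IsHamParams X η := ⟨η, h⟩
    have := h'.choose_spec.abs_sub_le h i
    rw [sub_self, norm_zero, abs_nonpos_iff, sub_eq_zero] at this
    simp only [g, dif_pos h', this]
  have hLip : LipschitzOnWith 1 g D := by
    refine LipschitzOnWith.of_dist_le_mul fun X hX Y hY => ?_
    obtain ⟨η, hη⟩ := hX
    obtain ⟨ζ, hζ⟩ := hY
    rw [hg X η hη, hg Y ζ hζ, Real.dist_eq, dist_eq_norm, NNReal.coe_one, one_mul]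
    exact hη.abs_sub_le hζ i
  obtain ⟨f, hf, hfg⟩ := hLip.extend_real
  have hθf : ∀ t, 0 ≤ t → θ t i = f (H t) := fun t ht => by
    rw [← hfg ⟨_, hθ t ht⟩, hg _ _ (hθ t ht)]
  have hmeas : AEStronglyMeasurable (fun t => f (H t)) (volume.restrict (uIoc 0 T)) :=
    hf.continuous.comp_aestronglyMeasurable hH.def'.aestronglyMeasurable
  have hint : IntervalIntegrable (fun t => f (H t)) volume 0 T := by
    refine ((intervalIntegrable_const (c := |f 0|)).add hH.norm).mono_fun hmeas
      (Filter.Eventually.of_forall fun t => ?_)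
    have := hf.dist_le_mul (H t) 0
    rw [Real.dist_eq, dist_zero_right, NNReal.coe_one, one_mul] at this
    simp only [Real.norm_eq_abs]
    refine le_trans ?_ (le_abs_self _)
    have h2 := abs_sub_abs_le_abs_sub (f (H t)) (f 0)
    linarith
  refine hint.congr fun t ht => ?_
  rw [uIoc_of_le hT] at ht
  exact (hθf t ht.1.le).symm

/-- The bounds on the sums of the `k` largest eigenvalues of `-2 H`, for a Hamiltonian `H` with
canonical parameters `θ`. -/
def kyFanProfile (θ : Fin 3 → ℝ) : ℕ → ℝ
  | 1 => 2 * (θ 0 + θ 1 + θ 2)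
  | 2 => 4 * θ 0
  | 3 => 2 * (θ 0 + θ 1 - θ 2)
  | _ => 0

theorem kyFanProfile_nonneg {θ : Fin 3 → ℝ} (h : IsOrdered θ) (k : ℕ) : 0 ≤ kyFanProfile θ k := by
  obtain ⟨h1, h2⟩ := h
  rw [abs_le] at h1
  unfold kyFanProfile
  split <;> linarith

theorem kyFanBound_of_eigenlist {G : Op} {θ : Fin 3 → ℝ} (hθ : IsOrdered θ)
    (h : HasEigenlist G (fun j => ((-2 * bellEig θ j : ℝ) : ℂ))) :
    KyFanBound G (kyFanProfile θ) := by
  refine h.kyFanBound fun w k hk h0 h1 hs => ?_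
  obtain ⟨ho1, ho2⟩ := hθ
  rw [abs_le] at ho1
  have hc : Fintype.card (Fin 2 × Fin 2) = 4 := rfl
  rw [hc] at hk
  have a0 := h0 (0, 0); have a1 := h0 (0, 1); have a2 := h0 (1, 0); have a3 := h0 (1, 1)
  have b0 := h1 (0, 0); have b1 := h1 (0, 1); have b2 := h1 (1, 0); have b3 := h1 (1, 1)
  simp only [Fintype.sum_prod_type, Fin.sum_univ_two] at hs ⊢
  simp only [bellEig, Matrix.of_apply, Matrix.cons_val_zero, Matrix.cons_val_one]
  generalize w (0, 0) = x at *
  generalize w (0, 1) = y at *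
  generalize w (1, 0) = z at *
  generalize w (1, 1) = v at *
  have hz : z = k - x - y - v := by linarith
  interval_cases k <;> simp only [kyFanProfile] <;> push_cast at hz
  · have : x = 0 := by linarith
    have : y = 0 := by linarith
    have : z = 0 := by linarith
    have : v = 0 := by linarith
    simp [*]
  -- For `k = 1, 2, 3` the multipliers are the gaps between eigenvalues.
  · nlinarith [mul_nonneg a0 (show 0 ≤ θ 0 + θ 2 by linarith),
      mul_nonneg a1 (show 0 ≤ θ 0 + θ 1 by linarith),
      mul_nonneg a3 (show 0 ≤ θ 1 + θ 2 by linarith)]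
  · nlinarith [mul_nonneg a0 (show 0 ≤ θ 0 - θ 1 by linarith),
      mul_nonneg a1 (show 0 ≤ θ 0 - θ 2 by linarith),
      mul_nonneg (sub_nonneg.2 b2) (show 0 ≤ θ 1 + θ 2 by linarith)]
  · nlinarith [mul_nonneg (sub_nonneg.2 b0) (show 0 ≤ θ 1 - θ 2 by linarith),
      mul_nonneg (sub_nonneg.2 b2) (show 0 ≤ θ 0 + θ 1 by linarith),
      mul_nonneg (sub_nonneg.2 b3) (show 0 ≤ θ 0 - θ 2 by linarith)]
  · have : x = 1 := by linarith
    have : y = 1 := by linarith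
    have : z = 1 := by linarith
    have : v = 1 := by linarith
    simp [*]; linarith

theorem IsHamParams.kyFanBound {H V : Op} {θ : Fin 3 → ℝ} (h : IsHamParams H θ)
    (hV : V ∈ unitaryGroup (Fin 2 × Fin 2) ℂ) :
    KyFanBound ((-2 : ℂ) • (Vᴴ * H * V)) (kyFanProfile θ) := by
  refine kyFanBound_of_eigenlist h.isOrdered ?_
  have h1 := (h.hasEigenlist.conj (Unitary.star_mem hV)).smul (-2)
  rw [star_eq_conjTranspose, conjTranspose_conjTranspose] at h1
  convert h1 using 2
  push_cast
  rfl

end Canonical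

end TwoQubit

/-! ### The s-order and s-majorization -/

namespace TwoQubit

section SOrder

/-- Vectors of signs with product one: the sign changes of an even number of coordinates. -/
def IsSigns (ε : Fin 3 → ℝ) : Prop := (∀ i, ε i = 1 ∨ ε i = -1) ∧ ∏ i, ε i = 1

theorem IsSigns.mul_self {ε : Fin 3 → ℝ} (h : IsSigns ε) (i : Fin 3) : ε i * ε i = 1 := by
  rcases h.1 i with h | h <;> rw [h] <;> norm_num

theorem IsSigns.abs {ε : Fin 3 → ℝ} (h : IsSigns ε) (i : Fin 3) : |ε i| = 1 := by
  rcases h.1 i with h | h <;> rw [h] <;> norm_num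

theorem IsSigns.mul {ε ε' : Fin 3 → ℝ} (h : IsSigns ε) (h' : IsSigns ε') :
    IsSigns fun i => ε i * ε' i := by
  refine ⟨fun i => ?_, ?_⟩
  · change ε i * ε' i = 1 ∨ ε i * ε' i = -1
    rcases h.1 i with h | h <;> rcases h'.1 i with h' | h' <;> rw [h, h'] <;> norm_num
  · rw [Finset.prod_mul_distrib, h.2, h'.2, one_mul]

theorem IsSigns.comp {ε : Fin 3 → ℝ} (h : IsSigns ε) (σ : Equiv.Perm (Fin 3)) :
    IsSigns fun i => ε (σ i) :=
  ⟨fun i => h.1 _, by rw [Equiv.prod_comp σ ε, h.2]⟩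

theorem isSigns_cons {a b c : ℝ} (ha : a = 1 ∨ a = -1) (hb : b = 1 ∨ b = -1) (hc : a * b = c) :
    IsSigns ![a, b, c] := by
  refine ⟨fun i => ?_, ?_⟩
  · fin_cases i
    · exact ha
    · exact hb
    · rcases ha with rfl | rfl <;> rcases hb with rfl | rfl <;> simp [← hc]
  · rcases ha with rfl | rfl <;> rcases hb with rfl | rfl <;>
      simp [Fin.prod_univ_three, ← hc]

theorem isSigns_one : IsSigns ![1, 1, 1] :=
  isSigns_cons (.inl rfl) (.inl rfl) (by norm_num)

theorem isSigns_neg_neg_one : IsSigns ![-1, -1, 1] :=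
  isSigns_cons (.inr rfl) (.inr rfl) (by norm_num)

/-- Each eigenvalue of `-H_x` is a combination of the coordinates of `x` with signs of product
one, and conversely. -/
theorem exists_isSigns_bellEig (k : Fin 2 × Fin 2) :
    ∃ ε, IsSigns ε ∧ ∀ x, bellEig x k = -∑ i, ε i * x i := by
  obtain ⟨a, b⟩ := k
  fin_cases a <;> fin_cases b
  · refine ⟨![-1, 1, -1], isSigns_cons (.inr rfl) (.inl rfl) (by norm_num), fun x => ?_⟩
    simp [bellEig, Fin.sum_univ_three]; ring
  · refine ⟨![-1, -1, 1], isSigns_cons (.inr rfl) (.inr rfl) (by norm_num), fun x => ?_⟩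
    simp [bellEig, Fin.sum_univ_three]; ring
  · refine ⟨![1, 1, 1], isSigns_cons (.inl rfl) (.inl rfl) (by norm_num), fun x => ?_⟩
    simp [bellEig, Fin.sum_univ_three]; ring
  · refine ⟨![1, -1, -1], isSigns_cons (.inl rfl) (.inr rfl) (by norm_num), fun x => ?_⟩
    simp [bellEig, Fin.sum_univ_three]; ring

theorem exists_bellEig_eq {ε : Fin 3 → ℝ} (h : IsSigns ε) :
    ∃ k, ∀ x, bellEig x k = -∑ i, ε i * x i := by
  have hp := h.2
  rw [Fin.prod_univ_three] at hp
  rcases h.1 0 with h0 | h0 <;> rcases h.1 1 with h1 | h1 <;> rw [h0, h1] at hp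
  · exact ⟨(1, 0), fun x => by
      simp [bellEig, Fin.sum_univ_three, h0, h1, show ε 2 = 1 by linarith]; ring⟩
  · exact ⟨(1, 1), fun x => by
      simp [bellEig, Fin.sum_univ_three, h0, h1, show ε 2 = -1 by linarith]; ring⟩
  · exact ⟨(0, 0), fun x => by
      simp [bellEig, Fin.sum_univ_three, h0, h1, show ε 2 = -1 by linarith]; ring⟩
  · exact ⟨(0, 1), fun x => by
      simp [bellEig, Fin.sum_univ_three, h0, h1, show ε 2 = 1 by linarith]; ring⟩

theorem exists_sOrder_eq (x : Fin 3 → ℝ) : ∃ σ : Equiv.Perm (Fin 3), ∃ ε, IsSigns ε ∧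
    (∀ i, sOrder x i = ε i * x (σ i)) ∧ IsOrdered (sOrder x) := by
  set f : Fin 3 → ℝ := fun i => |x i| with hf
  set σ : Equiv.Perm (Fin 3) := Fin.revPerm.trans (Tuple.sort f) with hσ
  have hdec : ∀ i, decreasing f i = |x (σ i)| := fun i => rfl
  have hmono : Monotone (f ∘ Tuple.sort f) := Tuple.monotone_sort f
  have h01 : |x (σ 1)| ≤ |x (σ 0)| := hmono (show Fin.rev 1 ≤ Fin.rev (0 : Fin 3) by decide)
  have h12 : |x (σ 2)| ≤ |x (σ 1)| := hmono (show Fin.rev 2 ≤ Fin.rev (1 : Fin 3) by decide)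
  have hsg : ∀ r : ℝ, ∃ s : ℝ, (s = 1 ∨ s = -1) ∧ |r| = s * r := fun r => by
    rcases abs_cases r with ⟨h, _⟩ | ⟨h, _⟩
    · exact ⟨1, .inl rfl, by rw [h, one_mul]⟩
    · exact ⟨-1, .inr rfl, by rw [h]; ring⟩
  obtain ⟨a, ha, hax⟩ := hsg (x (σ 0))
  obtain ⟨b, hb, hbx⟩ := hsg (x (σ 1))
  have hprod : x 0 * x 1 * x 2 = x (σ 0) * x (σ 1) * x (σ 2) := by
    rw [← Fin.prod_univ_three, ← Fin.prod_univ_three fun i => x (σ i), Equiv.prod_comp σ x]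
  have h2 : Real.sign (x 0 * x 1 * x 2) * |x (σ 2)| = a * b * x (σ 2) := by
    rw [hprod]
    rcases eq_or_ne (x (σ 2)) 0 with h0 | h0
    · simp [h0]
    have p2 : 0 < |x (σ 2)| := abs_pos.2 h0
    have h1p : 0 < |x (σ 0)| * |x (σ 1)| := mul_pos (by linarith) (by linarith)
    have e : x (σ 0) * x (σ 1) = a * b * (|x (σ 0)| * |x (σ 1)|) := by
      rw [hax, hbx]
      rcases ha with rfl | rfl <;> rcases hb with rfl | rfl <;> ring
    have hsign : ∀ {p q r : ℝ}, 0 < p → Real.sign (q * p * r) = Real.sign (q * r) := by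
      intro p q r hp
      rw [mul_right_comm]
      rcases lt_trichotomy (q * r) 0 with h | h | h
      · rw [Real.sign_of_neg h, Real.sign_of_neg (mul_neg_of_neg_of_pos h hp)]
      · rw [h, zero_mul]
      · rw [Real.sign_of_pos h, Real.sign_of_pos (mul_pos h hp)]
    rw [e, hsign h1p]
    rcases lt_or_gt_of_ne h0 with h | h
    · rw [abs_of_neg h]
      rcases ha with rfl | rfl <;> rcases hb with rfl | rfl <;>
        simp [Real.sign_of_neg h, Real.sign_of_pos (neg_pos.2 h)]
    · rw [abs_of_pos h]
      rcases ha with rfl | rfl <;> rcases hb with rfl | rfl <;>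
        simp [Real.sign_of_pos h, Real.sign_of_neg (neg_lt_zero.2 h)]
  have s0 : sOrder x 0 = |x (σ 0)| := rfl
  have s1 : sOrder x 1 = |x (σ 1)| := rfl
  have s2 : sOrder x 2 = a * b * x (σ 2) := h2
  refine ⟨σ, ![a, b, a * b], isSigns_cons ha hb rfl, fun i => ?_, ?_, ?_⟩
  · fin_cases i
    · exact s0.trans hax
    · exact s1.trans hbx
    · exact s2
  · rw [s2, s1]
    refine le_trans (le_of_eq ?_) h12
    rcases ha with rfl | rfl <;> rcases hb with rfl | rfl <;> simp
  · rw [s0, s1]; exact h01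

/-- Canonical parameters are in `s`-order already. -/
theorem sOrder_eq_self {y : Fin 3 → ℝ} (h : IsOrdered y) : sOrder y = y := by
  obtain ⟨h1, h2⟩ := h
  have hy1 : 0 ≤ y 1 := (abs_nonneg _).trans h1
  set f : Fin 3 → ℝ := fun i => |y i| with hf
  have f0 : f 0 = y 0 := abs_of_nonneg (hy1.trans h2)
  have f1 : f 1 = y 1 := abs_of_nonneg hy1
  have hmono : Monotone (f ∘ (Fin.revPerm : Equiv.Perm (Fin 3))) := by
    refine Fin.monotone_iff_le_succ.2 fun i => ?_
    fin_cases i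
    · change f 2 ≤ f 1
      rw [f1]; exact h1
    · change f 1 ≤ f 0
      rw [f0, f1]; exact h2
  have hdec : decreasing f = f := by
    funext i
    have := congrFun (Tuple.unique_monotone (Tuple.monotone_sort f) hmono) (Fin.rev i)
    simpa [decreasing] using this
  have hs : Real.sign (y 0 * y 1 * y 2) * |y 2| = y 2 := by
    rcases eq_or_ne (y 2) 0 with h0 | h0
    · simp [h0]
    have hp : 0 < y 1 := (abs_pos.2 h0).trans_le h1
    have hpp : 0 < y 0 * y 1 := mul_pos (hp.trans_le h2) hp
    rcases lt_or_gt_of_ne h0 with h | h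
    · rw [Real.sign_of_neg (mul_neg_of_pos_of_neg hpp h), abs_of_neg h]; ring
    · rw [Real.sign_of_pos (mul_pos hpp h), abs_of_pos h]; ring
  funext i
  unfold sOrder
  rw [← hf, hdec]
  fin_cases i
  · exact f0
  · exact f1
  · exact hs

theorem IsOrdered.sum_signs_le {s ε : Fin 3 → ℝ} (h : IsOrdered s) (hε : IsSigns ε) :
    ∑ i, ε i * s i ≤ s 0 + s 1 + s 2 ∧ -∑ i, ε i * s i ≤ s 0 + s 1 - s 2 := by
  obtain ⟨h1, h2⟩ := h
  rw [abs_le] at h1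
  have hp := hε.2
  rw [Fin.prod_univ_three] at hp
  rw [Fin.sum_univ_three]
  rcases hε.1 0 with e0 | e0 <;> rcases hε.1 1 with e1 | e1 <;> rw [e0, e1] at hp ⊢
  · rw [show ε 2 = 1 by linarith]; constructor <;> linarith
  · rw [show ε 2 = -1 by linarith]; constructor <;> linarith
  · rw [show ε 2 = -1 by linarith]; constructor <;> linarith
  · rw [show ε 2 = 1 by linarith]; constructor <;> linarith

/-- A form of `s`-majorization by an ordered vector that is visibly invariant under permutations
and even sign changes of `x`. -/
theorem sMajorized_iff {x y : Fin 3 → ℝ} (hy : IsOrdered y) : SMajorized x y ↔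
    (∀ i, |x i| ≤ y 0) ∧ (∀ ε, IsSigns ε → ∑ i, ε i * x i ≤ y 0 + y 1 + y 2) ∧
      ∀ ε, IsSigns ε → -∑ i, ε i * x i ≤ y 0 + y 1 - y 2 := by
  obtain ⟨σ, η, hη, hs, ho⟩ := exists_sOrder_eq x
  rw [SMajorized, sOrder_eq_self hy]
  set s := sOrder x
  have hx : ∀ i, x i = η (σ.symm i) * s (σ.symm i) := fun i => by
    rw [hs, Equiv.apply_symm_apply, ← mul_assoc, hη.mul_self, one_mul]
  have hsum : ∀ ε : Fin 3 → ℝ, ∑ i, ε i * x i = ∑ i, (ε (σ i) * η i) * s i := fun ε => by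
    rw [← Equiv.sum_comp σ]
    refine Finset.sum_congr rfl fun i _ => ?_
    rw [hx, Equiv.symm_apply_apply, mul_assoc]
  have hsum' : ∀ ε : Fin 3 → ℝ, ∑ i, ε i * s i = ∑ i, (ε (σ.symm i) * η (σ.symm i)) * x i :=
    fun ε => by
      rw [← Equiv.sum_comp σ fun i => (ε (σ.symm i) * η (σ.symm i)) * x i]
      refine Finset.sum_congr rfl fun i _ => ?_
      rw [Equiv.symm_apply_apply, hs, mul_assoc]
  constructor
  · rintro ⟨h0, h1, h2⟩
    refine ⟨fun i => le_trans ?_ h0, fun ε hε => le_trans ?_ h1, fun ε hε => le_trans ?_ h2⟩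
    · rw [hx, abs_mul, hη.abs, one_mul]
      obtain ⟨o1, o2⟩ := ho
      have := (abs_nonneg _).trans o1
      generalize σ.symm i = j
      fin_cases j
      · exact (abs_of_nonneg (this.trans o2)).le
      · exact (abs_of_nonneg this).le.trans o2
      · exact o1.trans o2
    · rw [hsum]; exact (ho.sum_signs_le ((hε.comp σ).mul hη)).1
    · rw [hsum]; exact (ho.sum_signs_le ((hε.comp σ).mul hη)).2
  · rintro ⟨h0, h1, h2⟩
    refine ⟨?_, ?_, ?_⟩
    · rw [hs]
      refine le_trans (le_abs_self _) ?_
      rw [abs_mul, hη.abs, one_mul]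
      exact h0 _
    · have h := hsum' ![1, 1, 1]
      rw [Fin.sum_univ_three] at h
      simp only [Matrix.cons_val, one_mul] at h
      rw [h]
      exact h1 _ ((isSigns_one.comp σ.symm).mul
        (hη.comp σ.symm))
    · have h := hsum' ![-1, -1, 1]
      rw [Fin.sum_univ_three] at h
      simp only [Matrix.cons_val, one_mul, neg_mul] at h
      have h' := h2 _ ((isSigns_neg_neg_one.comp σ.symm).mul
        (hη.comp σ.symm))
      simp only [← h] at h'
      linarith

/-- In terms of the eigenvalues of `H_x`, which are the sums `-∑ ε_i x_i` over even sign changes. -/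
theorem sMajorized_iff_bellEig {x y : Fin 3 → ℝ} (hy : IsOrdered y) : SMajorized x y ↔
    (∀ i, |x i| ≤ y 0) ∧ (∀ k, -bellEig x k ≤ y 0 + y 1 + y 2) ∧
      ∀ k, bellEig x k ≤ y 0 + y 1 - y 2 := by
  rw [sMajorized_iff hy]
  constructor
  · rintro ⟨h0, h1, h2⟩
    refine ⟨h0, fun k => ?_, fun k => ?_⟩ <;> obtain ⟨ε, hε, hk⟩ := exists_isSigns_bellEig k
    · rw [hk, neg_neg]; exact h1 ε hε
    · rw [hk]; exact h2 ε hε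
  · rintro ⟨h0, h1, h2⟩
    refine ⟨h0, fun ε hε => ?_, fun ε hε => ?_⟩ <;> obtain ⟨k, hk⟩ := exists_bellEig_eq hε
    · rw [← neg_neg (∑ i, _), ← hk]; exact h1 k
    · rw [← hk]; exact h2 k

/-- The action of a permutation with even sign changes on parameter vectors. -/
def signedPerm (σ : Equiv.Perm (Fin 3)) (ε : Fin 3 → ℝ) : (Fin 3 → ℝ) →ₗ[ℝ] (Fin 3 → ℝ) where
  toFun x i := ε i * x (σ i)
  map_add' x y := by ext i; simp [mul_add]
  map_smul' c x := by ext i; simp [mul_left_comm]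

/-- The group generated by permutations and even sign changes: the Weyl group that relates
locally equivalent canonical parameters. -/
def signedPerms : Set ((Fin 3 → ℝ) →ₗ[ℝ] (Fin 3 → ℝ)) :=
  {w | ∃ σ ε, IsSigns ε ∧ w = signedPerm σ ε}

theorem finite_signedPerms : signedPerms.Finite := by
  have h : signedPerms ⊆ (fun p : Equiv.Perm (Fin 3) × (Fin 3 → ℝ) => signedPerm p.1 p.2) ''
      (Set.univ ×ˢ Set.pi Set.univ fun _ => {1, -1}) := by
    rintro w ⟨σ, ε, hε, rfl⟩
    exact ⟨(σ, ε), ⟨trivial, fun i _ => hε.1 i⟩, rfl⟩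
  exact ((Set.finite_univ.prod (Set.Finite.pi fun _ => Set.toFinite _)).image _).subset h

/-- Vectors `s`-majorized by an ordered vector `y` are images of `y` under convex combinations of
permutations with even sign changes. By Hahn–Banach it suffices to compare linear functionals,
and after such a permutation a functional has ordered coefficients `g`, when it is a nonnegative
combination of the three functionals that define `s`-majorization. -/
theorem SMajorized.exists_convexHull {x y : Fin 3 → ℝ} (h : SMajorized x y) (hy : IsOrdered y) :
    ∃ Φ ∈ convexHull ℝ signedPerms, Φ y = x := by
  by_contra hcon
  set ev : ((Fin 3 → ℝ) →ₗ[ℝ] (Fin 3 → ℝ)) →ₗ[ℝ] (Fin 3 → ℝ) := LinearMap.applyₗ y with hev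
  have hK : x ∉ convexHull ℝ (ev '' signedPerms) := by
    rw [← LinearMap.image_convexHull]
    rintro ⟨Φ, hΦ, hx⟩
    exact hcon ⟨Φ, hΦ, hx⟩
  obtain ⟨F, u, hF, hu⟩ := geometric_hahn_banach_closed_point (convex_convexHull ℝ _)
    ((finite_signedPerms.image ev).isCompact_convexHull (𝕜 := ℝ)).isClosed hK
  set f : Fin 3 → ℝ := fun i => F (Pi.single i 1) with hf
  have hFf : ∀ z, F z = ∑ i, f i * z i := fun z => by
    conv_lhs => rw [pi_eq_sum_univ' z]
    rw [map_sum]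
    refine Finset.sum_congr rfl fun i _ => ?_
    rw [map_smul, smul_eq_mul, mul_comm, hf]
  obtain ⟨σ, ε, hε, hs, ho⟩ := exists_sOrder_eq f
  set g := sOrder f
  have hfg : ∀ i, f (σ i) = ε i * g i := fun i => by
    rw [hs, ← mul_assoc, hε.mul_self, one_mul]
  have hFx : ∀ z, F z = ∑ i, g i * (ε i * z (σ i)) := fun z => by
    rw [hFf, ← Equiv.sum_comp σ]
    refine Finset.sum_congr rfl fun i _ => ?_
    rw [hfg]; ring
  have hw := hF (signedPerm σ.symm (fun i => ε (σ.symm i)) y)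
    (subset_convexHull ℝ _ ⟨_, ⟨_, _, hε.comp _, rfl⟩, rfl⟩)
  have hz : F (signedPerm σ.symm (fun i => ε (σ.symm i)) y) = ∑ i, g i * y i := by
    rw [hFx]
    refine Finset.sum_congr rfl fun i _ => ?_
    simp only [signedPerm, LinearMap.coe_mk, AddHom.coe_mk, Equiv.symm_apply_apply]
    rw [← mul_assoc (ε i), hε.mul_self, one_mul]
  obtain ⟨m0, m1, m2⟩ := (sMajorized_iff hy).1 h
  have hxz : F x ≤ ∑ i, g i * y i := by
    rw [hFx]
    have k0 : ε 0 * x (σ 0) ≤ y 0 := (le_abs_self _).trans (by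
      rw [abs_mul, hε.abs, one_mul]; exact m0 _)
    have key : ∀ δ : Fin 3 → ℝ, ∑ i, δ i * (ε i * x (σ i))
        = ∑ i, (δ (σ.symm i) * ε (σ.symm i)) * x i := fun δ => by
      rw [← Equiv.sum_comp σ fun i => (δ (σ.symm i) * ε (σ.symm i)) * x i]
      refine Finset.sum_congr rfl fun i _ => ?_
      rw [Equiv.symm_apply_apply, mul_assoc]
    have k1 := m1 _ ((isSigns_one.comp σ.symm).mul
        (hε.comp σ.symm))
    have k2 := m2 _ ((isSigns_neg_neg_one.comp σ.symm).mul
        (hε.comp σ.symm))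
    rw [← key ![1, 1, 1], Fin.sum_univ_three] at k1
    rw [← key ![-1, -1, 1], Fin.sum_univ_three] at k2
    simp only [Matrix.cons_val, one_mul, neg_mul] at k1 k2
    rw [Fin.sum_univ_three, Fin.sum_univ_three]
    obtain ⟨o1, o2⟩ := ho
    rw [abs_le] at o1
    nlinarith [mul_le_mul_of_nonneg_left k0 (show 0 ≤ g 0 - g 1 by linarith),
      mul_le_mul_of_nonneg_left k1 (show 0 ≤ (g 1 + g 2) / 2 by linarith),
      mul_le_mul_of_nonneg_left k2 (show 0 ≤ (g 1 - g 2) / 2 by linarith)]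
  linarith

end SOrder

end TwoQubit

/-! ### Integer shifts -/

namespace TwoQubit

open Matrix

section Shifts

/-- The eigenvalue list of `H_n`, for an integer vector `n`. -/
def intBellEig (n : Fin 3 → ℤ) : Fin 2 × Fin 2 → ℤ :=
  fun p => !![n 0 - n 1 + n 2, n 0 + n 1 - n 2; -n 0 - n 1 - n 2, -n 0 + n 1 + n 2] p.1 p.2

theorem bellEig_shifted (θ : Fin 3 → ℝ) (n : Fin 3 → ℤ) (k : Fin 2 × Fin 2) :
    bellEig (shifted θ n) k = bellEig θ k + Real.pi / 2 * intBellEig n k := by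
  obtain ⟨a, b⟩ := k
  fin_cases a <;> fin_cases b <;> simp [bellEig, shifted, intBellEig] <;> ring

theorem abs_le_abs_shift {θ c : ℝ} (hc : 0 ≤ c) (h : |θ| ≤ c / 2) (m : ℤ) :
    |θ| ≤ |θ + c * m| := by
  rcases eq_or_ne m 0 with rfl | hm
  · simp
  have h1 : (1 : ℝ) ≤ |(m : ℝ)| := by
    rw [← Int.cast_abs]; exact_mod_cast Int.one_le_abs hm
  have h2 := abs_sub_abs_le_abs_add (c * (m : ℝ)) θ
  rw [abs_mul, abs_of_nonneg hc, add_comm] at h2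
  nlinarith

theorem abs_shift_ge_of_ne_zero {θ c : ℝ} (hc : 0 ≤ c) {m : ℤ} (hm : m ≠ 0) :
    c - |θ| ≤ |θ + c * m| := by
  have h1 : (1 : ℝ) ≤ |(m : ℝ)| := by
    rw [← Int.cast_abs]; exact_mod_cast Int.one_le_abs hm
  have h2 := abs_sub_abs_le_abs_add (c * (m : ℝ)) θ
  rw [abs_mul, abs_of_nonneg hc, add_comm] at h2
  nlinarith

/-- A list of numbers of spread at most `c`, when shifted by integer multiples of `c` with total
zero, keeps its largest and smallest values inside the range of the shifted list. -/
theorem exists_le_shift {ι : Type*} [Fintype ι] {μ ν : ι → ℝ} {c : ℝ} {m : ι → ℤ}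
    (hsum : ∑ k, m k = 0) (hν : ∀ k, ν k = μ k + c * m k) (hspread : ∀ j k, μ j - μ k ≤ c)
    (hc : 0 ≤ c) (j : ι) : (∃ k, μ j ≤ ν k) ∧ ∃ k, ν k ≤ μ j := by
  by_cases h0 : ∀ k, m k = 0
  · exact ⟨⟨j, by rw [hν, h0]; simp⟩, ⟨j, by rw [hν, h0]; simp⟩⟩
  push Not at h0
  obtain ⟨k0, hk0⟩ := h0
  constructor
  · obtain ⟨k, -, hk⟩ := Finset.exists_pos_of_sum_zero_of_exists_nonzero m hsum
      ⟨k0, Finset.mem_univ _, hk0⟩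
    refine ⟨k, ?_⟩
    have : (1 : ℝ) ≤ m k := by exact_mod_cast hk
    rw [hν]
    nlinarith [hspread j k]
  · obtain ⟨k, -, hk⟩ := Finset.exists_pos_of_sum_zero_of_exists_nonzero (fun k => -m k)
      (by rw [Finset.sum_neg_distrib, hsum, neg_zero]) ⟨k0, Finset.mem_univ _, neg_ne_zero.2 hk0⟩
    refine ⟨k, ?_⟩
    have : (m k : ℝ) ≤ -1 := by
      have : m k ≤ -1 := by omega
      exact_mod_cast this
    rw [hν]
    nlinarith [hspread k j]

/-- The comparison behind the reduction to two shifts: `s`-majorization of `x` implies that of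
`x'`, when the coordinates and the eigenvalues of `x'` are within the ranges of those of `x`. -/
theorem SMajorized.of_ranges {x x' y : Fin 3 → ℝ} (hy : IsOrdered y) (h : SMajorized x y)
    (hc : ∀ i, ∃ j, |x' i| ≤ |x j|)
    (hb : ∀ k, (∃ l, bellEig x' k ≤ bellEig x l) ∧ ∃ l, bellEig x l ≤ bellEig x' k) :
    SMajorized x' y := by
  rw [sMajorized_iff_bellEig hy] at h ⊢
  obtain ⟨h0, h1, h2⟩ := h
  refine ⟨fun i => ?_, fun k => ?_, fun k => ?_⟩
  · obtain ⟨j, hj⟩ := hc i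
    exact hj.trans (h0 j)
  · obtain ⟨l, hl⟩ := (hb k).2
    linarith [h1 l]
  · obtain ⟨l, hl⟩ := (hb k).1
    linarith [h2 l]

/-- Among all shifts of the parameters of a gate by multiples of `π/2`, the vectors `θ` and
`θ - (π/2, 0, 0)` are the least, for the even and for the odd shifts respectively. -/
theorem exists_sMajorized_shifted_iff {θ y : Fin 3 → ℝ} (hθ : IsOrdered θ)
    (hθ4 : θ 0 ≤ Real.pi / 4) (hy : IsOrdered y) :
    (∃ n, SMajorized (shifted θ n) y) ↔
      SMajorized (shifted θ ![0, 0, 0]) y ∨ SMajorized (shifted θ ![-1, 0, 0]) y := by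
  refine ⟨?_, fun h => h.elim (fun h => ⟨_, h⟩) fun h => ⟨_, h⟩⟩
  rintro ⟨n, hn⟩
  have hpi := Real.pi_pos
  obtain ⟨o1, o2⟩ := hθ
  have o1' := abs_le.1 o1
  have habs : ∀ i, |θ i| ≤ Real.pi / 2 / 2 := fun i => by
    rw [abs_le]
    fin_cases i <;> simp <;> constructor <;> linarith
  rcases Int.even_or_odd (n 0 + n 1 + n 2) with hpar | hpar
  -- Shifts of equal parity change the eigenvalues by multiples of `π` with sum zero, and the
  -- eigenvalues of `θ` and of `θ - (π/2, 0, 0)` have spread at most `π`.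
  · left
    obtain ⟨s, hs⟩ := hpar
    refine hn.of_ranges hy (fun i => ⟨i, ?_⟩) fun k => ?_
    · have := abs_le_abs_shift (by positivity) (habs i) (n i)
      fin_cases i <;> simpa [shifted] using this
    · set m : Fin 2 × Fin 2 → ℤ := fun p => !![s - n 1, s - n 2; -s, s - n 0] p.1 p.2 with hm
      have hmk : ∀ k, intBellEig n k = 2 * m k := fun k => by
        obtain ⟨a, b⟩ := k
        fin_cases a <;> fin_cases b <;> simp [intBellEig, hm] <;> omega
      refine exists_le_shift (m := m) (c := Real.pi) ?_ (fun k => ?_) (fun j k => ?_) hpi.le k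
      · simp [Fintype.sum_prod_type, hm]; omega
      · rw [bellEig_shifted, bellEig_shifted, hmk]
        have h0 : intBellEig ![0, 0, 0] k = 0 := by
          obtain ⟨a, b⟩ := k
          fin_cases a <;> fin_cases b <;> simp [intBellEig]
        rw [h0]; push_cast; ring
      · rw [bellEig_shifted, bellEig_shifted]
        obtain ⟨a, b⟩ := j
        obtain ⟨c, d⟩ := k
        fin_cases a <;> fin_cases b <;> fin_cases c <;> fin_cases d <;>
          simp [bellEig, intBellEig] <;> linarith
  · right
    obtain ⟨s, hs⟩ := hpar
    refine hn.of_ranges hy (fun i => ?_) fun k => ?_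
    · obtain ⟨j, hj⟩ : ∃ j, n j ≠ 0 := by
        by_contra hcon
        push Not at hcon
        rw [hcon, hcon, hcon] at hs
        omega
      refine ⟨j, le_trans ?_ (abs_shift_ge_of_ne_zero (by positivity) hj)⟩
      have hj0 : |θ j| ≤ θ 0 := by
        rw [abs_le]
        fin_cases j <;> simp <;> first | linarith | (constructor <;> linarith)
      rw [abs_le]
      fin_cases i <;> simp [shifted] <;> constructor <;> linarith
    · set m : Fin 2 × Fin 2 → ℤ :=
        fun p => !![s + 1 - n 1, s + 1 - n 2; -s - 1, s - n 0] p.1 p.2 with hm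
      have hmk : ∀ k, intBellEig n k = intBellEig ![-1, 0, 0] k + 2 * m k := fun k => by
        obtain ⟨a, b⟩ := k
        fin_cases a <;> fin_cases b <;> simp [intBellEig, hm] <;> omega
      refine exists_le_shift (m := m) (c := Real.pi) ?_ (fun k => ?_) (fun j k => ?_) hpi.le k
      · simp [Fintype.sum_prod_type, hm]; omega
      · rw [bellEig_shifted, bellEig_shifted, hmk]
        push_cast; ring
      · rw [bellEig_shifted, bellEig_shifted]
        obtain ⟨a, b⟩ := j
        obtain ⟨c, d⟩ := k
        fin_cases a <;> fin_cases b <;> fin_cases c <;> fin_cases d <;>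
          simp [bellEig, intBellEig] <;> linarith

end Shifts

end TwoQubit

/-! ### Transport of eigenphases along the control system -/

namespace TwoQubit

open Matrix MeasureTheory Set Filter Topology
open scoped Matrix.Norms.L2Operator

section Propagator

theorem intervalIntegral_entry {F : ℝ → Op} {a b : ℝ} (hF : IntervalIntegrable F volume a b)
    (p q : Fin 2 × Fin 2) : (∫ r in a..b, F r) p q = ∫ r in a..b, F r p q :=
  ((LinearMap.toContinuousLinearMap (entryLinearMap ℝ ℂ p q)).intervalIntegral_comp_comm hF).symm

/-- The entrywise integrals in the definition of a propagator are the entries of a matrix-valued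
Bochner integral. -/
theorem isPropagator_iff {H V : ℝ → Op} {τ : ℝ} (hτ : 0 ≤ τ)
    (hH : IntervalIntegrable H volume 0 τ) :
    IsPropagator H V τ ↔ IsEvolution (fun t => (-Complex.I) • H t) V 0 τ ∧ V 0 = 1 := by
  have hint : ContinuousOn V (Icc 0 τ) → ∀ t ∈ Icc 0 τ,
      IntervalIntegrable (fun r => (-Complex.I) • (H r * V r)) volume 0 t := fun hc t ht =>
    ((hH.mul_continuousOn (by rwa [uIcc_of_le hτ])).smul (-Complex.I)).mono_set
      (uIcc_subset_uIcc left_mem_uIcc (by rwa [uIcc_of_le hτ]))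
  constructor
  · rintro ⟨hc, h⟩
    have h' : ∀ t ∈ Icc 0 τ, V t = 1 + ∫ r in (0 : ℝ)..t, (-Complex.I) • (H r * V r) :=
      fun t ht => by
        ext p q
        rw [h t ht, Matrix.add_apply, intervalIntegral_entry (hint hc t ht)]
    have h0 : V 0 = 1 := by rw [h' 0 (left_mem_Icc.2 hτ), intervalIntegral.integral_same, add_zero]
    refine ⟨⟨hc, fun t ht => ?_⟩, h0⟩
    rw [h0, h' t ht]
    simp only [smul_mul_assoc]
  · rintro ⟨⟨hc, h⟩, h0⟩
    refine ⟨hc, fun t ht p q => ?_⟩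
    simp only [smul_mul_assoc] at h
    rw [h t ht, Matrix.add_apply, h0, intervalIntegral_entry (hint hc t ht)]

/-- The spin flip as a continuous real-linear map. -/
noncomputable def spinFlipL : Op →L[ℝ] Op :=
  LinearMap.toContinuousLinearMap
    { toFun := spinFlip
      map_add' := spinFlip_add
      map_smul' := fun c X => by
        rw [← Complex.coe_smul, spinFlip_smul, Complex.coe_smul]; rfl }

theorem spinFlipL_apply (X : Op) : spinFlipL X = spinFlip X := rfl

theorem det_spinFlip (X : Op) : (spinFlip X).det = X.det := by
  have h : flipOp.det * flipOp.det = 1 := by rw [← det_mul, flipOp_mul_self, det_one]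
  rw [spinFlip, det_mul, det_mul, det_transpose, mul_right_comm, h, one_mul]

theorem spinFlip_mem_unitaryGroup {X : Op} (h : X ∈ unitaryGroup (Fin 2 × Fin 2) ℂ) :
    spinFlip X ∈ unitaryGroup (Fin 2 × Fin 2) ℂ := by
  have hf : flipOp ∈ unitaryGroup (Fin 2 × Fin 2) ℂ :=
    kronecker_mem_unitaryGroup (pauli_mem_unitaryGroup 1) (pauli_mem_unitaryGroup 1)
  refine mul_mem (mul_mem hf ?_) hf
  rw [mem_unitaryGroup_iff, star_eq_conjTranspose, show Xᵀᴴ = Xᴴᵀ from rfl, ← transpose_mul]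
  have := congrArg (fun Y : Op => Yᵀ) (mem_unitaryGroup_mul' h)
  simpa using this

variable {M : ℝ → Matrix (Fin 3) (Fin 3) ℝ} {a b : ℝ → Fin 3 → ℝ} {V : ℝ → Op} {τ : ℝ}

theorem skew_hamiltonian {C : Op} (hC : Cᴴ = C) (a b : Fin 3 → ℝ) :
    star ((-Complex.I) • (C + localHam a b)) = -((-Complex.I) • (C + localHam a b)) := by
  rw [star_eq_conjTranspose, conjTranspose_smul, conjTranspose_add, hC, localHam_conjTranspose,
    star_neg, RCLike.star_def, Complex.conj_I, neg_smul]

/-- Along the control system `spinFlip V * V` evolves by the coupling alone: the spin flip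
reverses the sign of the local Hamiltonians, so that the controls cancel. -/
theorem IsEvolution.spinFlip_mul_self (hτ : 0 ≤ τ)
    (hM : IntervalIntegrable (fun t => couplingHam (M t)) volume 0 τ)
    (hab : IntervalIntegrable (fun t => localHam (a t) (b t)) volume 0 τ)
    (hV : IsEvolution (fun t => (-Complex.I) • (couplingHam (M t) + localHam (a t) (b t))) V 0 τ)
    (hVu : ∀ t ∈ Icc 0 τ, V t ∈ unitaryGroup (Fin 2 × Fin 2) ℂ) :
    ∀ t ∈ Icc 0 τ, spinFlip (V t) * V t = spinFlip (V 0) * V 0 + ∫ r in (0 : ℝ)..t,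
      Complex.I • ((spinFlip (V r) * V r) * ((-2 : ℂ) • ((V r)ᴴ * couplingHam (M r) * V r))) := by
  have hG := (hM.add hab).smul (-Complex.I)
  have hi := hV.integrable hτ hG
  have hflip : ∀ t ∈ Icc 0 τ, spinFlip (V t) = spinFlip (V 0) + ∫ r in (0 : ℝ)..t,
      spinFlip (((-Complex.I) • (couplingHam (M r) + localHam (a r) (b r))) * V r) := by
    intro t ht
    have := spinFlipL.intervalIntegral_comp_comm
      (hi.mono_set (uIcc_subset_uIcc left_mem_uIcc (by rwa [uIcc_of_le hτ] : t ∈ uIcc 0 τ)))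
    simp only [spinFlipL_apply] at this
    rw [this, ← spinFlip_add, ← hV.2 t ht]
  have hfi : IntervalIntegrable (fun r =>
      spinFlip (((-Complex.I) • (couplingHam (M r) + localHam (a r) (b r))) * V r)) volume 0 τ :=
    ⟨spinFlipL.integrable_comp hi.1, spinFlipL.integrable_comp hi.2⟩
  intro t ht
  rw [mul_eq_add_integral hτ hfi hi hflip hV.2 t ht]
  congr 1
  refine intervalIntegral.integral_congr fun r hr => ?_
  rw [uIcc_of_le ht.1] at hr
  have hu := mem_unitaryGroup_mul (hVu r ⟨hr.1, hr.2.trans ht.2⟩)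
  simp only [spinFlip_mul, spinFlip_smul, spinFlip_add, spinFlip_couplingHam, spinFlip_localHam]
  have e : spinFlip (V r) * V r * ((-2 : ℂ) • ((V r)ᴴ * couplingHam (M r) * V r))
      = (-2 : ℂ) • (spinFlip (V r) * couplingHam (M r) * V r) := by
    rw [mul_smul_comm]
    congr 1
    calc _ = spinFlip (V r) * (V r * (V r)ᴴ) * couplingHam (M r) * V r := by noncomm_ring
      _ = _ := by rw [hu, mul_one]
  rw [e, smul_smul]
  simp only [mul_smul_comm, smul_mul_assoc, mul_add, add_mul, mul_neg, neg_mul, smul_add, smul_neg]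
  rw [← mul_assoc, ← mul_assoc]
  have : -(Complex.I * 2) = -Complex.I + -Complex.I := by ring
  rw [this, add_smul]
  abel

theorem exists_kyFanProfile_eq (k : ℕ) :
    ∃ c : Fin 3 → ℝ, ∀ θ, kyFanProfile θ k = ∑ i, c i * θ i := by
  match k with
  | 0 => exact ⟨0, fun θ => by simp [kyFanProfile]⟩
  | 1 => exact ⟨![2, 2, 2], fun θ => by simp [kyFanProfile, Fin.sum_univ_three]; ring⟩
  | 2 => exact ⟨![4, 0, 0], fun θ => by simp [kyFanProfile, Fin.sum_univ_three]⟩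
  | 3 => exact ⟨![2, 2, -2], fun θ => by simp [kyFanProfile, Fin.sum_univ_three]; ring⟩
  | k + 4 => exact ⟨0, fun θ => by simp [kyFanProfile]⟩

theorem intervalIntegrable_kyFanProfile {θ : ℝ → Fin 3 → ℝ} {u v : ℝ}
    (hθ : ∀ i, IntervalIntegrable (fun t => θ t i) volume u v) (k : ℕ) :
    IntervalIntegrable (fun t => kyFanProfile (θ t) k) volume u v := by
  obtain ⟨c, hc⟩ := exists_kyFanProfile_eq k
  simp only [hc]
  have : (fun t => ∑ i, c i * θ t i) = ∑ i, fun t => c i * θ t i := by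
    funext t; simp
  rw [this]
  exact IntervalIntegrable.sum _ fun i _ => (hθ i).const_mul _

theorem kyFanProfile_integralVec {θ : ℝ → Fin 3 → ℝ} {τ : ℝ}
    (hθ : ∀ i, IntervalIntegrable (fun t => θ t i) volume 0 τ) (k : ℕ) :
    kyFanProfile (integralVec θ τ) k = ∫ r in (0 : ℝ)..τ, kyFanProfile (θ r) k := by
  obtain ⟨c, hc⟩ := exists_kyFanProfile_eq k
  simp only [hc, integralVec]
  rw [intervalIntegral.integral_finsetSum fun i _ => (hθ i).const_mul _]
  simp only [intervalIntegral.integral_const_mul]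

/-- What every reachable operator satisfies: its determinant is one, and the eigenphases of
`spinFlip X * X` obey the bounds given by the integrated canonical parameters. -/
theorem reachable_subset {θ : ℝ → Fin 3 → ℝ} {T : ℝ}
    (hM : ∀ i j, ∀ T : ℝ, 0 ≤ T → IntervalIntegrable (fun t => M t i j) volume 0 T)
    (hθ : ∀ t, 0 ≤ t → IsHamParams (couplingHam (M t)) (θ t)) :
    reachable (fun t => couplingHam (M t)) T ⊆ {X | X.det = 1 ∧
      ∃ ψ ∈ (partialSumSet (kyFanProfile (integralVec θ T)) 0 : Set (Fin 2 × Fin 2 → ℝ)),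
        HasPhases (spinFlip X * X) ψ} := by
  rintro X ⟨τ, hτ, hτT, a, b, ha, hb, V, hV, rfl⟩
  have hMi := intervalIntegrable_couplingHam fun i j => hM i j τ hτ
  have hab := intervalIntegrable_localHam ha hb
  have hG := (hMi.add hab).smul (-Complex.I)
  obtain ⟨hVe, hV0⟩ := (isPropagator_iff hτ (hMi.add hab)).1 hV
  have hVu : ∀ t ∈ Icc 0 τ, V t ∈ unitaryGroup (Fin 2 × Fin 2) ℂ := fun t ht =>
    mem_unitaryGroup_iff'.2 (hVe.star_mul_self hτ hG
      (fun r _ => skew_hamiltonian (couplingHam_conjTranspose _) _ _)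
      (by rw [hV0, star_one, one_mul]) t ht)
  have hP := hVe.spinFlip_mul_self hτ hMi hab hVu
  have hVc := hVe.1
  have hPc : ContinuousOn (fun t => spinFlip (V t) * V t) (Icc 0 τ) :=
    (spinFlipL.continuous.comp_continuousOn hVc).mul hVc
  have hVHc : ContinuousOn (fun t => (V t)ᴴ) (Icc 0 τ) := hVc.star
  have key : ∀ t ∈ Icc 0 τ, ∃ ψ ∈ (partialSumSet (kyFanProfile (integralVec θ t)) 0 :
      Set (Fin 2 × Fin 2 → ℝ)), HasPhases (spinFlip (V t) * V t) ψ := by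
    intro t ht
    have hsub : Icc 0 t ⊆ Icc 0 τ := Icc_subset_Icc_right ht.2
    have hθi := fun i => intervalIntegrable_params ht.1
      (hMi.mono_set (by rw [uIcc_of_le ht.1, uIcc_of_le hτ]; exact hsub)) hθ i
    have hGi : IntervalIntegrable (fun r => (-2 : ℂ) • ((V r)ᴴ * couplingHam (M r) * V r))
        volume 0 t := by
      refine (((hMi.mono_set ?_).continuousOn_mul ?_).mul_continuousOn ?_).smul (-2 : ℂ)
      · rw [uIcc_of_le ht.1, uIcc_of_le hτ]; exact hsub
      · rw [uIcc_of_le ht.1]; exact hVHc.mono hsub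
      · rw [uIcc_of_le ht.1]; exact hVc.mono hsub
    obtain ⟨ψ, hψ, h⟩ := exists_phases_of_evolution (n := Fin 2 × Fin 2) (le_of_eq rfl) ht.1
      (P := fun t => spinFlip (V t) * V t) (L := fun k r => kyFanProfile (θ r) k) hGi
      (fun k => intervalIntegrable_kyFanProfile hθi k)
      (fun r hr => mul_mem (spinFlip_mem_unitaryGroup (hVu r (hsub hr))) (hVu r (hsub hr)))
      (hPc.mono hsub) (fun r hr => hP r (hsub hr)) (by simp [hV0, spinFlip_one])
      (fun r hr => by
        rw [trace_smul, trace_mul_comm, ← mul_assoc, mem_unitaryGroup_mul (hVu r (hsub hr)),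
          one_mul, couplingHam_trace]
        simp)
      (fun r hr => (hθ r hr.1).kyFanBound (hVu r (hsub hr)))
    refine ⟨ψ, ?_, h⟩
    rw [show kyFanProfile (integralVec θ t) = _ from funext fun k =>
      kyFanProfile_integralVec hθi k]
    exact hψ
  -- The determinant has square one, since the eigenphases of `spinFlip V * V` sum to zero, and it
  -- is continuous in time with value one at time zero.
  refine ⟨?_, ?_⟩
  · have hsq : ∀ t ∈ Icc 0 τ, (V t).det ^ 2 = 1 := fun t ht => by
      obtain ⟨ψ, hψ, h⟩ := key t ht
      have h0 : ∑ j, ψ j = 0 := abs_nonpos_iff.1 hψ.2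
      have h1 := HasEigenlist.det h
      rw [det_mul, det_spinFlip, ← sq, ← Complex.exp_sum, ← Finset.sum_mul, ← Complex.ofReal_sum,
        h0] at h1
      simpa using h1
    have hdc : ContinuousOn (fun t => (V t).det) (Icc 0 τ) :=
      Continuous.comp_continuousOn (g := fun X : Op => X.det) (by fun_prop) hVc
    exact isPreconnected_Icc.eq_of_sq_eq (f := fun t => (V t).det) (g := fun _ => 1) hdc
      continuousOn_const (fun t ht => by simpa using hsq t ht) (fun _ => one_ne_zero)
      (left_mem_Icc.2 hτ) (by simp [hV0]) (right_mem_Icc.2 hτ)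
  · obtain ⟨ψ, hψ, h⟩ := key τ (right_mem_Icc.2 hτ)
    refine ⟨ψ, ⟨fun S => (hψ.1 S).trans ?_, hψ.2⟩, h⟩
    have hT := hτ.trans hτT
    have hθT := fun i => intervalIntegrable_params hT
      (intervalIntegrable_couplingHam fun i j => hM i j T hT) hθ i
    have hθτ := fun i => intervalIntegrable_params hτ hMi hθ i
    rw [kyFanProfile_integralVec hθT, kyFanProfile_integralVec hθτ, add_zero, add_zero]
    refine intervalIntegral.integral_mono_interval le_rfl hτ hτT ?_
      (intervalIntegrable_kyFanProfile hθT _)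
    refine (ae_restrict_iff' measurableSet_Ioc).2 (Eventually.of_forall fun r hr => ?_)
    exact kyFanProfile_nonneg (hθ r hr.1.le).isOrdered _

end Propagator

end TwoQubit

/-! ### Necessity of s-majorization -/

namespace TwoQubit

open Matrix MeasureTheory Set Filter Topology
open scoped Matrix.Norms.L2Operator

section EigenlistUnique

variable {n : Type*} [Fintype n] [DecidableEq n]

theorem HasEigenlist.charpoly {A : Matrix n n ℂ} {a : n → ℂ} (h : HasEigenlist A a) :
    A.charpoly = ∏ i, (Polynomial.X - Polynomial.C (a i)) := by
  obtain ⟨V, hV, rfl⟩ := h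
  rw [charpoly_mul_comm, ← mul_assoc, mem_unitaryGroup_mul' hV, one_mul, charpoly_diagonal]

/-- The list of eigenvalues is unique up to order. -/
theorem HasEigenlist.exists_perm {A : Matrix n n ℂ} {a b : n → ℂ} (ha : HasEigenlist A a)
    (hb : HasEigenlist A b) : ∃ σ : Equiv.Perm n, ∀ j, b (σ j) = a j := by
  classical
  have h : (Finset.univ.val.map a) = Finset.univ.val.map b := by
    rw [← Polynomial.roots_multiset_prod_X_sub_C (Finset.univ.val.map a),
      ← Polynomial.roots_multiset_prod_X_sub_C (Finset.univ.val.map b), Multiset.map_map,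
      Multiset.map_map]
    exact congrArg Polynomial.roots (ha.charpoly.symm.trans hb.charpoly)
  have hc : ∀ c, Nonempty ({j // a j = c} ≃ {j // b j = c}) := fun c => by
    refine Fintype.card_eq.1 ?_
    have := congrArg (Multiset.count c) h
    rw [Multiset.count_map, Multiset.count_map] at this
    rw [Fintype.card_subtype, Fintype.card_subtype]
    simp only [eq_comm (a := c)] at this
    exact this
  exact ⟨Equiv.ofFiberEquiv fun c => (hc c).some, Equiv.ofFiberEquiv_map _⟩

end EigenlistUnique

section Necessity

theorem spinFlip_exp (X : Op) : spinFlip (NormedSpace.exp X) = NormedSpace.exp (spinFlip X) := by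
  have hinv : flipOp⁻¹ = flipOp := inv_eq_right_inv flipOp_mul_self
  have hu : IsUnit flipOp := (isUnit_iff_isUnit_det _).2
    (isUnit_det_of_right_inverse flipOp_mul_self)
  have := exp_conj flipOp Xᵀ hu
  rw [hinv, exp_transpose] at this
  exact this.symm

theorem spinFlip_canonicalGate (β : Fin 3 → ℝ) :
    spinFlip (canonicalGate β) = canonicalGate β := by
  rw [canonicalGate, spinFlip_exp, spinFlip_smul, spinFlip_canonicalHam]

theorem sum_bellEig (β : Fin 3 → ℝ) : ∑ k, bellEig β k = 0 := by
  simp [Fintype.sum_prod_type, bellEig]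

theorem det_canonicalGate (β : Fin 3 → ℝ) : (canonicalGate β).det = 1 := by
  rw [canonicalGate_eq, HasEigenlist.det (phaseMatrix_hasPhases bellBasis_mem _),
    ← Complex.exp_sum, ← Finset.sum_mul, ← Complex.ofReal_sum, Finset.sum_neg_distrib, sum_bellEig]
  simp

theorem isOrdered_integralVec {θ : ℝ → Fin 3 → ℝ} {T : ℝ} (hT : 0 ≤ T)
    (hi : ∀ i, IntervalIntegrable (fun t => θ t i) volume 0 T)
    (hθ : ∀ t, 0 ≤ t → IsOrdered (θ t)) : IsOrdered (integralVec θ T) := by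
  constructor
  · refine (intervalIntegral.abs_integral_le_integral_abs hT).trans ?_
    exact intervalIntegral.integral_mono_on hT (hi 2).abs (hi 1) fun t ht => (hθ t ht.1).1
  · exact intervalIntegral.integral_mono_on hT (hi 1) (hi 0) fun t ht => (hθ t ht.1).2

variable {M : ℝ → Matrix (Fin 3) (Fin 3) ℝ} {θ : ℝ → Fin 3 → ℝ} {U : Op} {θU : Fin 3 → ℝ} {T : ℝ}

/-- The properties of reachable operators pass to the limit in the definition of generation
within time `T`. -/
theorem CanGenerate.exists_phases (hT : 0 ≤ T)
    (hM : ∀ i j, ∀ T : ℝ, 0 ≤ T → IntervalIntegrable (fun t => M t i j) volume 0 T)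
    (hθ : ∀ t, 0 ≤ t → IsHamParams (couplingHam (M t)) (θ t))
    (h : CanGenerate (fun t => couplingHam (M t)) T U) :
    ∃ c : ℂ, (c • U).det = 1 ∧
      ∃ ψ ∈ (partialSumSet (kyFanProfile (integralVec θ T)) 0 : Set (Fin 2 × Fin 2 → ℝ)),
        HasPhases (spinFlip (c • U) * (c • U)) ψ := by
  obtain ⟨c, -, hcl⟩ := h
  have hθi : ∀ S : ℝ, 0 ≤ S → ∀ i, IntervalIntegrable (fun t => θ t i) volume 0 S :=
    fun S hS i => intervalIntegrable_params hS
      (intervalIntegrable_couplingHam fun i j => hM i j S hS) hθ i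
  have hmem : ∀ δ : ℝ, 0 < δ → c • U ∈ {X : Op | X.det = 1 ∧
      ∃ ψ ∈ (partialSumSet (kyFanProfile (integralVec θ (T + δ))) 0 : Set (Fin 2 × Fin 2 → ℝ)),
        HasPhases (spinFlip X * X) ψ} := fun δ hδ => by
    refine closure_minimal (reachable_subset hM hθ) ?_ (hcl δ hδ)
    refine IsClosed.inter (isClosed_eq (f := fun X : Op => X.det) (by fun_prop) continuous_const) ?_
    exact (isClosed_exists_hasPhases (isCompact_partialSumSet _ _)).preimage
      (f := fun X : Op => spinFlip X * X) (spinFlipL.continuous.mul continuous_id)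
  refine ⟨c, (hmem 1 one_pos).1, ?_⟩
  set δ : ℕ → ℝ := fun m => 1 / ((m : ℝ) + 1) with hδ
  have hδ0 : ∀ m, 0 < δ m := fun m => by positivity
  have hδm : Antitone δ := fun m m' h => one_div_le_one_div_of_le (by positivity) (by
    gcongr)
  have hδ1 : ∀ m, δ m ≤ 1 := fun m => by simpa [hδ] using hδm (Nat.zero_le m)
  have hprof : ∀ m k, kyFanProfile (integralVec θ (T + δ m)) k
      = ∫ r in (0 : ℝ)..T + δ m, kyFanProfile (θ r) k := fun m k =>
    kyFanProfile_integralVec (hθi _ (by linarith [hδ0 m])) k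
  obtain ⟨ψ, hψ, hp⟩ := exists_hasPhases_iInter (P := spinFlip (c • U) * (c • U))
    (fun m => partialSumSet (kyFanProfile (integralVec θ (T + δ m))) 0) (fun m ψ hψ => by
      refine ⟨fun S => (hψ.1 S).trans ?_, hψ.2⟩
      rw [hprof, hprof]
      have h1 := hδm (Nat.le_succ m)
      gcongr
      refine intervalIntegral.integral_mono_interval le_rfl (by linarith [hδ0 (m + 1)])
        (by linarith) ?_ (intervalIntegrable_kyFanProfile (hθi _ (by linarith [hδ0 m])) _)
      refine (ae_restrict_iff' measurableSet_Ioc).2 (Eventually.of_forall fun r hr => ?_)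
      exact kyFanProfile_nonneg (hθ r hr.1.le).isOrdered _)
    (fun m => isCompact_partialSumSet _ _) (fun m => (hmem (δ m) (hδ0 m)).2)
  refine ⟨ψ, ⟨fun S => ?_, (hψ 0).2⟩, hp⟩
  have hT1 : (0 : ℝ) ≤ T + 1 := by linarith
  have hcont : ContinuousOn (fun s => ∫ r in (0 : ℝ)..s, kyFanProfile (θ r) S.card)
      (uIcc 0 (T + 1)) := intervalIntegral.continuousOn_primitive_interval'
    (intervalIntegrable_kyFanProfile (hθi _ hT1) _) left_mem_uIcc
  rw [uIcc_of_le hT1] at hcont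
  have hlim : Tendsto (fun m => T + δ m) atTop (𝓝[Icc 0 (T + 1)] T) := by
    refine tendsto_nhdsWithin_iff.2 ⟨?_, Eventually.of_forall fun m =>
      ⟨by linarith [hδ0 m], by linarith [hδ1 m]⟩⟩
    simpa [hδ] using tendsto_const_nhds.add (tendsto_one_div_add_atTop_nhds_zero_nat (𝕜 := ℝ))
  have h2 := (hcont T ⟨hT, by linarith⟩).tendsto.comp hlim
  rw [add_zero, kyFanProfile_integralVec (hθi T hT)]
  refine ge_of_tendsto' h2 fun m => ?_
  have := (hψ m).1 S
  rwa [add_zero, hprof] at this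

/-- For a gate with canonical parameters `β`, the operator `spinFlip U * U` has eigenphases
`-2 bellEig β`, up to a sign when the determinant is normalized. -/
theorem IsGateParams.exists_phases {c : ℂ} {β : Fin 3 → ℝ} (h : IsGateParams U β)
    (hdet : (c • U).det = 1) : ∃ e : ℤ, HasPhases (spinFlip (c • U) * (c • U))
      (fun k => -2 * bellEig β k + Real.pi * e) := by
  obtain ⟨-, -, -, A₁, hA₁, B₁, hB₁, A₂, hA₂, B₂, hB₂, rfl⟩ := h
  set E := canonicalGate β with hE
  set d₁ := A₁.det * B₁.det with hd₁
  set d₂ := A₂.det * B₂.det with hd₂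
  have hK := kronecker_mem_unitaryGroup hA₂ hB₂
  set D := c ^ 2 * (d₁ * d₂) with hD
  have hD2 : D ^ 2 = 1 := by
    rw [← hdet, det_smul, det_mul, det_mul, det_kronecker, det_kronecker, hE, det_canonicalGate]
    simp only [Fintype.card_prod, Fintype.card_fin, hD, hd₁, hd₂]
    ring
  obtain ⟨e, he⟩ : ∃ e : ℤ, Complex.exp ((Real.pi * e : ℝ) * Complex.I) = D := by
    rcases mul_self_eq_one_iff.1 ((sq D).symm.trans hD2) with h | h
    · exact ⟨0, by simp [h]⟩
    · exact ⟨1, by simp [h, Complex.exp_pi_mul_I]⟩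
  have hflip : spinFlip (A₂ ⊗ₖ B₂) = d₂ • (A₂ ⊗ₖ B₂)ᴴ := by
    calc spinFlip (A₂ ⊗ₖ B₂) = spinFlip (A₂ ⊗ₖ B₂) * ((A₂ ⊗ₖ B₂) * (A₂ ⊗ₖ B₂)ᴴ) := by
          rw [mem_unitaryGroup_mul hK, mul_one]
      _ = d₂ • (A₂ ⊗ₖ B₂)ᴴ := by
          rw [← mul_assoc, spinFlip_kronecker_mul, smul_mul_assoc, one_mul]
  have hprod : spinFlip (c • ((A₁ ⊗ₖ B₁) * E * (A₂ ⊗ₖ B₂))) * (c • ((A₁ ⊗ₖ B₁) * E * (A₂ ⊗ₖ B₂)))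
      = D • ((A₂ ⊗ₖ B₂)ᴴ * (E * E) * (A₂ ⊗ₖ B₂)) := by
    rw [spinFlip_smul, spinFlip_mul, spinFlip_mul, hE, spinFlip_canonicalGate, ← hE, hflip,
      smul_mul_smul_comm]
    calc _ = (c * c) • (d₂ • ((A₂ ⊗ₖ B₂)ᴴ * E * (spinFlip (A₁ ⊗ₖ B₁) * (A₁ ⊗ₖ B₁)) * E *
            (A₂ ⊗ₖ B₂))) := by
          simp only [smul_mul_assoc, mul_assoc]
      _ = _ := by
          rw [spinFlip_kronecker_mul]
          simp only [smul_mul_assoc, mul_smul_comm, mul_one, smul_smul, mul_assoc, hD]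
          congr 1
          ring
  refine ⟨e, ?_⟩
  rw [hprod]
  have hEE : HasEigenlist (E * E) (fun k => Complex.exp ((-2 * bellEig β k : ℝ) * Complex.I)) := by
    rw [hE, canonicalGate_eq, phaseMatrix_mul bellBasis_mem]
    convert (phaseMatrix_hasPhases bellBasis_mem _) using 1
    rw [HasPhases]
    congr! 3 with k
    simp only [Pi.add_apply]
    push_cast
    ring
  have h1 := (hEE.conj (Unitary.star_mem hK)).smul D
  rw [star_eq_conjTranspose, conjTranspose_conjTranspose] at h1
  rw [HasPhases]
  convert h1 using 2 with k
  rw [← he, ← Complex.exp_add]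
  congr 1
  push_cast
  ring

/-- Necessity: if a gate can be generated within time `T`, some shift of the parameters of the gate
is `s`-majorized by the integrated parameters of the Hamiltonian. -/
theorem CanGenerate.exists_sMajorized (hT : 0 ≤ T)
    (hM : ∀ i j, ∀ T : ℝ, 0 ≤ T → IntervalIntegrable (fun t => M t i j) volume 0 T)
    (hθ : ∀ t, 0 ≤ t → IsHamParams (couplingHam (M t)) (θ t)) (hU : IsGateParams U θU)
    (h : CanGenerate (fun t => couplingHam (M t)) T U) :
    ∃ n : Fin 3 → ℤ, SMajorized (shifted θU n) (integralVec θ T) := by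
  obtain ⟨c, hdet, ψ, hψ, hp⟩ := h.exists_phases hT hM hθ
  obtain ⟨e, he⟩ := hU.exists_phases hdet
  obtain ⟨σ, hσ⟩ := HasEigenlist.exists_perm he hp
  have hint : ∀ k, ∃ m : ℤ, ψ (σ k) = -2 * bellEig θU k + Real.pi * e + 2 * Real.pi * m := by
    intro k
    obtain ⟨m, hm⟩ := Complex.exp_eq_exp_iff_exists_int.1 (hσ k)
    refine ⟨m, ?_⟩
    have h1 : (ψ (σ k) : ℂ) * Complex.I
        = ((-2 * bellEig θU k + Real.pi * e + 2 * Real.pi * m : ℝ) : ℂ) * Complex.I := by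
      rw [hm]; push_cast; ring
    exact_mod_cast mul_right_cancel₀ Complex.I_ne_zero h1
  choose m hm using hint
  have hsum : ∑ k, ψ (σ k) = 0 := by
    rw [Equiv.sum_comp σ ψ]
    exact abs_nonpos_iff.1 hψ.2
  have hpi := Real.pi_pos
  have hme : m (0, 0) + m (0, 1) + m (1, 0) + m (1, 1) = -2 * e := by
    have h1 : Real.pi * (4 * e + 2 * (m (0, 0) + m (0, 1) + m (1, 0) + m (1, 1))) = 0 := by
      have h2 := sum_bellEig θU
      rw [← hsum]
      simp only [hm]
      simp only [Fintype.sum_prod_type, Fin.sum_univ_two] at h2 ⊢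
      linear_combination 2 * h2
    rcases mul_eq_zero.1 h1 with h2 | h2
    · exact absurd h2 hpi.ne'
    · have h3 : 4 * e + 2 * (m (0, 0) + m (0, 1) + m (1, 0) + m (1, 1)) = 0 := by exact_mod_cast h2
      omega
  -- The solution of `intBellEig n = -(e + 2 m)`, an integer vector because the `m k` sum to `-2 e`.
  set n : Fin 3 → ℤ := ![-(e + m (0, 0) + m (0, 1)), -(e + m (0, 1) + m (1, 1)),
    -(e + m (0, 0) + m (1, 1))] with hn
  have hne : ∀ k, intBellEig n k = -(e + 2 * m k) := fun k => by
    obtain ⟨a, b⟩ := k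
    fin_cases a <;> fin_cases b <;> simp [intBellEig, hn] <;> omega
  have hx : ∀ k, bellEig (shifted θU n) k = -ψ (σ k) / 2 := fun k => by
    rw [bellEig_shifted, hne, hm]
    push_cast
    ring
  have hθi := fun i => intervalIntegrable_params hT
    (intervalIntegrable_couplingHam fun i j => hM i j T hT) hθ i
  have hord := isOrdered_integralVec hT hθi fun t ht => (hθ t ht).isOrdered
  set Λ := integralVec θ T
  -- The bounds for one, three and two eigenphases; since all four sum to zero, the second is a
  -- lower bound for the remaining one.
  have h1 : ∀ k, ψ (σ k) ≤ 2 * (Λ 0 + Λ 1 + Λ 2) := fun k => by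
    have := hψ.1 {σ k}
    simpa [kyFanProfile] using this
  have h3 : ∀ k, -ψ (σ k) ≤ 2 * (Λ 0 + Λ 1 - Λ 2) := fun k => by
    have := hψ.1 (Finset.univ.erase (σ k))
    rw [Finset.card_erase_of_mem (Finset.mem_univ _), Finset.card_univ,
      show Fintype.card (Fin 2 × Fin 2) - 1 = 3 from rfl, kyFanProfile] at this
    have h4 := Finset.add_sum_erase Finset.univ ψ (Finset.mem_univ (σ k))
    rw [Equiv.sum_comp σ ψ] at hsum
    linarith
  have h2 : ∀ k l, k ≠ l → ψ (σ k) + ψ (σ l) ≤ 4 * Λ 0 := fun k l hkl => by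
    have := hψ.1 {σ k, σ l}
    rw [Finset.sum_pair (σ.injective.ne hkl), Finset.card_pair (σ.injective.ne hkl),
      kyFanProfile] at this
    linarith
  refine ⟨n, (sMajorized_iff_bellEig hord).2 ⟨fun i => ?_, fun k => ?_, fun k => ?_⟩⟩
  · have x0 := hx (0, 0)
    have x1 := hx (0, 1)
    have x2 := hx (1, 0)
    have x3 := hx (1, 1)
    have p01 := h2 (0, 0) (0, 1) (by decide)
    have p02 := h2 (0, 0) (1, 0) (by decide)
    have p03 := h2 (0, 0) (1, 1) (by decide)
    have p12 := h2 (0, 1) (1, 0) (by decide)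
    have p13 := h2 (0, 1) (1, 1) (by decide)
    have p23 := h2 (1, 0) (1, 1) (by decide)
    simp only [bellEig, of_apply, cons_val_zero, cons_val_one] at x0 x1 x2 x3
    rw [abs_le]
    fin_cases i <;> constructor <;> simp only [Fin.zero_eta, Fin.mk_one, Fin.reduceFinMk] <;>
      linarith
  · rw [hx]; linarith [h1 k]
  · rw [hx]; linarith [h3 k]

end Necessity

end TwoQubit

/-! ### Local unitaries -/

namespace TwoQubit

open Matrix
open scoped Matrix.Norms.L2Operator

section Local

/-- Local unitary operators, up to a global phase. -/
def IsLocal (K : Op) : Prop :=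
  ∃ c : ℂ, ‖c‖ = 1 ∧ ∃ A ∈ unitaryGroup (Fin 2) ℂ, ∃ B ∈ unitaryGroup (Fin 2) ℂ, K = c • (A ⊗ₖ B)

theorem isLocal_kronecker {A B : Matrix (Fin 2) (Fin 2) ℂ} (hA : A ∈ unitaryGroup (Fin 2) ℂ)
    (hB : B ∈ unitaryGroup (Fin 2) ℂ) : IsLocal (A ⊗ₖ B) :=
  ⟨1, norm_one, A, hA, B, hB, (one_smul _ _).symm⟩

theorem isLocal_one : IsLocal 1 := by
  rw [← one_kronecker_one]
  exact isLocal_kronecker (one_mem _) (one_mem _)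

theorem IsLocal.mul {K L : Op} (hK : IsLocal K) (hL : IsLocal L) : IsLocal (K * L) := by
  obtain ⟨c, hc, A, hA, B, hB, rfl⟩ := hK
  obtain ⟨d, hd, A', hA', B', hB', rfl⟩ := hL
  refine ⟨c * d, by rw [norm_mul, hc, hd, one_mul], A * A', mul_mem hA hA', B * B',
    mul_mem hB hB', ?_⟩
  rw [smul_mul_smul_comm, ← mul_kronecker_mul]

theorem IsLocal.smul {K : Op} (hK : IsLocal K) {c : ℂ} (hc : ‖c‖ = 1) : IsLocal (c • K) := by
  obtain ⟨d, hd, A, hA, B, hB, rfl⟩ := hK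
  exact ⟨c * d, by rw [norm_mul, hc, hd, one_mul], A, hA, B, hB, smul_smul _ _ _⟩

theorem IsLocal.conjTranspose {K : Op} (hK : IsLocal K) : IsLocal Kᴴ := by
  obtain ⟨c, hc, A, hA, B, hB, rfl⟩ := hK
  refine ⟨star c, by rw [norm_star, hc], Aᴴ, Unitary.star_mem hA, Bᴴ, Unitary.star_mem hB, ?_⟩
  rw [conjTranspose_smul, conjTranspose_kronecker]

theorem exists_eq_one_add_pauli {X : Matrix (Fin 2) (Fin 2) ℂ} (hX : Xᴴ = X) :
    ∃ (z : ℝ) (a : Fin 3 → ℝ), X = (z : ℂ) • 1 + ∑ i, (a i : ℂ) • pauli i := by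
  have h00 := congrFun (congrFun hX 0) 0
  have h11 := congrFun (congrFun hX 1) 1
  have h01 := congrFun (congrFun hX 0) 1
  rw [conjTranspose_apply, RCLike.star_def] at h00 h11 h01
  have e0 := Complex.conj_eq_iff_re.1 h00
  have e1 := Complex.conj_eq_iff_re.1 h11
  have e2 : X 1 0 = (X 1 0).re + (X 1 0).im * Complex.I := (Complex.re_add_im _).symm
  have e3 : X 0 1 = (X 1 0).re - (X 1 0).im * Complex.I := by
    rw [← h01]
    apply Complex.ext <;> simp
  set z : ℝ := ((X 0 0).re + (X 1 1).re) / 2 with hz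
  set a : Fin 3 → ℝ := ![(X 1 0).re, (X 1 0).im, ((X 0 0).re - (X 1 1).re) / 2] with ha
  set Y : Matrix (Fin 2) (Fin 2) ℂ := (z : ℂ) • 1 + ∑ i, (a i : ℂ) • pauli i with hY
  have y00 : Y 0 0 = z + a 2 := by
    simp [hY, Fin.sum_univ_three, pauli, Matrix.add_apply]
  have y01 : Y 0 1 = a 0 - a 1 * Complex.I := by
    simp [hY, Fin.sum_univ_three, pauli, Matrix.add_apply, sub_eq_add_neg]
  have y10 : Y 1 0 = a 0 + a 1 * Complex.I := by
    simp [hY, Fin.sum_univ_three, pauli, Matrix.add_apply]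
  have y11 : Y 1 1 = z - a 2 := by
    simp [hY, Fin.sum_univ_three, pauli, Matrix.add_apply, sub_eq_add_neg]
  refine ⟨z, a, ?_⟩
  ext i j
  fin_cases i <;> fin_cases j
  · change X 0 0 = Y 0 0
    rw [y00, ← e0, hz, ha]; simp; ring
  · exact e3.trans y01.symm
  · exact e2.trans y10.symm
  · change X 1 1 = Y 1 1
    rw [y11, ← e1, hz, ha]; simp; ring

/-- After a change of phase a unitary `2 × 2` matrix lies at distance less than two from the
identity: with determinant one, `A + Aᴴ` is the trace of `A`, whose sign can be chosen. -/
theorem exists_phase_norm_sub_one_lt {A : Matrix (Fin 2) (Fin 2) ℂ}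
    (hA : A ∈ unitaryGroup (Fin 2) ℂ) :
    ∃ c : ℂ, ‖c‖ = 1 ∧ ∃ A' ∈ unitaryGroup (Fin 2) ℂ, ‖A' - 1‖ < 2 ∧ A = c • A' := by
  have hdet : ‖A.det‖ = 1 := by
    have h := congrArg (fun X => ‖Matrix.det X‖) (mem_unitaryGroup_mul hA)
    simp only [det_mul, det_conjTranspose, norm_mul, norm_star, det_one, norm_one] at h
    nlinarith [norm_nonneg A.det]
  obtain ⟨d, hd⟩ : ∃ d : ℂ, d ^ 2 = A.det := IsAlgClosed.exists_pow_nat_eq _ two_pos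
  have hdn : ‖d‖ = 1 := by
    rw [← hd, norm_pow] at hdet
    nlinarith [norm_nonneg d]
  have hd0 : d ≠ 0 := norm_pos_iff.1 (by rw [hdn]; exact one_pos)
  have key : ∀ c : ℂ, c ^ 2 = A.det → ‖c‖ = 1 → 0 ≤ ((c⁻¹ • A).trace).re →
      ∃ c : ℂ, ‖c‖ = 1 ∧ ∃ A' ∈ unitaryGroup (Fin 2) ℂ, ‖A' - 1‖ < 2 ∧ A = c • A' := by
    intro c hc hcn htr
    have hc0 : c ≠ 0 := norm_pos_iff.1 (by rw [hcn]; exact one_pos)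
    set A' := c⁻¹ • A with hA'
    have hA'u : A' ∈ unitaryGroup (Fin 2) ℂ := by
      rw [mem_unitaryGroup_iff, star_eq_conjTranspose, hA', conjTranspose_smul,
        smul_mul_smul_comm, mem_unitaryGroup_mul hA, RCLike.star_def, Complex.mul_conj,
        Complex.normSq_eq_norm_sq, norm_inv, hcn]
      simp
    have hdet' : A'.det = 1 := by
      rw [hA', det_smul, ← hc, Fintype.card_fin, inv_pow, inv_mul_cancel₀ (pow_ne_zero 2 hc0)]
    have hadj : A'ᴴ = adjugate A' := by
      calc A'ᴴ = A'ᴴ * (A' * adjugate A') := by rw [mul_adjugate, hdet', one_smul, mul_one]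
        _ = adjugate A' := by rw [← mul_assoc, mem_unitaryGroup_mul' hA'u, one_mul]
    have hsum : A' + A'ᴴ = A'.trace • 1 := by
      rw [hadj, adjugate_fin_two]
      ext i j
      fin_cases i <;> fin_cases j <;> simp [trace_fin_two, add_comm]
    have hreal : ((A'.trace.re : ℝ) : ℂ) = A'.trace := by
      refine Complex.conj_eq_iff_re.1 ?_
      have h1 := congrArg Matrix.conjTranspose hsum
      rw [conjTranspose_add, conjTranspose_conjTranspose, add_comm, hsum, conjTranspose_smul,
        conjTranspose_one] at h1
      have h2 := congrFun (congrFun h1 0) 0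
      simpa using h2.symm
    have htr2 : |A'.trace.re| ≤ 2 := by
      have e0 := (norm_entry_le A' 0 0).trans (norm_le_one_of_mem_unitaryGroup hA'u)
      have e1 := (norm_entry_le A' 1 1).trans (norm_le_one_of_mem_unitaryGroup hA'u)
      refine (Complex.abs_re_le_norm _).trans ?_
      rw [trace_fin_two]
      exact (norm_add_le _ _).trans (by linarith)
    have hsq : ‖A' - 1‖ * ‖A' - 1‖ ≤ 2 := by
      rw [← CStarRing.norm_star_mul_self, star_eq_conjTranspose, conjTranspose_sub,
        conjTranspose_one]
      have e : (A'ᴴ - 1) * (A' - 1) = ((2 - A'.trace.re : ℝ) : ℂ) • 1 := by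
        calc (A'ᴴ - 1) * (A' - 1) = A'ᴴ * A' + 1 - (A' + A'ᴴ) := by noncomm_ring
          _ = _ := by
            rw [mem_unitaryGroup_mul' hA'u, hsum, ← hreal]
            push_cast
            rw [sub_smul, two_smul]
            simp
      rw [e, norm_smul, Complex.norm_real, Real.norm_eq_abs]
      have := (abs_le.1 htr2)
      rw [abs_of_nonneg (by linarith)]
      have h1 : ‖(1 : Matrix (Fin 2) (Fin 2) ℂ)‖ ≤ 1 :=
        norm_le_one_of_mem_unitaryGroup (one_mem _)
      nlinarith [norm_nonneg (1 : Matrix (Fin 2) (Fin 2) ℂ)]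
    refine ⟨c, hcn, A', hA'u, by nlinarith [norm_nonneg (A' - 1)], ?_⟩
    rw [hA', smul_smul, mul_inv_cancel₀ hc0, one_smul]
  rcases le_total 0 ((d⁻¹ • A).trace).re with h | h
  · exact key d hd hdn h
  · refine key (-d) (by rw [neg_sq, hd]) (by rw [norm_neg, hdn]) ?_
    rw [inv_neg, neg_smul, trace_neg, Complex.neg_re]
    linarith

theorem localHam_eq (a b : Fin 3 → ℝ) : localHam a b =
    (∑ i, (a i : ℂ) • pauli i) ⊗ₖ (1 : Matrix (Fin 2) (Fin 2) ℂ) +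
      (1 : Matrix (Fin 2) (Fin 2) ℂ) ⊗ₖ ∑ i, (b i : ℂ) • pauli i := by
  ext ⟨i, j⟩ ⟨k, l⟩
  simp only [localHam, kroneckerMap_apply, Finset.sum_add_distrib, Matrix.add_apply,
    Matrix.sum_apply, Finset.sum_mul, Finset.mul_sum, Matrix.smul_apply, smul_eq_mul]
  congr 1 <;> exact Finset.sum_congr rfl fun x _ => by ring

theorem localHam_smul (r : ℝ) (a b : Fin 3 → ℝ) :
    localHam (fun i => r * a i) (fun i => r * b i) = (r : ℂ) • localHam a b := by
  simp only [localHam, Finset.smul_sum, smul_add, smul_smul, Complex.ofReal_mul]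

/-- Up to a phase, local unitaries are generated by local Hamiltonians. -/
theorem IsLocal.exists_exp {K : Op} (hK : IsLocal K) : ∃ c : ℂ, ‖c‖ = 1 ∧ ∃ a b : Fin 3 → ℝ,
    K = c • NormedSpace.exp ((-Complex.I) • localHam a b) := by
  obtain ⟨c, hc, A, hA, B, hB, rfl⟩ := hK
  obtain ⟨c₁, hc₁, A', hA', hA1, rfl⟩ := exists_phase_norm_sub_one_lt hA
  obtain ⟨c₂, hc₂, B', hB', hB1, rfl⟩ := exists_phase_norm_sub_one_lt hB
  obtain ⟨x, ⟨V, hV, hAV⟩, -⟩ := exists_hasPhases hA' hA1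
  obtain ⟨y, ⟨W, hW, hBW⟩, -⟩ := exists_hasPhases hB' hB1
  obtain ⟨z, a, hXa⟩ := exists_eq_one_add_pauli (conjTranspose_conj_real V x)
  obtain ⟨t, b, hYb⟩ := exists_eq_one_add_pauli (conjTranspose_conj_real W y)
  have h1 : A' ⊗ₖ B' = NormedSpace.exp (Complex.I • ((V ⊗ₖ W) *
      diagonal (fun p : Fin 2 × Fin 2 => ((x p.1 + y p.2 : ℝ) : ℂ)) * (V ⊗ₖ W)ᴴ)) := by
    rw [exp_I_smul_conj (kronecker_mem_unitaryGroup hV hW), hAV, hBW, mul_kronecker_mul,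
      mul_kronecker_mul, conjTranspose_kronecker, diagonal_kronecker_diagonal]
    congr 3
    ext p
    rw [← Complex.exp_add]
    push_cast
    ring_nf
  have h2 : (V ⊗ₖ W) * diagonal (fun p : Fin 2 × Fin 2 => ((x p.1 + y p.2 : ℝ) : ℂ)) * (V ⊗ₖ W)ᴴ
      = diagonal (fun _ => ((z + t : ℝ) : ℂ)) + localHam a b := by
    have e : diagonal (fun p : Fin 2 × Fin 2 => ((x p.1 + y p.2 : ℝ) : ℂ)) =
        diagonal (fun j => (x j : ℂ)) ⊗ₖ (1 : Matrix (Fin 2) (Fin 2) ℂ) +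
          (1 : Matrix (Fin 2) (Fin 2) ℂ) ⊗ₖ diagonal (fun j => (y j : ℂ)) := by
      rw [← diagonal_one, diagonal_kronecker_diagonal, diagonal_kronecker_diagonal, diagonal_add]
      simp
    rw [e, mul_add, add_mul, conjTranspose_kronecker, ← mul_kronecker_mul, ← mul_kronecker_mul,
      ← mul_kronecker_mul, ← mul_kronecker_mul, mul_one, mul_one, mem_unitaryGroup_mul hV,
      mem_unitaryGroup_mul hW, hXa, hYb, add_kronecker, kronecker_add, smul_kronecker,
      kronecker_smul, one_kronecker_one, localHam_eq, ← smul_one_eq_diagonal]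
    push_cast
    rw [add_smul]
    abel
  have h3 : NormedSpace.exp (Complex.I • (diagonal (fun _ => ((z + t : ℝ) : ℂ)) + localHam a b))
      = Complex.exp ((z + t : ℝ) * Complex.I) • NormedSpace.exp (Complex.I • localHam a b) := by
    have hcomm : Commute (diagonal fun _ : Fin 2 × Fin 2 => Complex.I * ((z + t : ℝ) : ℂ))
        (Complex.I • localHam a b) := by
      rw [← smul_one_eq_diagonal]
      exact (Commute.one_left _).smul_left _
    rw [smul_add, ← diagonal_smul]
    change NormedSpace.exp ((diagonal fun _ => Complex.I * ((z + t : ℝ) : ℂ)) + _) = _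
    rw [Matrix.exp_add_of_commute _ _ hcomm, exp_diagonal]
    have : NormedSpace.exp (fun _ : Fin 2 × Fin 2 => Complex.I * ((z + t : ℝ) : ℂ)) =
        fun _ => Complex.exp ((z + t : ℝ) * Complex.I) := by
      ext j
      rw [Pi.coe_exp, ← Complex.exp_eq_exp_ℂ, mul_comm]
    rw [this, ← smul_one_eq_diagonal, smul_mul_assoc, one_mul]
  refine ⟨c * (c₁ * c₂ * Complex.exp ((z + t : ℝ) * Complex.I)), ?_, fun i => -1 * a i,
    fun i => -1 * b i, ?_⟩
  · rw [norm_mul, norm_mul, norm_mul, hc, hc₁, hc₂, Complex.norm_exp_ofReal_mul_I]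
    norm_num
  · have e : (-Complex.I) • (((-1 : ℝ) : ℂ) • localHam a b) = Complex.I • localHam a b := by
      rw [smul_smul]; simp
    rw [smul_kronecker, kronecker_smul, h1, h2, h3, localHam_smul, e, smul_smul, smul_smul,
      smul_smul]
    congr 1
    ring

end Local

end TwoQubit

/-! ### Local equivalences of canonical Hamiltonians -/

namespace TwoQubit

open Matrix
open scoped Matrix.Norms.L2Operator

section Equivalences

theorem pauli_conj_pauli (k i : Fin 3) :
    pauli k * pauli i * pauli k = (if i = k then (1 : ℂ) else -1) • pauli i := by
  ext a b
  simp only [mul_apply, Fin.sum_univ_two, Matrix.smul_apply]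
  fin_cases k <;> fin_cases i <;> fin_cases a <;> fin_cases b <;> simp [pauli]

theorem pauli_anticomm {i j : Fin 3} (hij : i ≠ j) : pauli i * pauli j = -(pauli j * pauli i) := by
  have h := pauli_conj_pauli j i
  rw [if_neg hij] at h
  calc pauli i * pauli j = pauli j * (pauli j * pauli i * pauli j) := by
        rw [mul_assoc, ← mul_assoc (pauli j) (pauli j), pauli_mul_self, one_mul]
    _ = _ := by rw [h]; simp

/-- The single-qubit unitary that exchanges the Pauli matrices `σ_i` and `σ_j`. -/
noncomputable def pauliSwap (i j : Fin 3) : Matrix (Fin 2) (Fin 2) ℂ :=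
  (Real.sqrt 2 : ℂ)⁻¹ • (pauli i + pauli j)

theorem pauliSwap_conjTranspose (i j : Fin 3) : (pauliSwap i j)ᴴ = pauliSwap i j := by
  rw [pauliSwap, conjTranspose_smul, conjTranspose_add, pauli_conjTranspose, pauli_conjTranspose,
    star_inv₀, RCLike.star_def, Complex.conj_ofReal]

theorem pauliSwap_mul_self {i j : Fin 3} (hij : i ≠ j) : pauliSwap i j * pauliSwap i j = 1 := by
  rw [pauliSwap, smul_mul_smul_comm, sqrt_two_inv_sq]
  have h : (pauli i + pauli j) * (pauli i + pauli j) = (2 : ℂ) • 1 := by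
    rw [mul_add, add_mul, add_mul, pauli_mul_self, pauli_mul_self, pauli_anticomm hij, two_smul]
    abel
  rw [h, smul_smul]
  norm_num

theorem exists_pauliSwap_conj {i j : Fin 3} (hij : i ≠ j) (k : Fin 3) : ∃ s : ℂ, s * s = 1 ∧
    pauliSwap i j * pauli k * pauliSwap i j = s • pauli (Equiv.swap i j k) := by
  have hconj : pauliSwap i j * pauli k * pauliSwap i j = (1 / 2 : ℂ) •
      (pauli i * pauli k * pauli i + pauli j * pauli k * pauli j +
        (pauli i * pauli k * pauli j + pauli j * pauli k * pauli i)) := by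
    rw [pauliSwap, smul_mul_assoc, smul_mul_smul_comm, sqrt_two_inv_sq]
    congr 1
    noncomm_ring
  rw [hconj]
  rcases eq_or_ne k i with rfl | hki
  · refine ⟨1, one_mul 1, ?_⟩
    rw [Equiv.swap_apply_left, pauli_mul_self, one_mul, pauli_conj_pauli, if_neg hij, one_mul,
      mul_assoc, pauli_mul_self, mul_one]
    module
  rcases eq_or_ne k j with rfl | hkj
  · refine ⟨1, one_mul 1, ?_⟩
    rw [Equiv.swap_apply_right, pauli_mul_self, one_mul, pauli_conj_pauli, if_neg hij.symm, one_mul,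
      mul_assoc, pauli_mul_self, mul_one]
    module
  · refine ⟨-1, by norm_num, ?_⟩
    have h : pauli i * pauli k * pauli j + pauli j * pauli k * pauli i = 0 := by
      rw [pauli_anticomm hki.symm, pauli_anticomm hkj.symm, neg_mul, neg_mul, mul_assoc,
        pauli_anticomm hij, mul_assoc]
      simp
    rw [Equiv.swap_apply_of_ne_of_ne hki hkj, pauli_conj_pauli, pauli_conj_pauli, if_neg hki,
      if_neg hkj, h]
    module

/-- Linear transformations of the parameters that are effected by conjugation with a local
unitary. -/
def IsLocallyRealized (w : (Fin 3 → ℝ) →ₗ[ℝ] (Fin 3 → ℝ)) : Prop :=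
  ∃ L, IsLocal L ∧ ∀ θ, canonicalHam (w θ) = Lᴴ * canonicalHam θ * L

theorem IsLocallyRealized.comp {w w' : (Fin 3 → ℝ) →ₗ[ℝ] (Fin 3 → ℝ)} (h : IsLocallyRealized w)
    (h' : IsLocallyRealized w') : IsLocallyRealized (w ∘ₗ w') := by
  obtain ⟨L, hL, hw⟩ := h
  obtain ⟨L', hL', hw'⟩ := h'
  refine ⟨L' * L, hL'.mul hL, fun θ => ?_⟩
  rw [LinearMap.comp_apply, hw, hw', conjTranspose_mul]
  noncomm_ring

theorem isLocallyRealized_perm (σ : Equiv.Perm (Fin 3)) :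
    IsLocallyRealized (signedPerm σ fun _ => 1) := by
  induction σ using Equiv.Perm.swap_induction_on with
  | one => exact ⟨1, isLocal_one, fun θ => by simp [signedPerm]⟩
  | swap_mul σ i j hij ih =>
    have hswap : IsLocallyRealized (signedPerm (Equiv.swap i j) fun _ => 1) := by
      have hu : pauliSwap i j ∈ unitaryGroup (Fin 2) ℂ := by
        rw [mem_unitaryGroup_iff, star_eq_conjTranspose, pauliSwap_conjTranspose,
          pauliSwap_mul_self hij]
      refine ⟨pauliSwap i j ⊗ₖ pauliSwap i j, isLocal_kronecker hu hu, fun θ => ?_⟩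
      rw [canonicalHam, canonicalHam, Finset.mul_sum, Finset.sum_mul,
        ← Equiv.sum_comp (Equiv.swap i j)]
      refine Finset.sum_congr rfl fun k _ => ?_
      obtain ⟨s, hs, hk⟩ := exists_pauliSwap_conj hij k
      rw [mul_smul_comm, smul_mul_assoc, conjTranspose_kronecker, pauliSwap_conjTranspose,
        ← mul_kronecker_mul, ← mul_kronecker_mul, hk, smul_kronecker, kronecker_smul, smul_smul,
        smul_smul, mul_assoc, hs, mul_one]
      simp [signedPerm]
    have := ih.comp hswap
    convert this using 1
    ext θ k
    simp [signedPerm]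

theorem isLocallyRealized_signs {ε : Fin 3 → ℝ} (hε : IsSigns ε) :
    IsLocallyRealized (signedPerm 1 ε) := by
  -- Conjugation with `σ_k ⊗ 1` changes the signs of the two coordinates other than `k`.
  have hk : ∀ k : Fin 3, (∀ i, ε i = if i = k then 1 else -1) →
      IsLocallyRealized (signedPerm 1 ε) := fun k hk => by
    refine ⟨pauli k ⊗ₖ 1, isLocal_kronecker (pauli_mem_unitaryGroup k) (one_mem _), fun θ => ?_⟩
    rw [canonicalHam, canonicalHam, Finset.mul_sum, Finset.sum_mul]
    refine Finset.sum_congr rfl fun i _ => ?_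
    rw [mul_smul_comm, smul_mul_assoc, conjTranspose_kronecker, pauli_conjTranspose,
      conjTranspose_one, ← mul_kronecker_mul, ← mul_kronecker_mul, one_mul, mul_one,
      pauli_conj_pauli, smul_kronecker, smul_smul]
    congr 1
    simp only [signedPerm, LinearMap.coe_mk, AddHom.coe_mk, Equiv.Perm.coe_one, id_eq, hk]
    split_ifs <;> simp
  have hp := hε.2
  rw [Fin.prod_univ_three] at hp
  rcases hε.1 0 with h0 | h0 <;> rcases hε.1 1 with h1 | h1 <;> rw [h0, h1] at hp
  · have : ε = fun _ => 1 := by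
      ext i
      fin_cases i
      · exact h0
      · exact h1
      · change ε 2 = 1; linarith
    rw [this]
    exact isLocallyRealized_perm 1
  · refine hk 0 fun i => ?_
    fin_cases i
    · exact h0
    · exact h1
    · change ε 2 = -1; linarith
  · refine hk 1 fun i => ?_
    fin_cases i
    · exact h0
    · exact h1
    · change ε 2 = -1; linarith
  · refine hk 2 fun i => ?_
    fin_cases i
    · exact h0
    · exact h1
    · change ε 2 = 1; linarith

/-- Any Hamiltonian with canonical parameters `θ` is brought by local unitaries, generated by
local Hamiltonians, to each of the canonical forms locally equivalent to `H_θ`. -/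
theorem IsHamParams.exists_exp_conj {C : Op} {θ : Fin 3 → ℝ} (h : IsHamParams C θ)
    {w : (Fin 3 → ℝ) →ₗ[ℝ] (Fin 3 → ℝ)} (hw : w ∈ signedPerms) : ∃ a b : Fin 3 → ℝ,
    canonicalHam (w θ) = (NormedSpace.exp ((-Complex.I) • localHam a b))ᴴ * C *
      NormedSpace.exp ((-Complex.I) • localHam a b) := by
  obtain ⟨σ, ε, hε, rfl⟩ := hw
  obtain ⟨L, hL, hLw⟩ : IsLocallyRealized (signedPerm σ ε) := by
    have := (isLocallyRealized_signs hε).comp (isLocallyRealized_perm σ)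
    convert this using 1
    ext θ k
    simp [signedPerm]
  obtain ⟨-, -, A, hA, B, hB, hC⟩ := h
  have hK := kronecker_mem_unitaryGroup hA hB
  obtain ⟨c, hc, a, b, hab⟩ := ((isLocal_kronecker hA hB).conjTranspose.mul hL).exists_exp
  refine ⟨a, b, ?_⟩
  set Z := NormedSpace.exp ((-Complex.I) • localHam a b) with hZ
  have h1 : canonicalHam θ = (A ⊗ₖ B) * C * (A ⊗ₖ B)ᴴ := by
    rw [hC]
    calc canonicalHam θ = ((A ⊗ₖ B) * (A ⊗ₖ B)ᴴ) * canonicalHam θ * ((A ⊗ₖ B) * (A ⊗ₖ B)ᴴ) := by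
          rw [mem_unitaryGroup_mul hK, one_mul, mul_one]
      _ = _ := by noncomm_ring
  calc canonicalHam (signedPerm σ ε θ) = ((A ⊗ₖ B)ᴴ * L)ᴴ * C * ((A ⊗ₖ B)ᴴ * L) := by
        rw [hLw, h1, conjTranspose_mul, conjTranspose_conjTranspose]
        noncomm_ring
    _ = Zᴴ * C * Z := by
        rw [hab, conjTranspose_smul, smul_mul_assoc, smul_mul_smul_comm, RCLike.star_def,
          mul_comm ((starRingEnd ℂ) c), Complex.mul_conj, Complex.normSq_eq_norm_sq, hc]
        simp

theorem canonicalGate_add (x y : Fin 3 → ℝ) :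
    canonicalGate (x + y) = canonicalGate x * canonicalGate y := by
  rw [canonicalGate_eq, canonicalGate_eq, canonicalGate_eq, phaseMatrix_mul bellBasis_mem]
  congr 1
  ext ⟨a, b⟩
  fin_cases a <;> fin_cases b <;> simp [bellEig] <;> ring

theorem canonicalGate_zero : canonicalGate 0 = 1 := by
  have : canonicalHam 0 = 0 := by simp [canonicalHam]
  rw [canonicalGate, this, smul_zero, NormedSpace.exp_zero]

theorem canonicalGate_mem (x : Fin 3 → ℝ) :
    canonicalGate x ∈ unitaryGroup (Fin 2 × Fin 2) ℂ := by
  rw [canonicalGate_eq]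
  exact (phaseMatrix_hasPhases bellBasis_mem _).mem_unitaryGroup

theorem canonicalGate_neg (x : Fin 3 → ℝ) : canonicalGate (-x) = (canonicalGate x)ᴴ := by
  calc canonicalGate (-x) = canonicalGate (-x) * (canonicalGate x * (canonicalGate x)ᴴ) := by
        rw [mem_unitaryGroup_mul (canonicalGate_mem x), mul_one]
    _ = _ := by rw [← mul_assoc, ← canonicalGate_add, neg_add_cancel, canonicalGate_zero, one_mul]

theorem canonicalGate_single (j : Fin 3) :
    canonicalGate (Pi.single j (Real.pi / 2)) = (-Complex.I) • (pauli j ⊗ₖ pauli j) := by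
  have h1 : canonicalHam (Pi.single j 1) = pauli j ⊗ₖ pauli j := by
    rw [canonicalHam, Finset.sum_eq_single j]
    · simp
    · intro i _ hij; simp [hij]
    · simp
  rw [← h1, canonicalHam_eq_conj, canonicalGate_eq, phaseMatrix, ← smul_mul_assoc, ← mul_smul_comm,
    ← diagonal_smul]
  congr 3
  ext ⟨a, b⟩
  have e1 : Complex.exp ((-(Real.pi / 2) : ℝ) * Complex.I) = -Complex.I := by
    rw [Complex.ofReal_neg, neg_mul, Complex.exp_neg, Complex.ofReal_div, Complex.ofReal_ofNat,
      Complex.exp_pi_div_two_mul_I, Complex.inv_I]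
  have e2 : Complex.exp ((Real.pi / 2 : ℝ) * Complex.I) = Complex.I := by
    rw [Complex.ofReal_div, Complex.ofReal_ofNat, Complex.exp_pi_div_two_mul_I]
  have key : ∀ r : ℝ, (r = 1 ∨ r = -1) →
      Complex.exp ((-(r * (Real.pi / 2)) : ℝ) * Complex.I) = -Complex.I * r := by
    rintro r (rfl | rfl)
    · rw [one_mul, e1]; simp
    · rw [neg_mul, one_mul, neg_neg, e2]; simp
  have hb : bellEig (Pi.single j (Real.pi / 2)) (a, b) =
      bellEig (Pi.single j 1) (a, b) * (Real.pi / 2) := by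
    fin_cases j <;> fin_cases a <;> fin_cases b <;> simp [bellEig]
  rw [hb]
  refine key _ ?_
  fin_cases j <;> fin_cases a <;> fin_cases b <;> simp [bellEig]

/-- Shifting the parameters by integer multiples of `π/2` changes the gate by a local unitary. -/
theorem isLocal_canonicalGate (n : Fin 3 → ℤ) :
    IsLocal (canonicalGate fun j => Real.pi / 2 * (n j : ℝ)) := by
  let S : AddSubgroup (Fin 3 → ℤ) :=
    { carrier := {n | IsLocal (canonicalGate fun j => Real.pi / 2 * (n j : ℝ))}
      add_mem' := fun {m n} hm hn => by
        have : (fun j => Real.pi / 2 * (((m + n) j : ℤ) : ℝ)) =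
            (fun j => Real.pi / 2 * (m j : ℝ)) + fun j => Real.pi / 2 * (n j : ℝ) := by
          ext j; simp; ring
        change IsLocal (canonicalGate _)
        rw [this, canonicalGate_add]
        exact hm.mul hn
      zero_mem' := by
        have : (fun j => Real.pi / 2 * (((0 : Fin 3 → ℤ) j : ℤ) : ℝ)) = 0 := by
          ext j; simp
        change IsLocal (canonicalGate _)
        rw [this, canonicalGate_zero]
        exact isLocal_one
      neg_mem' := fun {n} hn => by
        have : (fun j => Real.pi / 2 * (((-n) j : ℤ) : ℝ)) =
            -fun j => Real.pi / 2 * (n j : ℝ) := by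
          ext j; simp
        change IsLocal (canonicalGate _)
        rw [this, canonicalGate_neg]
        exact IsLocal.conjTranspose hn }
  have hsingle : ∀ j : Fin 3, Pi.single j 1 ∈ S := fun j => by
    have : (fun i => Real.pi / 2 * (((Pi.single j 1 : Fin 3 → ℤ) i : ℤ) : ℝ)) =
        Pi.single j (Real.pi / 2) := by
      ext i
      rcases eq_or_ne i j with rfl | h <;> simp [*]
    change IsLocal (canonicalGate _)
    rw [this, canonicalGate_single]
    exact (isLocal_kronecker (pauli_mem_unitaryGroup j) (pauli_mem_unitaryGroup j)).smul (by simp)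
  have hn : n = ∑ j, n j • Pi.single j 1 := by
    ext i
    simp [Finset.sum_apply, Pi.single_apply]
  have : n ∈ S := by
    rw [hn]
    exact S.sum_mem fun j _ => S.zsmul_mem (hsingle j) _
  exact this

end Equivalences

end TwoQubit

/-! ### Steering with fast local pulses -/

namespace TwoQubit

open Matrix MeasureTheory Set
open scoped Matrix.Norms.L2Operator

section Steering

theorem IsEvolution.congr {A : Type*} [NormedRing A] [NormedAlgebra ℝ A] {G G' V : ℝ → A}
    {a b : ℝ} (h : IsEvolution G V a b) (hG : ∀ t ∈ Ioc a b, G t = G' t) :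
    IsEvolution G' V a b := by
  refine ⟨h.1, fun t ht => ?_⟩
  rw [h.2 t ht]
  congr 1
  refine intervalIntegral.integral_congr_ae (Filter.Eventually.of_forall fun r hr => ?_)
  rw [uIoc_of_le ht.1] at hr
  rw [hG r ⟨hr.1, hr.2.trans ht.2⟩]

/-- The control system with drift `Hd` can be steered from the identity at time `u` to `X` at
time `v`. -/
def Steers (Hd : ℝ → Op) (u v : ℝ) (X : Op) : Prop :=
  ∃ a b : ℝ → Fin 3 → ℝ, (∀ i, IntervalIntegrable (fun t => a t i) volume u v) ∧
    (∀ i, IntervalIntegrable (fun t => b t i) volume u v) ∧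
    ∃ V : ℝ → Op, IsEvolution (fun t => (-Complex.I) • (Hd t + localHam (a t) (b t))) V u v ∧
      V u = 1 ∧ V v = X

variable {Hd : ℝ → Op}

theorem steers_refl (u : ℝ) : Steers Hd u u 1 := by
  refine ⟨fun _ _ => 0, fun _ _ => 0, fun _ => .refl, fun _ => .refl, fun _ => 1,
    ⟨continuousOn_const, fun t ht => ?_⟩, rfl, rfl⟩
  rw [Icc_self] at ht
  rw [mem_singleton_iff.1 ht]
  simp

theorem Steers.trans {u v w : ℝ} {X Y : Op} (huv : u ≤ v) (hvw : v ≤ w)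
    (hH : IntervalIntegrable Hd volume u w) (hX : Steers Hd u v X) (hY : Steers Hd v w Y) :
    Steers Hd u w (Y * X) := by
  obtain ⟨a, b, ha, hb, V, hV, hV0, rfl⟩ := hX
  obtain ⟨a', b', ha', hb', W, hW, hW0, rfl⟩ := hY
  have hgl : ∀ {f g : ℝ → Fin 3 → ℝ}, (∀ i, IntervalIntegrable (fun t => f t i) volume u v) →
      (∀ i, IntervalIntegrable (fun t => g t i) volume v w) →
      ∀ i, IntervalIntegrable (fun t => (if t ≤ v then f t else g t) i) volume u w := by
    intro f g hf hg i
    refine ((hf i).congr fun t ht => ?_).trans ((hg i).congr fun t ht => ?_)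
    · rw [uIoc_of_le huv] at ht; simp [ht.2]
    · rw [uIoc_of_le hvw] at ht; simp [not_le.2 ht.1]
  have hsub : uIcc v w ⊆ uIcc u w := by
    rw [uIcc_of_le hvw, uIcc_of_le (huv.trans hvw)]; exact Icc_subset_Icc_left huv
  have hA := hgl ha ha'
  have hB := hgl hb hb'
  have hG' := ((hH.mono_set hsub).add (intervalIntegrable_localHam ha' hb')).smul (-Complex.I)
  have hev := IsEvolution.glue
    (G := fun t => (-Complex.I) • (Hd t + localHam (if t ≤ v then a t else a' t)
      (if t ≤ v then b t else b' t))) huv hvw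
    ((hH.add (intervalIntegrable_localHam hA hB)).smul (-Complex.I))
    (hV.congr fun t ht => by simp [ht.2])
    ((hW.mul_const hvw hG' (V v)).congr fun t ht => by simp [not_le.2 ht.1]) (by simp [hW0])
  refine ⟨_, _, hA, hB, _, hev, by simp [huv, hV0], ?_⟩
  rcases hvw.eq_or_lt with rfl | h
  · simp [hW0]
  · simp [not_le.2 h]

theorem Steers.norm_le_one {u v : ℝ} {X : Op} (huv : u ≤ v)
    (hH : IntervalIntegrable Hd volume u v) (hHh : ∀ t, (Hd t)ᴴ = Hd t) (hX : Steers Hd u v X) :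
    ‖X‖ ≤ 1 := by
  obtain ⟨a, b, ha, hb, V, hV, hV0, rfl⟩ := hX
  refine norm_le_one_of_star_mul_self (hV.star_mul_self huv
    ((hH.add (intervalIntegrable_localHam ha hb)).smul (-Complex.I))
    (fun r _ => skew_hamiltonian (hHh r) _ _)
    (by rw [hV0]; simp) v (right_mem_Icc.2 huv))

/-- Constant controls: the operator reached is compared with the exponential for a constant
drift `C`. -/
theorem exists_steers_const {u v : ℝ} (huv : u ≤ v) (hH : IntervalIntegrable Hd volume u v)
    (hHh : ∀ t, (Hd t)ᴴ = Hd t) {C : Op} (hC : Cᴴ = C) (a b : Fin 3 → ℝ) :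
    ∃ X, Steers Hd u v X ∧
      ‖X - NormedSpace.exp ((v - u) • ((-Complex.I) • (C + localHam a b)))‖ ≤
        ∫ r in u..v, ‖Hd r - C‖ := by
  have hG : IntervalIntegrable (fun t => (-Complex.I) • (Hd t + localHam a b)) volume u v :=
    (hH.add intervalIntegrable_const).smul (-Complex.I)
  obtain ⟨V, hV, hV0⟩ := exists_isEvolution huv hG 1
  refine ⟨V v, ⟨fun _ => a, fun _ => b, fun _ => intervalIntegrable_const,
    fun _ => intervalIntegrable_const, V, hV, hV0, rfl⟩, ?_⟩
  have := hV.norm_sub_exp_le huv hG (X := (-Complex.I) • (C + localHam a b))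
    (fun r _ => skew_hamiltonian (hHh r) a b) (skew_hamiltonian hC a b) hV0
  refine this.trans_eq (intervalIntegral.integral_congr fun r _ => ?_)
  simp only [← smul_sub, add_sub_add_right_eq_sub, norm_smul, norm_neg, Complex.norm_I, one_mul]

/-- The control system can be steered from time `u` to time `v` arbitrarily close to the closed
ball of radius `e` around `E`. -/
def Approximates (Hd : ℝ → Op) (u v e : ℝ) (E : Op) : Prop :=
  ∀ ε > 0, ∃ X, Steers Hd u v X ∧ ‖X - E‖ < e + ε

theorem Approximates.mono {u v e e' : ℝ} {E : Op} (h : Approximates Hd u v e E) (he : e ≤ e') :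
    Approximates Hd u v e' E := fun ε hε =>
  let ⟨X, hX, hXE⟩ := h ε hε; ⟨X, hX, hXE.trans_le (by linarith)⟩

theorem approximates_of_forall {u v e : ℝ} {E : Op}
    (h : ∀ ε > 0, Approximates Hd u v (e + ε) E) : Approximates Hd u v e E := fun ε hε =>
  let ⟨X, hX, hXE⟩ := h (ε / 2) (half_pos hε) (ε / 2) (half_pos hε); ⟨X, hX, by linarith⟩

theorem Approximates.perturb {u v e : ℝ} {E E' : Op} (h : Approximates Hd u v e E) :
    Approximates Hd u v (e + ‖E - E'‖) E' := fun ε hε => by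
  obtain ⟨X, hX, hXE⟩ := h ε hε
  refine ⟨X, hX, ?_⟩
  have := norm_sub_le_norm_sub_add_norm_sub X E E'
  linarith

theorem Approximates.trans {u v w e e' : ℝ} {E E' : Op} (huv : u ≤ v) (hvw : v ≤ w)
    (hH : IntervalIntegrable Hd volume u w) (hHh : ∀ t, (Hd t)ᴴ = Hd t)
    (hE' : ‖E'‖ ≤ 1) (h : Approximates Hd u v e E) (h' : Approximates Hd v w e' E') :
    Approximates Hd u w (e + e') (E' * E) := fun ε hε => by
  obtain ⟨X, hX, hXE⟩ := h (ε / 2) (half_pos hε)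
  obtain ⟨Y, hY, hYE⟩ := h' (ε / 2) (half_pos hε)
  refine ⟨Y * X, hX.trans huv hvw hH hY, ?_⟩
  have hX1 := hX.norm_le_one huv (hH.mono_set (by
    rw [uIcc_of_le huv, uIcc_of_le (huv.trans hvw)]; exact Icc_subset_Icc_right hvw)) hHh
  calc ‖Y * X - E' * E‖ = ‖(Y - E') * X + E' * (X - E)‖ := by congr 1; noncomm_ring
    _ ≤ ‖Y - E'‖ * ‖X‖ + ‖E'‖ * ‖X - E‖ :=
        (norm_add_le _ _).trans (add_le_add (norm_mul_le _ _) (norm_mul_le _ _))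
    _ ≤ ‖Y - E'‖ * 1 + 1 * ‖X - E‖ := by gcongr
    _ < e + e' + ε := by linarith

theorem approximates_refl (u : ℝ) : Approximates Hd u u 0 1 := fun ε hε =>
  ⟨1, steers_refl u, by simpa using hε⟩

/-- A strong local pulse realizes any local rotation on a short interval. -/
theorem approximates_pulse {u v : ℝ} (huv : u < v) (hH : IntervalIntegrable Hd volume u v)
    (hHh : ∀ t, (Hd t)ᴴ = Hd t) (a b : Fin 3 → ℝ) :
    Approximates Hd u v (∫ r in u..v, ‖Hd r‖)
      (NormedSpace.exp ((-Complex.I) • localHam a b)) := fun ε hε => by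
  obtain ⟨X, hX, hXE⟩ := exists_steers_const huv.le hH hHh conjTranspose_zero
    (fun i => (v - u)⁻¹ * a i) (fun i => (v - u)⁻¹ * b i)
  refine ⟨X, hX, ?_⟩
  have e : (v - u) • ((-Complex.I) • (0 + localHam (fun i => (v - u)⁻¹ * a i)
      fun i => (v - u)⁻¹ * b i)) = (-Complex.I) • localHam a b := by
    rw [zero_add, localHam_smul, smul_comm, ← Complex.coe_smul, smul_smul, smul_smul, mul_assoc,
      ← Complex.ofReal_mul,
      mul_inv_cancel₀ (sub_pos.2 huv).ne', Complex.ofReal_one, mul_one]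
  rw [e] at hXE
  simp only [sub_zero] at hXE
  linarith

theorem canonicalHam_smul (r : ℝ) (x : Fin 3 → ℝ) :
    canonicalHam (r • x) = (r : ℂ) • canonicalHam x := by
  simp only [canonicalHam, Finset.smul_sum, smul_smul, Pi.smul_apply, smul_eq_mul,
    Complex.ofReal_mul]

theorem abs_bellEig_le (x : Fin 3 → ℝ) (k : Fin 2 × Fin 2) : |bellEig x k| ≤ ∑ i, |x i| := by
  obtain ⟨ε, hε, hk⟩ := exists_isSigns_bellEig k
  rw [hk, abs_neg]
  refine (Finset.abs_sum_le_sum_abs _ _).trans_eq (Finset.sum_congr rfl fun i _ => ?_)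
  rw [abs_mul, hε.abs, one_mul]

theorem norm_canonicalGate_le (x : Fin 3 → ℝ) : ‖canonicalGate x‖ ≤ 1 :=
  norm_le_one_of_mem_unitaryGroup (canonicalGate_mem x)

theorem norm_canonicalGate_sub_le (x y : Fin 3 → ℝ) :
    ‖canonicalGate x - canonicalGate y‖ ≤ ∑ i, |x i - y i| := by
  have h1 : canonicalGate x - canonicalGate y = canonicalGate y * (canonicalGate (x - y) - 1) := by
    rw [mul_sub, ← canonicalGate_add, add_sub_cancel, mul_one]
  have h2 : ‖canonicalGate (x - y) - 1‖ ≤ ∑ i, |x i - y i| := by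
    rw [canonicalGate_eq]
    refine phaseMatrix_norm_sub_one_le bellBasis_mem
      (Finset.sum_nonneg fun _ _ => abs_nonneg _) fun k => ?_
    rw [abs_neg]
    exact abs_bellEig_le (x - y) k
  rw [h1]
  calc _ ≤ ‖canonicalGate y‖ * ‖canonicalGate (x - y) - 1‖ := norm_mul_le _ _
    _ ≤ 1 * ‖canonicalGate (x - y) - 1‖ := by gcongr; exact norm_canonicalGate_le y
    _ ≤ _ := by rwa [one_mul]

theorem exp_localHam_conjTranspose (a b : Fin 3 → ℝ) :
    (NormedSpace.exp ((-Complex.I) • localHam a b))ᴴ =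
      NormedSpace.exp ((-Complex.I) • localHam (fun i => -1 * a i) fun i => -1 * b i) := by
  rw [← exp_conjTranspose, conjTranspose_smul, localHam_conjTranspose, localHam_smul, smul_smul]
  congr 2
  simp

theorem exp_localHam_mem (a b : Fin 3 → ℝ) :
    NormedSpace.exp ((-Complex.I) • localHam a b) ∈ unitaryGroup (Fin 2 × Fin 2) ℂ := by
  have h1 : (-Complex.I) • localHam a b =
      Complex.I • localHam (fun i => -1 * a i) fun i => -1 * b i := by
    rw [localHam_smul, smul_smul]; simp
  obtain ⟨d, hd⟩ := exists_hasEigenlist_of_isHermitian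
    (localHam_conjTranspose (fun i => -1 * a i) fun i => -1 * b i)
  rw [h1]
  exact hd.exp_I_smul.mem_unitaryGroup

/-- Between two short local pulses, a drift close to a constant Hamiltonian `C` with canonical
parameters `θ` realizes the canonical gate of every vector equivalent to `θ`. -/
theorem approximates_signedPerm {u v : ℝ} (huv : u ≤ v) (hH : IntervalIntegrable Hd volume u v)
    (hHh : ∀ t, (Hd t)ᴴ = Hd t) {C : Op} (hC : Cᴴ = C) {θ : Fin 3 → ℝ} (hCθ : IsHamParams C θ)
    {w : (Fin 3 → ℝ) →ₗ[ℝ] (Fin 3 → ℝ)} (hw : w ∈ signedPerms) :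
    Approximates Hd u v (∫ r in u..v, ‖Hd r - C‖) (canonicalGate ((v - u) • w θ)) := by
  rcases huv.eq_or_lt with rfl | huv
  · simpa [canonicalGate_zero] using approximates_refl u
  obtain ⟨a, b, hab⟩ := hCθ.exists_exp_conj hw
  set K := NormedSpace.exp ((-Complex.I) • localHam a b) with hK
  have hKu : K ∈ unitaryGroup (Fin 2 × Fin 2) ℂ := exp_localHam_mem a b
  set D : ℝ := 2 * (‖C‖ + ∑ i, |w θ i|) + 1 with hD
  have hS : 0 ≤ ∑ i, |w θ i| := Finset.sum_nonneg fun _ _ => abs_nonneg _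
  have hD0 : 0 < D := by positivity
  refine approximates_of_forall fun ε hε => ?_
  -- The duration of the two pulses. They cost at most `ρ ‖C‖` each, besides the integral of
  -- `‖Hd - C‖`, and shorten the main part by `2 ρ`.
  set ρ : ℝ := min ((v - u) / 4) (ε / D) with hρ
  have hρ0 : 0 < ρ := lt_min (by linarith) (by positivity)
  have hρ1 : ρ ≤ (v - u) / 4 := min_le_left _ _
  have hρ2 : ρ * D ≤ ε := (le_div_iff₀ hD0).1 (min_le_right _ _)
  have hsub : ∀ {x y}, u ≤ x → x ≤ y → y ≤ v → IntervalIntegrable Hd volume x y :=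
    fun {x y} h1 h2 h3 => hH.mono_set (by
      rw [uIcc_of_le h2, uIcc_of_le huv.le]; exact Icc_subset_Icc h1 h3)
  set p := u + ρ with hp
  set q := v - ρ with hq
  have hup : u < p := by linarith
  have hpq : p ≤ q := by linarith
  have hqv : q < v := by linarith
  have i1 := hsub le_rfl hup.le (by linarith)
  have i2 := hsub hup.le hpq hqv.le
  have i3 := hsub (by linarith) hqv.le le_rfl
  have a1 := approximates_pulse hup i1 hHh a b
  have a2 : Approximates Hd p q (∫ r in p..q, ‖Hd r - C‖)
      (NormedSpace.exp ((q - p) • ((-Complex.I) • C))) := fun ε hε => by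
    obtain ⟨X, hX, hXE⟩ := exists_steers_const hpq i2 hHh hC 0 0
    have h0 : localHam 0 0 = 0 := by simp [localHam]
    rw [h0, add_zero] at hXE
    exact ⟨X, hX, by linarith⟩
  have a3 := approximates_pulse hqv i3 hHh (fun i => -1 * a i) fun i => -1 * b i
  rw [← exp_localHam_conjTranspose, ← hK] at a3
  have hKinv : Kᴴ = K⁻¹ := (inv_eq_right_inv (mem_unitaryGroup_mul hKu)).symm
  have hKunit : IsUnit K := (isUnit_iff_isUnit_det _).2
    (isUnit_det_of_right_inverse (mem_unitaryGroup_mul hKu))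
  have hgate : Kᴴ * (NormedSpace.exp ((q - p) • ((-Complex.I) • C)) * K) =
      canonicalGate ((q - p) • w θ) := by
    rw [canonicalGate, canonicalHam_smul, hab, ← mul_assoc, hKinv, ← exp_conj' _ _ hKunit]
    congr 1
    rw [← Complex.coe_smul]
    simp only [mul_smul_comm, smul_mul_assoc]
    exact smul_comm _ _ _
  have hexp : ‖NormedSpace.exp ((q - p) • ((-Complex.I) • C))‖ ≤ 1 := by
    have h1 : NormedSpace.exp ((q - p) • ((-Complex.I) • C)) =
        K * canonicalGate ((q - p) • w θ) * Kᴴ := by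
      rw [← hgate]
      calc _ = (K * Kᴴ) * NormedSpace.exp ((q - p) • ((-Complex.I) • C)) * (K * Kᴴ) := by
            rw [mem_unitaryGroup_mul hKu, one_mul, mul_one]
        _ = _ := by noncomm_ring
    rw [h1, norm_conj hKu]
    exact norm_canonicalGate_le _
  have hKn : ‖Kᴴ‖ ≤ 1 := norm_le_one_of_mem_unitaryGroup (Unitary.star_mem hKu)
  have a12 := Approximates.trans hup.le hpq (hsub le_rfl (by linarith) hqv.le) hHh hexp a1 a2
  have a123 := Approximates.trans (by linarith) hqv.le hH hHh hKn a12 a3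
  rw [hgate] at a123
  refine (a123.perturb (E' := canonicalGate ((v - u) • w θ))).mono ?_
  have hCi : ∀ x y : ℝ, IntervalIntegrable (fun _ => C) volume x y := fun _ _ =>
    intervalIntegrable_const
  have hshort : ∀ x y, x ≤ y → IntervalIntegrable Hd volume x y →
      ∫ r in x..y, ‖Hd r‖ ≤ (∫ r in x..y, ‖Hd r - C‖) + (y - x) * ‖C‖ := by
    intro x y hxy hi
    have h1 : (∫ r in x..y, ‖Hd r - C‖) + (y - x) * ‖C‖ = ∫ r in x..y, (‖Hd r - C‖ + ‖C‖) := by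
      rw [intervalIntegral.integral_add (hi.sub (hCi x y)).norm intervalIntegrable_const,
        intervalIntegral.integral_const, smul_eq_mul]
    rw [h1]
    refine intervalIntegral.integral_mono_on hxy hi.norm
      ((hi.sub (hCi x y)).norm.add intervalIntegrable_const) fun r _ => ?_
    have := norm_add_le (Hd r - C) C
    rwa [sub_add_cancel] at this
  have s1 := hshort u p hup.le i1
  have s3 := hshort q v hqv.le i3
  have hadd : (∫ r in u..p, ‖Hd r - C‖) + (∫ r in p..q, ‖Hd r - C‖) + (∫ r in q..v, ‖Hd r - C‖)
      = ∫ r in u..v, ‖Hd r - C‖ := by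
    rw [intervalIntegral.integral_add_adjacent_intervals (i1.sub (hCi _ _)).norm
      (i2.sub (hCi _ _)).norm, intervalIntegral.integral_add_adjacent_intervals
      ((i1.sub (hCi _ _)).norm.trans (i2.sub (hCi _ _)).norm) (i3.sub (hCi _ _)).norm]
  have hg : ‖canonicalGate ((q - p) • w θ) - canonicalGate ((v - u) • w θ)‖ ≤
      2 * ρ * ∑ i, |w θ i| := by
    refine (norm_canonicalGate_sub_le _ _).trans_eq ?_
    rw [Finset.mul_sum]
    refine Finset.sum_congr rfl fun i _ => ?_
    simp only [Pi.smul_apply, smul_eq_mul]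
    rw [← sub_mul, abs_mul, show q - p - (v - u) = -(2 * ρ) by rw [hp, hq]; ring, abs_neg,
      abs_of_nonneg (by linarith)]
  have e1 : p - u = ρ := by rw [hp]; ring
  have e3 : v - q = ρ := by rw [hq]; ring
  rw [e1] at s1
  rw [e3] at s3
  have : 2 * ρ * (‖C‖ + ∑ i, |w θ i|) ≤ ε := by
    refine le_trans ?_ hρ2
    rw [hD]
    nlinarith
  nlinarith

end Steering

end TwoQubit

/-! ### Steering along integrated canonical parameters -/

namespace TwoQubit

open Matrix MeasureTheory Set
open scoped Matrix.Norms.L2Operator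

section Sufficiency

variable {Hd : ℝ → Op}

/-- Dividing an interval in the ratio `p : q` realizes the convex combination of two linear
transformations of the parameters. -/
theorem approximates_convexHull (hHh : ∀ t, (Hd t)ᴴ = Hd t) {C : Op} (hC : Cᴴ = C)
    {θ : Fin 3 → ℝ} (hCθ : IsHamParams C θ) {Φ : (Fin 3 → ℝ) →ₗ[ℝ] (Fin 3 → ℝ)}
    (hΦ : Φ ∈ convexHull ℝ signedPerms) {u v : ℝ} (huv : u ≤ v)
    (hH : IntervalIntegrable Hd volume u v) :
    Approximates Hd u v (∫ r in u..v, ‖Hd r - C‖) (canonicalGate ((v - u) • Φ θ)) := by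
  refine convexHull_min (s := signedPerms) (t := {Φ | ∀ u v, u ≤ v →
    IntervalIntegrable Hd volume u v →
    Approximates Hd u v (∫ r in u..v, ‖Hd r - C‖) (canonicalGate ((v - u) • Φ θ))})
    (fun w hw u v huv hH => approximates_signedPerm huv hH hHh hC hCθ hw) ?_ hΦ u v huv hH
  intro Φ₁ h₁ Φ₂ h₂ p q hp hq hpq u v huv hH
  set m := u + p * (v - u) with hm
  have hvu : 0 ≤ v - u := sub_nonneg.2 huv
  have hq' : v - m = q * (v - u) := by
    rw [hm]; linear_combination (-(v - u)) * hpq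
  have hum : u ≤ m := by nlinarith
  have hmv : m ≤ v := by nlinarith
  have hH1 : IntervalIntegrable Hd volume u m := hH.mono_set (by
    rw [uIcc_of_le hum, uIcc_of_le huv]; exact Icc_subset_Icc_right hmv)
  have hH2 : IntervalIntegrable Hd volume m v := hH.mono_set (by
    rw [uIcc_of_le hmv, uIcc_of_le huv]; exact Icc_subset_Icc_left hum)
  have h := Approximates.trans hum hmv hH hHh (norm_canonicalGate_le _) (h₁ u m hum hH1)
    (h₂ m v hmv hH2)
  rw [intervalIntegral.integral_add_adjacent_intervals
    (hH1.sub intervalIntegrable_const).norm (hH2.sub intervalIntegrable_const).norm,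
    ← canonicalGate_add, hq', show m - u = p * (v - u) by rw [hm]; ring] at h
  convert h using 2
  simp only [LinearMap.add_apply, LinearMap.smul_apply, smul_add, smul_smul]
  rw [add_comm, mul_comm (v - u), mul_comm (v - u)]

theorem sum_abs_le_of_mem_convexHull {Φ : (Fin 3 → ℝ) →ₗ[ℝ] (Fin 3 → ℝ)}
    (hΦ : Φ ∈ convexHull ℝ signedPerms) (z : Fin 3 → ℝ) : ∑ i, |Φ z i| ≤ ∑ i, |z i| := by
  refine convexHull_min (s := signedPerms)
    (t := {Φ | ∀ z : Fin 3 → ℝ, ∑ i, |Φ z i| ≤ ∑ i, |z i|}) ?_ ?_ hΦ z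
  · rintro w ⟨σ, ε, hε, rfl⟩ z
    refine le_of_eq ?_
    rw [← Equiv.sum_comp σ fun i => |z i|]
    exact Finset.sum_congr rfl fun i _ => by
      simp only [signedPerm, LinearMap.coe_mk, AddHom.coe_mk, abs_mul, hε.abs, one_mul]
  · intro Φ₁ h₁ Φ₂ h₂ p q hp hq hpq z
    calc ∑ i, |(p • Φ₁ + q • Φ₂) z i| ≤ ∑ i, (p * |Φ₁ z i| + q * |Φ₂ z i|) := by
          refine Finset.sum_le_sum fun i _ => (abs_add_le _ _).trans_eq ?_
          simp [abs_mul, abs_of_nonneg hp, abs_of_nonneg hq]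
      _ = p * ∑ i, |Φ₁ z i| + q * ∑ i, |Φ₂ z i| := by
          rw [Finset.sum_add_distrib, Finset.mul_sum, Finset.mul_sum]
      _ ≤ p * ∑ i, |z i| + q * ∑ i, |z i| := by
          exact add_le_add (mul_le_mul_of_nonneg_left (h₁ z) hp)
            (mul_le_mul_of_nonneg_left (h₂ z) hq)
      _ = _ := by rw [← add_mul, hpq, one_mul]

variable {θ : ℝ → Fin 3 → ℝ}

/-- Replacing the drift on an interval by its value at one point `τ` changes the integrated
parameters and the operator reached by a multiple of the `L¹` oscillation around `Hd τ`. -/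
theorem approximates_sample (hHh : ∀ t, (Hd t)ᴴ = Hd t)
    (hθ : ∀ t, 0 ≤ t → IsHamParams (Hd t) (θ t)) {Φ : (Fin 3 → ℝ) →ₗ[ℝ] (Fin 3 → ℝ)}
    (hΦ : Φ ∈ convexHull ℝ signedPerms) {u v τ : ℝ} (hu : 0 ≤ u) (huv : u ≤ v) (hτ : 0 ≤ τ)
    (hH : IntervalIntegrable Hd volume u v)
    (hθi : ∀ i, IntervalIntegrable (fun t => θ t i) volume u v) :
    Approximates Hd u v (4 * ∫ r in u..v, ‖Hd r - Hd τ‖)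
      (canonicalGate (Φ fun i => ∫ r in u..v, θ r i)) := by
  refine ((approximates_convexHull hHh (hHh τ) (hθ τ hτ) hΦ huv hH).perturb
    (E' := canonicalGate (Φ fun i => ∫ r in u..v, θ r i))).mono ?_
  have hcoord : ∀ i, |(v - u) * θ τ i - ∫ r in u..v, θ r i| ≤ ∫ r in u..v, ‖Hd r - Hd τ‖ := by
    intro i
    have h1 : (v - u) * θ τ i - ∫ r in u..v, θ r i = ∫ r in u..v, (θ τ i - θ r i) := by
      rw [intervalIntegral.integral_sub intervalIntegrable_const (hθi i),
        intervalIntegral.integral_const, smul_eq_mul]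
    rw [h1]
    refine (intervalIntegral.abs_integral_le_integral_abs huv).trans ?_
    refine intervalIntegral.integral_mono_on huv (intervalIntegrable_const.sub (hθi i)).abs
      (hH.sub intervalIntegrable_const).norm fun r hr => ?_
    rw [norm_sub_rev]
    exact (hθ τ hτ).abs_sub_le (hθ r (hu.trans hr.1)) i
  have h2 : ‖canonicalGate ((v - u) • Φ (θ τ)) - canonicalGate (Φ fun i => ∫ r in u..v, θ r i)‖ ≤
      3 * ∫ r in u..v, ‖Hd r - Hd τ‖ := by
    refine (norm_canonicalGate_sub_le _ _).trans ?_
    have h3 : ∀ i, ((v - u) • Φ (θ τ)) i - (Φ fun i => ∫ r in u..v, θ r i) i =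
        Φ ((v - u) • θ τ - fun i => ∫ r in u..v, θ r i) i := fun i => by
      rw [map_sub, map_smul, Pi.sub_apply]
    simp only [h3]
    refine (sum_abs_le_of_mem_convexHull hΦ _).trans ?_
    rw [Fin.sum_univ_three]
    have c0 := hcoord 0
    have c1 := hcoord 1
    have c2 := hcoord 2
    simp only [Pi.sub_apply, Pi.smul_apply, smul_eq_mul]
    linarith
  linarith

/-- Every convex combination of equivalent forms of the integrated canonical parameters can be
realized. On a fine partition the drift is compared with its values at sample points, where it
is close to a continuous function that approximates it in `L¹`. -/
theorem approximates_integral (hHi : ∀ T, 0 ≤ T → IntervalIntegrable Hd volume 0 T)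
    (hHh : ∀ t, (Hd t)ᴴ = Hd t) (hθ : ∀ t, 0 ≤ t → IsHamParams (Hd t) (θ t))
    {Φ : (Fin 3 → ℝ) →ₗ[ℝ] (Fin 3 → ℝ)} (hΦ : Φ ∈ convexHull ℝ signedPerms) {s s' : ℝ}
    (hs : 0 ≤ s) (hss : s ≤ s') :
    Approximates Hd s s' 0 (canonicalGate (Φ fun i => ∫ r in s..s', θ r i)) := by
  have hsub : ∀ {x y : ℝ}, 0 ≤ x → x ≤ y → uIcc x y ⊆ uIcc 0 y := fun {_ _} hx hxy => by
    rw [uIcc_of_le hxy, uIcc_of_le (hx.trans hxy)]; exact Icc_subset_Icc_left hx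
  have hHxy : ∀ {x y : ℝ}, 0 ≤ x → x ≤ y → IntervalIntegrable Hd volume x y := fun {_ _} hx hxy =>
    (hHi _ (hx.trans hxy)).mono_set (hsub hx hxy)
  have hθxy : ∀ {x y : ℝ}, 0 ≤ x → x ≤ y → ∀ i, IntervalIntegrable (fun t => θ t i) volume x y :=
    fun {_ _} hx hxy i => (intervalIntegrable_params (hx.trans hxy) (hHi _ (hx.trans hxy))
      hθ i).mono_set (hsub hx hxy)
  rcases hss.eq_or_lt with rfl | hlt
  · have h0 : (fun i => ∫ r in s..s, θ r i) = 0 := by ext i; simp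
    rw [h0, map_zero, canonicalGate_zero]
    exact approximates_refl s
  refine approximates_of_forall fun ε hε => ?_
  rw [zero_add]
  set ℓ := s' - s with hℓ
  have hℓ0 : 0 < ℓ := sub_pos.2 hlt
  obtain ⟨h, hhc, hhI, hhcont, hhint⟩ := Integrable.exists_hasCompactSupport_integral_sub_le
    ((integrable_indicator_iff measurableSet_Ioc).2 (hHxy hs hss).1)
    (show (0 : ℝ) < ε / 16 by positivity)
  have hg : ∀ {x y : ℝ}, 0 ≤ x → x ≤ y → IntervalIntegrable (fun r => ‖Hd r - h r‖) volume x y :=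
    fun hx hxy => ((hHxy hx hxy).sub (hhcont.intervalIntegrable _ _)).norm
  have hgI : ∫ r in s..s', ‖Hd r - h r‖ ≤ ε / 16 := by
    refine le_trans ?_ hhI
    rw [intervalIntegral.integral_of_le hss]
    have h1 : ∫ r in Ioc s s', ‖Hd r - h r‖ = ∫ r in Ioc s s', ‖(Ioc s s').indicator Hd r - h r‖ :=
      setIntegral_congr_fun measurableSet_Ioc fun r hr => by simp only [indicator_of_mem hr]
    rw [h1]
    exact setIntegral_le_integral (((integrable_indicator_iff measurableSet_Ioc).2
      (hHxy hs hss).1).sub hhint).norm (Filter.Eventually.of_forall fun _ => norm_nonneg _)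
  -- The bound `β` below adds up to `8 (ε / 16) + 4 ω ℓ = ε` over the whole interval.
  set ω : ℝ := ε / (8 * ℓ) with hω
  have hω0 : 0 < ω := by positivity
  obtain ⟨δ, hδ, hδω⟩ := Metric.uniformContinuous_iff.1
    (hhcont.uniformContinuous_of_tendsto_cocompact hhc.is_zero_at_infty) ω hω0
  set β : ℝ → ℝ → ℝ := fun x y => 4 * (2 * (∫ r in x..y, ‖Hd r - h r‖) + ω * (y - x)) with hβ
  have hcell : ∀ {u v}, s ≤ u → u ≤ v → v - u < δ →
      Approximates Hd u v (β u v) (canonicalGate (Φ fun i => ∫ r in u..v, θ r i)) := by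
    intro u v hsu huv hvu
    have hu : 0 ≤ u := hs.trans hsu
    rcases huv.eq_or_lt with rfl | huv'
    · have h0 : (fun i => ∫ r in u..u, θ r i) = 0 := by ext i; simp
      rw [h0, map_zero, canonicalGate_zero]
      simpa [hβ] using approximates_refl u
    -- A sample point where the error of the approximation by `h` is at most its average.
    obtain ⟨τ, hτm, hτ⟩ := exists_le_setAverage (μ := volume) (s := Ioc u v)
      (f := fun r => ‖Hd r - h r‖) (by simp [huv']) (by simp) (hg hu huv).1
    rw [setAverage_eq, smul_eq_mul, Real.volume_real_Ioc_of_le huv,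
      ← intervalIntegral.integral_of_le huv, inv_mul_eq_div,
      le_div_iff₀ (sub_pos.2 huv')] at hτ
    have hτ0 : 0 ≤ τ := hu.trans hτm.1.le
    refine (approximates_sample hHh hθ hΦ hu huv hτ0 (hHxy hu huv) (hθxy hu huv)).mono ?_
    have h1 : ∫ r in u..v, ‖Hd r - Hd τ‖ ≤ ∫ r in u..v, (‖Hd r - h r‖ + (ω + ‖Hd τ - h τ‖)) := by
      refine intervalIntegral.integral_mono_on huv ((hHxy hu huv).sub intervalIntegrable_const).norm
        ((hg hu huv).add intervalIntegrable_const) fun r hr => ?_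
      have h2 : dist (h r) (h τ) < ω := hδω (by
        rw [Real.dist_eq, abs_lt]
        constructor <;> linarith [hr.1, hr.2, hτm.1, hτm.2])
      rw [dist_eq_norm] at h2
      have h3 : Hd r - Hd τ = (Hd r - h r) + ((h r - h τ) - (Hd τ - h τ)) := by abel
      rw [h3]
      refine (norm_add_le _ _).trans ?_
      have := norm_sub_le (h r - h τ) (Hd τ - h τ)
      linarith
    rw [intervalIntegral.integral_add (hg hu huv) intervalIntegrable_const,
      intervalIntegral.integral_const, smul_eq_mul] at h1
    simp only [hβ]
    nlinarith
  obtain ⟨N, hN⟩ := exists_nat_gt (ℓ / δ)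
  have hN0 : (0 : ℝ) < N := lt_trans (by positivity) hN
  set d := ℓ / N with hd
  have hd0 : 0 < d := by positivity
  have hdδ : d < δ := by
    rw [hd, div_lt_iff₀ hN0]
    rw [div_lt_iff₀ hδ] at hN
    linarith
  have key : ∀ k : ℕ, Approximates Hd s (s + k * d) (β s (s + k * d))
      (canonicalGate (Φ fun i => ∫ r in s..s + k * d, θ r i)) := by
    intro k
    induction k with
    | zero =>
      have := hcell (le_refl s) (le_refl s) (by simpa using hδ)
      simpa using this
    | succ k ih =>
      have hk : 0 ≤ (k : ℝ) * d := by positivity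
      have e : s + ((k + 1 : ℕ) : ℝ) * d = s + k * d + d := by push_cast; ring
      rw [e]
      have l1 : s ≤ s + k * d := by linarith
      have l2 : s + k * d ≤ s + k * d + d := by linarith
      have l0 : 0 ≤ s + k * d := by linarith
      have hstep := hcell l1 l2 (by linarith)
      have := Approximates.trans l1 l2 (hHxy hs (l1.trans l2)) hHh (norm_canonicalGate_le _)
        ih hstep
      rw [← canonicalGate_add, ← map_add] at this
      have e1 : (fun i => ∫ r in s + k * d..s + k * d + d, θ r i) +
          (fun i => ∫ r in s..s + k * d, θ r i) = fun i => ∫ r in s..s + k * d + d, θ r i := by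
        ext i
        rw [Pi.add_apply, add_comm]
        exact intervalIntegral.integral_add_adjacent_intervals (hθxy hs l1 i) (hθxy l0 l2 i)
      have e2 : β s (s + k * d) + β (s + k * d) (s + k * d + d) = β s (s + k * d + d) := by
        simp only [hβ]
        rw [← intervalIntegral.integral_add_adjacent_intervals (hg hs l1) (hg l0 l2)]
        ring
      rwa [e1, e2] at this
  have hfin := key N
  have e : s + N * d = s' := by
    rw [hd, mul_div_cancel₀ _ hN0.ne', hℓ]; ring
  rw [e] at hfin
  refine hfin.mono ?_
  simp only [hβ]
  have : ω * (s' - s) = ε / 8 := by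
    rw [← hℓ, hω]; field_simp
  rw [this]
  linarith

end Sufficiency

end TwoQubit

/-! ### Generation of gates and minimum time -/

namespace TwoQubit

open Matrix MeasureTheory Set Filter Topology
open scoped Matrix.Norms.L2Operator

section Generation

theorem tendsto_primitive {E : Type*} [NormedAddCommGroup E] [NormedSpace ℝ E] {f : ℝ → E}
    (hf : ∀ T, 0 ≤ T → IntervalIntegrable f volume 0 T) {S k : ℝ} (hS : 0 ≤ S) (hk : 0 ≤ k) :
    Tendsto (fun η => ∫ r in (0 : ℝ)..S + k * η, f r) (𝓝[>] 0) (𝓝 (∫ r in (0 : ℝ)..S, f r)) := by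
  have hS1 : (0 : ℝ) ≤ S + 1 := by linarith
  have hc := intervalIntegral.continuousOn_primitive_interval' (hf (S + 1) hS1) left_mem_uIcc
  rw [uIcc_of_le hS1] at hc
  have hlim : Tendsto (fun η : ℝ => S + k * η) (𝓝[>] 0) (𝓝 S) := by
    have : Continuous fun η : ℝ => S + k * η := by fun_prop
    exact (this.tendsto' 0 S (by simp)).mono_left nhdsWithin_le_nhds
  refine (hc S ⟨hS, by linarith⟩).tendsto.comp (tendsto_nhdsWithin_iff.2 ⟨hlim, ?_⟩)
  filter_upwards [hlim.eventually_le_const (show S < S + 1 by linarith), self_mem_nhdsWithin]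
    with η h1 h2
  have : 0 ≤ k * η := mul_nonneg hk (le_of_lt h2)
  exact ⟨by linarith, h1⟩

theorem Steers.mem_reachable {Hd : ℝ → Op} {τ T : ℝ} {X : Op} (hτ : 0 ≤ τ) (hT : τ ≤ T)
    (hH : IntervalIntegrable Hd volume 0 τ) (hX : Steers Hd 0 τ X) : X ∈ reachable Hd T := by
  obtain ⟨a, b, ha, hb, V, hV, hV0, rfl⟩ := hX
  exact ⟨τ, hτ, hT, a, b, ha, hb, V, (isPropagator_iff hτ
    (hH.add (intervalIntegrable_localHam ha hb))).2 ⟨hV, hV0⟩, rfl⟩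

/-- Up to a phase, a gate is the canonical gate of any shift of its parameters between two local
rotations generated by local Hamiltonians. -/
theorem IsGateParams.exists_eq {U : Op} {β : Fin 3 → ℝ} (h : IsGateParams U β) (n : Fin 3 → ℤ) :
    ∃ c : ℂ, ‖c‖ = 1 ∧ ∃ a b a' b' : Fin 3 → ℝ,
      c • U = NormedSpace.exp ((-Complex.I) • localHam a b) * (canonicalGate (shifted β n) *
        NormedSpace.exp ((-Complex.I) • localHam a' b')) := by
  obtain ⟨-, -, -, A₁, hA₁, B₁, hB₁, A₂, hA₂, B₂, hB₂, rfl⟩ := h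
  set N := canonicalGate fun j => Real.pi / 2 * (n j : ℝ) with hN
  have hshift : canonicalGate β = canonicalGate (shifted β n) * Nᴴ := by
    have h1 : shifted β n = β + fun j => Real.pi / 2 * (n j : ℝ) := rfl
    rw [h1, canonicalGate_add, mul_assoc, mem_unitaryGroup_mul (canonicalGate_mem _), mul_one]
  obtain ⟨c, hc, a, b, h1⟩ := (isLocal_kronecker hA₁ hB₁).exists_exp
  obtain ⟨d, hd, a', b', h2⟩ :=
    ((isLocal_canonicalGate n).conjTranspose.mul (isLocal_kronecker hA₂ hB₂)).exists_exp
  have hcd : ‖c * d‖ = 1 := by rw [norm_mul, hc, hd, one_mul]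
  have hcd0 : c * d ≠ 0 := norm_pos_iff.1 (by rw [hcd]; exact one_pos)
  refine ⟨(c * d)⁻¹, by rw [norm_inv, hcd, inv_one], a, b, a', b', ?_⟩
  rw [inv_smul_eq_iff₀ hcd0]
  calc (A₁ ⊗ₖ B₁) * canonicalGate β * (A₂ ⊗ₖ B₂)
      = (A₁ ⊗ₖ B₁) * (canonicalGate (shifted β n) * (Nᴴ * (A₂ ⊗ₖ B₂))) := by
        rw [hshift]; noncomm_ring
    _ = _ := by
        rw [h2, h1, mul_smul_comm, smul_mul_smul_comm]

variable {M : ℝ → Matrix (Fin 3) (Fin 3) ℝ} {θ : ℝ → Fin 3 → ℝ} {U : Op} {θU : Fin 3 → ℝ} {T : ℝ}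

/-- Sufficiency: the gate is performed by a local pulse, the scheme for a convex combination of
equivalent forms of the drift, and a final local pulse. -/
theorem canGenerate_of_sMajorized (hT : 0 ≤ T)
    (hM : ∀ i j, ∀ T : ℝ, 0 ≤ T → IntervalIntegrable (fun t => M t i j) volume 0 T)
    (hθ : ∀ t, 0 ≤ t → IsHamParams (couplingHam (M t)) (θ t)) (hU : IsGateParams U θU)
    {n : Fin 3 → ℤ} (h : SMajorized (shifted θU n) (integralVec θ T)) :
    CanGenerate (fun t => couplingHam (M t)) T U := by
  set Hd : ℝ → Op := fun t => couplingHam (M t) with hHd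
  have hHi : ∀ T, 0 ≤ T → IntervalIntegrable Hd volume 0 T := fun T hT =>
    intervalIntegrable_couplingHam fun i j => hM i j T hT
  have hHh : ∀ t, (Hd t)ᴴ = Hd t := fun t => couplingHam_conjTranspose _
  have hθi : ∀ T, 0 ≤ T → ∀ i, IntervalIntegrable (fun t => θ t i) volume 0 T := fun T hT i =>
    intervalIntegrable_params hT (hHi T hT) hθ i
  obtain ⟨Φ, hΦ, hΦx⟩ := h.exists_convexHull
    (isOrdered_integralVec hT (hθi T hT) fun t ht => (hθ t ht).isOrdered)
  obtain ⟨c, hc, a, b, a', b', hcU⟩ := hU.exists_eq n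
  refine ⟨c, hc, fun δ hδ => Metric.mem_closure_iff.2 fun ε hε => ?_⟩
  set y : ℝ → Fin 3 → ℝ := fun η i => ∫ r in η..T + η, θ r i with hy
  -- The cost of the two pulses and of the delay of the main part tends to zero.
  have hlim : Tendsto (fun η => (∫ r in (0 : ℝ)..η, ‖Hd r‖) +
      (∫ r in T + η..T + 2 * η, ‖Hd r‖) + ∑ i, |y η i - integralVec θ T i|) (𝓝[>] 0) (𝓝 0) := by
    have n0 := tendsto_primitive (fun T hT => (hHi T hT).norm) le_rfl zero_le_one
    have n1 := tendsto_primitive (fun T hT => (hHi T hT).norm) hT zero_le_one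
    have n2 := tendsto_primitive (fun T hT => (hHi T hT).norm) hT zero_le_two
    have t0 := fun i => tendsto_primitive (fun T hT => hθi T hT i) le_rfl zero_le_one
    have t1 := fun i => tendsto_primitive (fun T hT => hθi T hT i) hT zero_le_one
    have hsum := (n0.add (n2.sub n1)).add (tendsto_finsetSum Finset.univ fun i _ =>
      (((t1 i).sub (t0 i)).sub_const (integralVec θ T i)).abs)
    simp only [intervalIntegral.integral_same, zero_add, one_mul, sub_self, sub_zero, add_zero,
      integralVec, abs_zero, Finset.sum_const_zero] at hsum
    refine hsum.congr' ?_
    filter_upwards [self_mem_nhdsWithin] with η hη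
    have hη0 : (0 : ℝ) ≤ η := le_of_lt hη
    rw [intervalIntegral.integral_interval_sub_left (hHi _ (by linarith)).norm
      (hHi _ (by linarith)).norm]
    congr 1
    refine Finset.sum_congr rfl fun i _ => ?_
    rw [intervalIntegral.integral_interval_sub_left (hθi _ (by linarith) i)
      (hθi _ (by linarith) i)]
    rfl
  have hsmall : ∀ᶠ η : ℝ in 𝓝[>] 0, η < δ / 2 :=
    nhdsWithin_le_nhds (Iio_mem_nhds (half_pos hδ))
  obtain ⟨η, hη, hηδ, hη0⟩ :=
    ((hlim.eventually_lt_const hε).and (hsmall.and self_mem_nhdsWithin)).exists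
  have hη0 : 0 < η := hη0
  have l1 : η ≤ T + η := by linarith
  have l2 : T + η < T + 2 * η := by linarith
  have hsub : ∀ {x z : ℝ}, 0 ≤ x → x ≤ z → IntervalIntegrable Hd volume x z :=
    fun {x z} hx hxz => (hHi z (hx.trans hxz)).mono_set (by
      rw [uIcc_of_le hxz, uIcc_of_le (hx.trans hxz)]; exact Icc_subset_Icc_left hx)
  have p1 := approximates_pulse hη0 (hsub le_rfl hη0.le) hHh a' b'
  have p2 := approximates_integral hHi hHh hθ hΦ hη0.le l1
  have p3 := approximates_pulse l2 (hsub (by linarith) l2.le) hHh a b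
  have p12 := Approximates.trans hη0.le l1 (hsub le_rfl (by linarith)) hHh
    (norm_canonicalGate_le _) p1 p2
  have p123 := Approximates.trans (by linarith) l2.le (hsub le_rfl (by linarith)) hHh
    (norm_le_one_of_mem_unitaryGroup (exp_localHam_mem a b)) p12 p3
  have pfin := p123.perturb (E' := c • U)
  have hdist : ‖NormedSpace.exp ((-Complex.I) • localHam a b) * (canonicalGate (Φ (y η)) *
      NormedSpace.exp ((-Complex.I) • localHam a' b')) - c • U‖
      ≤ ∑ i, |y η i - integralVec θ T i| := by
    rw [hcU, ← mul_sub, ← sub_mul, ← hΦx]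
    refine (norm_mul_le _ _).trans ?_
    refine (mul_le_of_le_one_left (norm_nonneg _)
      (norm_le_one_of_mem_unitaryGroup (exp_localHam_mem a b))).trans ?_
    refine (norm_mul_le _ _).trans ?_
    refine (mul_le_of_le_one_right (norm_nonneg _)
      (norm_le_one_of_mem_unitaryGroup (exp_localHam_mem a' b'))).trans ?_
    refine (norm_canonicalGate_sub_le _ _).trans ?_
    have e : ∀ i, Φ (y η) i - Φ (integralVec θ T) i = Φ (y η - integralVec θ T) i := fun i => by
      rw [map_sub, Pi.sub_apply]
    simp only [e]
    exact sum_abs_le_of_mem_convexHull hΦ _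
  obtain ⟨X, hX, hXE⟩ := pfin _ (sub_pos.2 hη)
  refine ⟨X, hX.mem_reachable (by linarith) (by linarith) (hsub le_rfl (by linarith)), ?_⟩
  rw [dist_comm, dist_eq_norm]
  simp only [hy] at hdist hη hXE
  linarith

/-- If `x` is `s`-majorized by the integrated parameters at some time, there is a first such
time. -/
theorem exists_isLeast_sMajorized {x x' : Fin 3 → ℝ}
    (hθi : ∀ T, 0 ≤ T → ∀ i, IntervalIntegrable (fun t => θ t i) volume 0 T)
    (hθ : ∀ t, 0 ≤ t → IsOrdered (θ t))
    (h : ∃ T : ℝ, 0 ≤ T ∧ (SMajorized x (integralVec θ T) ∨ SMajorized x' (integralVec θ T))) :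
    ∃ Tmin : ℝ, IsLeast {T : ℝ | 0 ≤ T ∧
      (SMajorized x (integralVec θ T) ∨ SMajorized x' (integralVec θ T))} Tmin := by
  obtain ⟨T, hT, hmaj⟩ := h
  have hcont : ContinuousOn (integralVec θ) (Icc 0 T) := by
    refine continuousOn_pi.2 fun i => ?_
    have := intervalIntegral.continuousOn_primitive_interval' (hθi T hT i) left_mem_uIcc
    rwa [uIcc_of_le hT] at this
  have hclosed : ∀ x : Fin 3 → ℝ, IsClosed {y : Fin 3 → ℝ | sOrder x 0 ≤ y 0 ∧
      sOrder x 0 + sOrder x 1 + sOrder x 2 ≤ y 0 + y 1 + y 2 ∧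
      sOrder x 0 + sOrder x 1 - sOrder x 2 ≤ y 0 + y 1 - y 2} := fun x =>
    (isClosed_le (g := fun y : Fin 3 → ℝ => y 0) continuous_const (by fun_prop)).inter
      ((isClosed_le (g := fun y : Fin 3 → ℝ => y 0 + y 1 + y 2) continuous_const
        (by fun_prop)).inter
        (isClosed_le (g := fun y : Fin 3 → ℝ => y 0 + y 1 - y 2) continuous_const (by fun_prop)))
  have hself : ∀ S, 0 ≤ S → sOrder (integralVec θ S) = integralVec θ S := fun S hS =>
    sOrder_eq_self (isOrdered_integralVec hS (hθi S hS) hθ)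
  have hK : IsCompact {S | S ∈ Icc 0 T ∧
      (SMajorized x (integralVec θ S) ∨ SMajorized x' (integralVec θ S))} := by
    have h1 := hcont.preimage_isClosed_of_isClosed isClosed_Icc ((hclosed x).union (hclosed x'))
    refine isCompact_Icc.of_isClosed_subset (s := Icc 0 T) ?_ fun S hS => hS.1
    convert h1 using 1
    ext S
    constructor
    · rintro ⟨hS, hm⟩
      refine ⟨hS, ?_⟩
      simp only [SMajorized, hself S hS.1] at hm
      exact hm
    · rintro ⟨hS, hm⟩
      refine ⟨hS, ?_⟩
      simp only [SMajorized, hself S hS.1]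
      exact hm
  obtain ⟨S, ⟨hS, hm⟩, hleast⟩ := hK.exists_isLeast ⟨T, ⟨hT, le_rfl⟩, hmaj⟩
  refine ⟨S, ⟨hS.1, hm⟩, fun R ⟨hR, hRm⟩ => ?_⟩
  rcases le_total R T with h | h
  · exact hleast ⟨⟨hR, h⟩, hRm⟩
  · exact hS.2.trans h

end Generation

end TwoQubit

theorem mainTheorem2
    (M : ℝ → Matrix (Fin 3) (Fin 3) ℝ)
    (hM : ∀ i j, ∀ T : ℝ, 0 ≤ T →
      IntervalIntegrable (fun t => M t i j) MeasureTheory.volume 0 T)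
    (θH : ℝ → Fin 3 → ℝ)
    (hθH : ∀ t : ℝ, 0 ≤ t → TwoQubit.IsHamParams (TwoQubit.couplingHam (M t)) (θH t))
    (U : TwoQubit.Op) (hU : U ∈ Matrix.unitaryGroup (Fin 2 × Fin 2) ℂ)
    (θU : Fin 3 → ℝ) (hθU : TwoQubit.IsGateParams U θU) :
    (∀ T : ℝ, 0 ≤ T →
      (TwoQubit.CanGenerate (fun t => TwoQubit.couplingHam (M t)) T U ↔
        ∃ n : Fin 3 → ℤ,
          TwoQubit.SMajorized (TwoQubit.shifted θU n) (TwoQubit.integralVec θH T))) ∧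
    (∀ Tmin : ℝ,
      IsLeast {T : ℝ | 0 ≤ T ∧
        TwoQubit.CanGenerate (fun t => TwoQubit.couplingHam (M t)) T U} Tmin ↔
      IsLeast {T : ℝ | 0 ≤ T ∧
        (TwoQubit.SMajorized (TwoQubit.shifted θU ![0, 0, 0]) (TwoQubit.integralVec θH T) ∨
         TwoQubit.SMajorized (TwoQubit.shifted θU ![-1, 0, 0])
           (TwoQubit.integralVec θH T))} Tmin) ∧
    ((∃ T : ℝ, 0 ≤ T ∧ TwoQubit.CanGenerate (fun t => TwoQubit.couplingHam (M t)) T U) →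
      ∃ Tmin : ℝ, IsLeast {T : ℝ | 0 ≤ T ∧
        TwoQubit.CanGenerate (fun t => TwoQubit.couplingHam (M t)) T U} Tmin) := by
  have hθi : ∀ T : ℝ, 0 ≤ T → ∀ i,
      IntervalIntegrable (fun t => θH t i) MeasureTheory.volume 0 T := fun T hT i =>
    TwoQubit.intervalIntegrable_params hT
      (TwoQubit.intervalIntegrable_couplingHam fun i j => hM i j T hT) hθH i
  have hord : ∀ t : ℝ, 0 ≤ t → TwoQubit.IsOrdered (θH t) := fun t ht => (hθH t ht).isOrdered
  have h1 : ∀ T : ℝ, 0 ≤ T →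
      (TwoQubit.CanGenerate (fun t => TwoQubit.couplingHam (M t)) T U ↔
        ∃ n : Fin 3 → ℤ,
          TwoQubit.SMajorized (TwoQubit.shifted θU n) (TwoQubit.integralVec θH T)) :=
    fun T hT => ⟨fun h => h.exists_sMajorized hT hM hθH hθU,
      fun ⟨_, hn⟩ => TwoQubit.canGenerate_of_sMajorized hT hM hθH hθU hn⟩
  have hset : {T : ℝ | 0 ≤ T ∧
        TwoQubit.CanGenerate (fun t => TwoQubit.couplingHam (M t)) T U} =
      {T : ℝ | 0 ≤ T ∧
        (TwoQubit.SMajorized (TwoQubit.shifted θU ![0, 0, 0]) (TwoQubit.integralVec θH T) ∨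
         TwoQubit.SMajorized (TwoQubit.shifted θU ![-1, 0, 0])
           (TwoQubit.integralVec θH T))} := by
    ext T
    refine and_congr_right fun hT => (h1 T hT).trans ?_
    exact TwoQubit.exists_sMajorized_shifted_iff ⟨hθU.1, hθU.2.1⟩ hθU.2.2.1
      (TwoQubit.isOrdered_integralVec hT (hθi T hT) hord)
  refine ⟨h1, fun Tmin => by rw [hset], fun hex => ?_⟩
  obtain ⟨T, hT⟩ := hex
  rw [hset]
  exact TwoQubit.exists_isLeast_sMajorized hθi hord ⟨T, hset.subset hT⟩
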